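/- Let $p\ge 1$ be fixed. For each $n$ let $\beta^*=(\beta^*_1,\dots,\beta^*_n)\in\mathbb R^n$, $\gamma^*\in\mathbb R^p$ and let $z_{ij}=z_{ji}\in\mathbb R^p$ ($1\le i\neq j\le n$) be covariates; $\beta^*,\gamma^*,z_{ij}$ and the quantities below may depend on $n$. Write $\mu(x)=e^x/(1+e^x)$, $\pi_{ij}(\beta,\gamma)=\beta_i+\beta_j+z_{ij}^\top\gamma$, $\mu_{ij}=\mu(\pi_{ij})$, $z_*=\max_{i\ne j}\|z_{ij}\|_\infty$. Let $a_{ij}=a_{ji}$, $i<j$, be independent Bernoulli variables with $\mathbb P(a_{ij}=1)=\mu_{ij}(\beta^*,\gamma^*)$, and $a_{ii}=0$. For an integer $k_n\ge1$ and $\epsilon_n>0$, the released statistics (calibrated for $(k_n,\epsilon_n)$-edge differential privacy) are $$\tilde d_i=\sum_{j\ne i}a_{ij}+\xi_i\ (1\le i\le n),\qquad \tilde y=\sum_{i}\sum_{j<i}z_{ij}a_{ij}+\eta ,$$ where all noises are independent of each other and of the graph, $\xi_i$ is discrete Laplace, $\mathbb P(\xi_i=x)=\frac{1-\lambda}{1+\lambda}\lambda^{|x|}$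 for $x\in\mathbb Z$ with $\lambda=e^{-\epsilon_n/(4k_n)}$, and the coordinates $\eta_1,\dots,\eta_p$ are Laplace with density $e^{-|x|/\lambda'}/(2\lambda')$, $\lambda'=2pk_nz_*/\epsilon_n$. A moment estimator $(\widehat\beta,\widehat\gamma)$ is a solution of $$\tilde d_i=\sum_{j\neq i}\mu_{ij}(\beta,\gamma)\ (1\le i\le n),\qquad \tilde y=\sum_{i}\sum_{j<i}z_{ij}\,\mu_{ij}(\beta,\gamma)$$ (defined arbitrarily when there is no solution). Let $\epsilon_{n1},\epsilon_{n2}>0$, let $B(x,r)$ be the closed ball of radius $r$ about $x$ in the maximum norm, and put $$b_n=\sup_{\beta\in B(\beta^*,\epsilon_{n1}),\,\gamma\in B(\gamma^*,\epsilon_{n2})}\ \max_{i\ne j}\frac{(1+e^{\pi_{ij}(\beta,\gamma)})^2}{e^{\pi_{ij}(\beta,\gamma)}} .$$ With $F_i=\sum_{j\ne i}\mu_{ij}-\tilde d_i$ and $Q=\sum_i\sum_{j<i}z_{ij}\mu_{ij}-\tilde y$, let $$H(\beta,\gamma)=\frac{\partial Q}{\partial\gamma^\top}-\frac{\partial Q}{\partial\beta^\top}\Big[\frac{\partial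 F}{\partial\beta^\top}\Big]^{-1}\frac{\partial F}{\partial\gamma^\top},$$ and let $\rho_n$ be such that, for all large $n$ and all $\beta\in B(\beta^*,\epsilon_{n1})$, $H(\beta,\gamma^*)$ is invertible and $\|H^{-1}(\beta,\gamma^*)\|_\infty\le\rho_n/n^2$ (maximal absolute row sum). Let $$\tilde\epsilon_n=1+\frac{4k_n}{\epsilon_n}\sqrt{\frac{\log n}{n}},\qquad \tau_n=b_n^3+\frac{k_n}{\epsilon_n}b_n^3+\frac{z_*}{\sqrt{\log n}} .$$ **Theorem.** Suppose that $z_*=O(\log n)$, $$b_n^2\tilde\epsilon_n=o\Big(\sqrt{n/\log n}\Big),\qquad b_n^3\rho_n^2\tau_nz_*^2=o\big(n/\log n\big).$$ Then, as $n\to\infty$, the moment equations have a solution with probability tending to one, and every moment estimator $(\widehat\beta,\widehat\gamma)$ satisfies $$\|\widehat\gamma-\gamma^*\|_\infty=O_p\Big(\frac{\rho_n\tau_n\log n}{n}\Big)=o_p(1),\qquad \|\widehat\beta-\beta^*\|_\infty=O_p\Big(b_n\tilde\epsilon_n\sqrt{\frac{\log n}{n}}\Big)=o_p(1).$$ -/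

import Mathlib

open Filter Topology MeasureTheory Asymptotics

namespace DPBeta

/-! ### The covariate-adjusted beta-model -/

/-- Unordered pairs of distinct nodes, each listed once as `(i, j)` with `i < j`. -/
abbrev Pair (n : ℕ) : Type := {e : Fin n × Fin n // e.1 < e.2}

/-- The logistic function `μ(x) = eˣ / (1 + eˣ)`. -/
noncomputable def mu (x : ℝ) : ℝ := Real.exp x / (1 + Real.exp x)

/-- The linear predictor `π_ij = β_i + β_j + z_ijᵀ γ`. -/
noncomputable def linPred {n p : ℕ} (z : Fin n → Fin n → Fin p → ℝ)
    (β : Fin n → ℝ) (γ : Fin p → ℝ) (i j : Fin n) : ℝ :=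
  β i + β j + ∑ t, z i j t * γ t

/-- The expected degrees `i ↦ ∑_{j ≠ i} μ(π_ij)`. -/
noncomputable def meanDeg {n p : ℕ} (z : Fin n → Fin n → Fin p → ℝ)
    (β : Fin n → ℝ) (γ : Fin p → ℝ) (i : Fin n) : ℝ :=
  ∑ j ∈ Finset.univ.filter (fun j => j ≠ i), mu (linPred z β γ i j)

/-- The expected covariate statistic `∑_i ∑_{j < i} z_ij μ(π_ij)`. -/
noncomputable def meanCov {n p : ℕ} (z : Fin n → Fin n → Fin p → ℝ)
    (β : Fin n → ℝ) (γ : Fin p → ℝ) (t : Fin p) : ℝ :=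
  ∑ i, ∑ j ∈ Finset.univ.filter (fun j => j < i), z i j t * mu (linPred z β γ i j)

/-! ### The data: a random graph and the two kinds of noise -/

/-- A sample: the edge indicators, the integer noises added to the degrees, and the real noises
added to the covariate statistic. -/
abbrev Sample (n p : ℕ) : Type := (Pair n → Bool) × (Fin n → ℤ) × (Fin p → ℝ)

/-- The law of one edge indicator with linear predictor `x`. -/
noncomputable def edgeLaw (x : ℝ) : Measure Bool :=
  ENNReal.ofReal (mu x) • Measure.dirac true + ENNReal.ofReal (1 - mu x) • Measure.dirac false

/-- The discrete Laplace law: mass `(1 - l) / (1 + l) * l ^ |x|` at the integer `x`. -/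
noncomputable def discreteLaplace (l : ℝ) : Measure ℤ :=
  Measure.count.withDensity fun x => ENNReal.ofReal ((1 - l) / (1 + l) * l ^ x.natAbs)

/-- The Laplace law with density `exp (-|x| / l) / (2 l)`. -/
noncomputable def laplace (l : ℝ) : Measure ℝ :=
  volume.withDensity fun x => ENNReal.ofReal (Real.exp (-|x| / l) / (2 * l))

/-- `z_* = max_{i ≠ j} ‖z_ij‖_∞` (the norm of `Fin p → ℝ` is the maximum norm). -/
noncomputable def zMax {n p : ℕ} (z : Fin n → Fin n → Fin p → ℝ) : ℝ :=
  ⨆ e : Pair n, ‖z e.1.1 e.1.2‖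

/-- The joint law of the sample: all edges and all noises are independent, the edge `(i, j)` is
present with probability `μ(π_ij)`, the degree noises are discrete Laplace with parameter
`exp (-ε / (4 k))`, the covariate noises are Laplace with scale `2 p k z_* / ε`. -/
noncomputable def sampleLaw {n p : ℕ} (z : Fin n → Fin n → Fin p → ℝ)
    (β : Fin n → ℝ) (γ : Fin p → ℝ) (k : ℕ) (ε : ℝ) : Measure (Sample n p) :=
  (Measure.pi fun e : Pair n => edgeLaw (linPred z β γ e.1.1 e.1.2)).prod
    ((Measure.pi fun _ : Fin n => discreteLaplace (Real.exp (-ε / (4 * k)))).prod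
      (Measure.pi fun _ : Fin p => laplace (2 * p * k * zMax z / ε)))

/-- The adjacency matrix: symmetric, with zero diagonal. -/
def adj {n : ℕ} (g : Pair n → Bool) (i j : Fin n) : ℝ :=
  if h : i < j then (if g ⟨(i, j), h⟩ then 1 else 0)
  else if h : j < i then (if g ⟨(j, i), h⟩ then 1 else 0)
  else 0

/-- The released degrees `d_i + ξ_i`. -/
noncomputable def noisyDeg {n p : ℕ} (ω : Sample n p) (i : Fin n) : ℝ :=
  (∑ j ∈ Finset.univ.filter (fun j => j ≠ i), adj ω.1 i j) + (ω.2.1 i : ℝ)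

/-- The released covariate statistic `∑_{j < i} a_ij z_ij + η`. -/
noncomputable def noisyCov {n p : ℕ} (z : Fin n → Fin n → Fin p → ℝ) (ω : Sample n p)
    (t : Fin p) : ℝ :=
  (∑ i, ∑ j ∈ Finset.univ.filter (fun j => j < i), z i j t * adj ω.1 i j) + ω.2.2 t

/-- `(β, γ)` solves the moment equations for the released statistics. -/
def SolvesMoment {n p : ℕ} (z : Fin n → Fin n → Fin p → ℝ) (ω : Sample n p)
    (β : Fin n → ℝ) (γ : Fin p → ℝ) : Prop :=
  (∀ i, noisyDeg ω i = meanDeg z β γ i) ∧ (∀ t, noisyCov z ω t = meanCov z β γ t)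

/-- `(βh, γh)` is a moment estimator: it solves the moment equations whenever they have a
solution (and is arbitrary otherwise). -/
def IsMomentEstimator {n p : ℕ} (z : Fin n → Fin n → Fin p → ℝ)
    (βh : Sample n p → Fin n → ℝ) (γh : Sample n p → Fin p → ℝ) : Prop :=
  ∀ ω, (∃ β γ, SolvesMoment z ω β γ) → SolvesMoment z ω (βh ω) (γh ω)

/-! ### The quantities in the conditions -/

/-- `b = sup max_{i ≠ j} (1 + e^{π_ij})² / e^{π_ij}`, the supremum being over the closed balls of
radius `r₁` about `β` and `r₂` about `γ` in the maximum norm. -/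
noncomputable def bSup {n p : ℕ} (z : Fin n → Fin n → Fin p → ℝ)
    (β : Fin n → ℝ) (γ : Fin p → ℝ) (r₁ r₂ : ℝ) : ℝ :=
  sSup {x | ∃ β' ∈ Metric.closedBall β r₁, ∃ γ' ∈ Metric.closedBall γ r₂, ∃ i j : Fin n, i ≠ j ∧
    x = (1 + Real.exp (linPred z β' γ' i j)) ^ 2 / Real.exp (linPred z β' γ' i j)}

/-- The Jacobian matrix at `x` of a map between coordinate spaces: its `(s, t)` entry is the
partial derivative of the `s`-th component in the `t`-th variable. -/
noncomputable def jacobian {m q : ℕ} (f : (Fin q → ℝ) → Fin m → ℝ) (x : Fin q → ℝ) :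
    Matrix (Fin m) (Fin q) ℝ :=
  Matrix.of fun s t => deriv (fun u => f (Function.update x t u) s) (x t)

/-- `H = ∂Q/∂γ - ∂Q/∂β (∂F/∂β)⁻¹ ∂F/∂γ`, where `F` and `Q` are the expected minus the released
degrees and covariate statistics; the released values do not depend on the parameters, so they
do not enter the derivatives. -/
noncomputable def fisherH {n p : ℕ} (z : Fin n → Fin n → Fin p → ℝ)
    (β : Fin n → ℝ) (γ : Fin p → ℝ) : Matrix (Fin p) (Fin p) ℝ :=
  jacobian (fun γ' => meanCov z β γ') γ -
    jacobian (fun β' => meanCov z β' γ) β *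
      (jacobian (fun β' => meanDeg z β' γ) β)⁻¹ *
      jacobian (fun γ' => meanDeg z β γ') γ

/-- The matrix norm induced by the maximum norm: the largest absolute row sum. -/
noncomputable def rowSumNorm {m q : ℕ} (M : Matrix (Fin m) (Fin q) ℝ) : ℝ :=
  ⨆ s, ∑ t, |M s t|

/-- `ε̃ = 1 + (4 k / ε) √(log n / n)`. -/
noncomputable def epsTilde (n k : ℕ) (ε : ℝ) : ℝ :=
  1 + 4 * k / ε * √(Real.log n / n)

/-- `τ = b³ + (k / ε) b³ + z_* / √(log n)`. -/
noncomputable def tau (n k : ℕ) (ε b zs : ℝ) : ℝ :=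
  b ^ 3 + k / ε * b ^ 3 + zs / √(Real.log n)

/-! ### Stochastic order symbols -/

/-- `X_n = O_P(r_n)`, for `X_n` on a space with measure `P_n`. -/
def IsBigOP {Ω : ℕ → Type*} [∀ n, MeasurableSpace (Ω n)] (P : ∀ n, Measure (Ω n))
    (X : ∀ n, Ω n → ℝ) (r : ℕ → ℝ) : Prop :=
  ∀ δ : ℝ, 0 < δ → ∃ M : ℝ, 0 < M ∧
    ∀ᶠ n in atTop, P n {ω | M * r n < |X n ω|} ≤ ENNReal.ofReal δ

/-- `X_n = o_P(1)`: convergence to zero in probability. -/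
def IsLittleOPOne {Ω : ℕ → Type*} [∀ n, MeasurableSpace (Ω n)] (P : ∀ n, Measure (Ω n))
    (X : ∀ n, Ω n → ℝ) : Prop :=
  ∀ δ : ℝ, 0 < δ → Tendsto (fun n => P n {ω | δ < |X n ω|}) atTop (𝓝 0)

end DPBeta

open DPBeta

namespace DPBeta

/-! ### Sums over pairs and over rows -/

/-! Everything is expanded at the true parameter. Let `v` be the edge variances there, so that `1 /
b ≤ v ≤ 1`, let `D` be the change of the linear predictor, and put κ = k/ε, Z = z_* and s = √(log n
/ n). A solution in a small box satisfies the linearized equations up to a remainder `R` with `|R| ≤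
v * D ^ 2` (`abs_mu_add_sub_le`). The factor `v` is essential: it allows the summed remainder to be
controlled by the energy E = Σ v D² instead of by n² times a squared maximum.

Elimination. Let `w` be the weighted projection of the covariates on the node effects
(`exists_profile`). The residual z_ij − w_i − w_j is `v`-orthogonal to every array y_i + y_j, so the
node parameters drop out: H applied to the covariate error is the projected noise minus a
residual-weighted sum of `R` (`profile_mulVec_eq`). Testing the equations against the solution
itself bounds E by the sum of squares of the degree noise and by the projected noise (`energy_le`).
With the bound on the inverse of `H` this controls the covariate error. The node error then follows
row by row, because the inverse of a signless Laplacian with weights at least `1 / b` has row-sum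
norm at most 8b/n (`abs_le_of_rowSum_le`).

Existence and uniqueness. These estimates show that a solution in the box lies strictly inside it
(`norm_lt_of_moment_eq`), also when the noise is multiplied by a number in [0, 1]. The moment map is
open, so a solution can be continued from zero noise to the actual noise without reaching the
boundary of the box (`exists_solution_of_interior`). Since `mu` is strictly increasing and the
predictor is injective in the parameters, the solution is unique (`solution_unique`), so the bounds
hold for every moment estimator.

Noise and rates. Hoeffding's inequality and the exponential moments of the discrete Laplace law
bound the largest degree noise; second moments bound the sum of squares by a multiple of n(n + κ²)
and the projected noise by a multiple of b²Z(n + κ²) (`noise_tail`). This gives a covariate error of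
order ρb²Z(n + κ²)/n², which is at most of order ρτ log n / n (`second_order_le_tau`), and a node
error of order b ε̃ s. The inequality 1 ≤ ρZ² (`one_le_rho_mul_zMax_sq`) lets the two hypotheses of
the theorem imply all the smallness that is needed. -/

/-- The sum of `f i j` over the pairs `j < i`. -/
noncomputable def pairSum {n : ℕ} (f : Fin n → Fin n → ℝ) : ℝ :=
  ∑ i, ∑ j ∈ Finset.univ.filter (fun j => j < i), f i j

/-- The sum of the off-diagonal entries of the `i`-th row. -/
noncomputable def rowSum {n : ℕ} (f : Fin n → Fin n → ℝ) (i : Fin n) : ℝ :=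
  ∑ j ∈ Finset.univ.filter (fun j => j ≠ i), f i j

theorem pairSum_congr {n : ℕ} {f g : Fin n → Fin n → ℝ} (h : ∀ i j, i ≠ j → f i j = g i j) :
    pairSum f = pairSum g := by
  refine Finset.sum_congr rfl fun i _ => Finset.sum_congr rfl fun j hj => h i j ?_
  exact (Finset.mem_filter.1 hj).2.ne'

theorem pairSum_le_pairSum {n : ℕ} {f g : Fin n → Fin n → ℝ}
    (h : ∀ i j, i ≠ j → f i j ≤ g i j) : pairSum f ≤ pairSum g := by
  refine Finset.sum_le_sum fun i _ => Finset.sum_le_sum fun j hj => h i j ?_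
  exact (Finset.mem_filter.1 hj).2.ne'

theorem pairSum_nonneg {n : ℕ} {f : Fin n → Fin n → ℝ} (h : ∀ i j, i ≠ j → 0 ≤ f i j) :
    0 ≤ pairSum f :=
  Finset.sum_nonneg fun i _ => Finset.sum_nonneg fun j hj =>
    h i j (Finset.mem_filter.1 hj).2.ne'

theorem pairSum_add {n : ℕ} (f g : Fin n → Fin n → ℝ) :
    pairSum (fun i j => f i j + g i j) = pairSum f + pairSum g := by
  simp [pairSum, Finset.sum_add_distrib]

theorem pairSum_sub {n : ℕ} (f g : Fin n → Fin n → ℝ) :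
    pairSum (fun i j => f i j - g i j) = pairSum f - pairSum g := by
  simp [pairSum, Finset.sum_sub_distrib]

theorem pairSum_const_mul {n : ℕ} (c : ℝ) (f : Fin n → Fin n → ℝ) :
    pairSum (fun i j => c * f i j) = c * pairSum f := by
  simp [pairSum, Finset.mul_sum]

theorem pairSum_sum {n : ℕ} {ι : Type*} (s : Finset ι) (f : ι → Fin n → Fin n → ℝ) :
    pairSum (fun i j => ∑ t ∈ s, f t i j) = ∑ t ∈ s, pairSum (f t) := by
  simp only [pairSum]
  rw [Finset.sum_comm]
  refine Finset.sum_congr rfl fun i _ => ?_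
  rw [Finset.sum_comm]

theorem abs_pairSum_le {n : ℕ} {f g : Fin n → Fin n → ℝ} (h : ∀ i j, i ≠ j → |f i j| ≤ g i j) :
    |pairSum f| ≤ pairSum g := by
  refine (Finset.abs_sum_le_sum_abs _ _).trans (Finset.sum_le_sum fun i _ => ?_)
  refine (Finset.abs_sum_le_sum_abs _ _).trans (Finset.sum_le_sum fun j hj => h i j ?_)
  exact (Finset.mem_filter.1 hj).2.ne'

theorem pairSum_eq_zero_imp {n : ℕ} {f : Fin n → Fin n → ℝ} (h : ∀ i j, i ≠ j → 0 ≤ f i j)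
    (h0 : pairSum f = 0) (i j : Fin n) (hij : j < i) : f i j = 0 := by
  have h1 := (Finset.sum_eq_zero_iff_of_nonneg (fun i _ => Finset.sum_nonneg fun j hj =>
    h i j (Finset.mem_filter.1 hj).2.ne')).1 h0 i (Finset.mem_univ _)
  exact (Finset.sum_eq_zero_iff_of_nonneg (fun j hj =>
    h i j (Finset.mem_filter.1 hj).2.ne')).1 h1 j (by simp [hij])

theorem rowSum_congr {n : ℕ} {f g : Fin n → Fin n → ℝ} (i : Fin n)
    (h : ∀ j, i ≠ j → f i j = g i j) : rowSum f i = rowSum g i := by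
  refine Finset.sum_congr rfl fun j hj => h j ?_
  exact (Finset.mem_filter.1 hj).2.symm

theorem rowSum_le_rowSum {n : ℕ} {f g : Fin n → Fin n → ℝ} (i : Fin n)
    (h : ∀ j, i ≠ j → f i j ≤ g i j) : rowSum f i ≤ rowSum g i := by
  refine Finset.sum_le_sum fun j hj => h j ?_
  exact (Finset.mem_filter.1 hj).2.symm

theorem rowSum_sub {n : ℕ} (f g : Fin n → Fin n → ℝ) (i : Fin n) :
    rowSum (fun i j => f i j - g i j) i = rowSum f i - rowSum g i := by
  simp [rowSum, Finset.sum_sub_distrib]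

theorem rowSum_const {n : ℕ} (c : ℝ) (i : Fin n) :
    rowSum (fun _ _ => c) i = ((n : ℝ) - 1) * c := by
  have h := Finset.sum_erase_add (s := Finset.univ) (f := fun _ : Fin n => c)
    (Finset.mem_univ i)
  rw [rowSum, Finset.filter_ne']
  simp only [Finset.sum_const, Finset.card_univ, Fintype.card_fin, nsmul_eq_mul] at h ⊢
  linarith

theorem rowSum_col {n : ℕ} (x : Fin n → ℝ) (i : Fin n) :
    rowSum (fun _ j => x j) i = ∑ j, x j - x i := by
  have h := Finset.sum_erase_add (s := Finset.univ) (f := x) (Finset.mem_univ i)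
  rw [rowSum, Finset.filter_ne']
  linarith

theorem abs_rowSum_le {n : ℕ} {f : Fin n → Fin n → ℝ} {c : ℝ} (hc : 0 ≤ c) (i : Fin n)
    (h : ∀ j, i ≠ j → |f i j| ≤ c) : |rowSum f i| ≤ n * c := by
  refine (Finset.abs_sum_le_sum_abs _ _).trans ?_
  have : ∑ j ∈ Finset.univ.filter (fun j => j ≠ i), |f i j| ≤ rowSum (fun _ _ => c) i :=
    Finset.sum_le_sum fun j hj => h j (Finset.mem_filter.1 hj).2.symm
  rw [rowSum_const] at this
  linarith

/-- Summation by parts: row sums of a symmetric array tested against `x`. -/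
theorem sum_mul_rowSum {n : ℕ} (x : Fin n → ℝ) {c : Fin n → Fin n → ℝ}
    (hc : ∀ i j, c i j = c j i) :
    ∑ i, x i * rowSum c i = pairSum fun i j => (x i + x j) * c i j := by
  have h1 : ∀ i : Fin n, x i * rowSum c i
      = ∑ j ∈ Finset.univ.filter (fun j => j < i), x i * c i j
        + ∑ j ∈ Finset.univ.filter (fun j => i < j), x i * c i j := by
    intro i
    rw [rowSum, Finset.mul_sum, ← Finset.sum_union]
    · refine Finset.sum_congr ?_ fun _ _ => rfl
      ext j
      simp [lt_or_lt_iff_ne]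
    · rw [Finset.disjoint_left]
      intro j hj hj'
      simp only [Finset.mem_filter, Finset.mem_univ, true_and] at hj hj'
      exact lt_asymm hj hj'
  have h2 : ∑ i, ∑ j ∈ Finset.univ.filter (fun j => i < j), x i * c i j
      = ∑ i, ∑ j ∈ Finset.univ.filter (fun j => j < i), x j * c i j := by
    simp only [Finset.sum_filter]
    rw [Finset.sum_comm]
    refine Finset.sum_congr rfl fun i _ => Finset.sum_congr rfl fun j _ => ?_
    rw [hc]
  simp only [h1, Finset.sum_add_distrib, h2, pairSum, add_mul]

theorem two_mul_pairSum_const {n : ℕ} (c : ℝ) :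
    2 * pairSum (fun _ _ : Fin n => c) = n * (n - 1) * c := by
  have h := sum_mul_rowSum (fun _ : Fin n => (1 : ℝ)) (c := fun _ _ => c) fun _ _ => rfl
  simp only [rowSum_const, Finset.sum_const, Finset.card_univ, Fintype.card_fin,
    nsmul_eq_mul, one_mul] at h
  rw [pairSum_const_mul] at h
  linarith

theorem pairSum_const_le {n : ℕ} {c : ℝ} (hc : 0 ≤ c) :
    pairSum (fun _ _ : Fin n => c) ≤ (n : ℝ) ^ 2 * c := by
  have := two_mul_pairSum_const (n := n) c
  have hn : (0 : ℝ) ≤ n := n.cast_nonneg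
  nlinarith [mul_nonneg hn hc, mul_nonneg (mul_nonneg hn hn) hc]

/-! ### Signless Laplacians with weights bounded below -/

/-- Let m be the maximal entry and X the sum of `x`. The row of the maximum gives l((n − 2)m + X) ≤
Y, which suffices unless X < −(n − 2)m/2. In that case, as no entry is below −m, the signs sum to at
most 2. Testing all rows against the signs then bounds Σ|x_i|, and Σ|x_i| ≥ −X is of order nm. -/
theorem le_of_rowSum_le_aux {n : ℕ} (hn : 8 ≤ n) {v : Fin n → Fin n → ℝ} {l Y : ℝ} (hl : 0 < l)
    (hv : ∀ i j, v i j = v j i) (hvl : ∀ i j, i ≠ j → l ≤ v i j) (x : Fin n → ℝ)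
    (hY : ∀ i, |rowSum (fun i j => v i j * (x i + x j)) i| ≤ Y) (k : Fin n)
    (hk : ∀ i, |x i| ≤ x k) : x k ≤ 8 * Y / (n * l) := by
  have hn' : (8 : ℝ) ≤ n := by exact_mod_cast hn
  set s : Fin n → ℝ := fun i => if 0 ≤ x i then 1 else -1 with hs
  set m := x k with hm
  have hm0 : 0 ≤ m := (abs_nonneg _).trans (hk k)
  have hs1 : ∀ i, s i * s i = 1 := fun i => by simp only [hs]; split_ifs <;> norm_num
  have hsabs : ∀ i, |s i| = 1 := fun i => by simp only [hs]; split_ifs <;> norm_num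
  have hsx : ∀ i, s i * x i = |x i| := fun i => by
    simp only [hs]; split_ifs with h
    · rw [abs_of_nonneg h, one_mul]
    · rw [abs_of_neg (not_le.1 h), neg_one_mul]
  have hxs : ∀ i, x i = s i * |x i| := fun i => by rw [← hsx, ← mul_assoc, hs1, one_mul]
  set X := ∑ i, x i
  set σ := ∑ i, s i
  have hY0 : 0 ≤ Y := (abs_nonneg _).trans (hY k)
  have hmaxrow : l * ((n - 2) * m + X) ≤ Y := by
    have h1 : rowSum (fun i j => l * (x i + x j)) k ≤ rowSum (fun i j => v i j * (x i + x j)) k := by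
      refine rowSum_le_rowSum k fun j hj => mul_le_mul_of_nonneg_right (hvl _ _ hj) ?_
      have := neg_abs_le (x j)
      linarith [hk j]
    have h2 : rowSum (fun i j => l * (x i + x j)) k = l * ((n - 2) * m + X) := by
      have : rowSum (fun i j => l * (x i + x j)) k
          = rowSum (fun _ _ => l * m) k + l * rowSum (fun _ j => x j) k := by
        simp only [rowSum, Finset.mul_sum, ← Finset.sum_add_distrib, mul_add, hm]
      rw [this, rowSum_const, rowSum_col]
      ring
    linarith [(le_abs_self _).trans (hY k)]
  have hXσ : -(m * (n - σ) / 2) ≤ X := by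
    have : ∀ i, -(m * (1 - s i) / 2) ≤ x i := fun i => by
      simp only [hs]; split_ifs with h
      · simpa using h
      · have := neg_abs_le (x i)
        have := hk i
        norm_num; linarith
    have h2 := Finset.sum_le_sum fun i (_ : i ∈ Finset.univ) => this i
    have h3 : ∑ i, -(m * (1 - s i) / 2) = -(m * (n - σ) / 2) := by
      rw [Finset.sum_neg_distrib, ← Finset.sum_div, ← Finset.mul_sum, Finset.sum_sub_distrib]
      simp [σ]
    linarith
  have htest : l * ((n - 2) * ∑ i, |x i| + σ * X) ≤ n * Y := by
    have h1 : ∑ i, s i * rowSum (fun i j => v i j * (x i + x j)) i ≤ n * Y := by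
      have : ∀ i ∈ Finset.univ, s i * rowSum (fun i j => v i j * (x i + x j)) i ≤ Y := fun i _ => by
        refine (le_abs_self _).trans ?_
        rw [abs_mul, hsabs, one_mul]
        exact hY i
      simpa using Finset.sum_le_sum this
    rw [sum_mul_rowSum s (fun i j => by rw [hv, add_comm])] at h1
    have h2 : pairSum (fun i j => (s i + s j) * (l * (x i + x j)))
        ≤ pairSum fun i j => (s i + s j) * (v i j * (x i + x j)) := by
      refine pairSum_le_pairSum fun i j hij => ?_
      -- The sign vector is a good test vector because this product equals (1 + s_i s_j)(|x_i| +
      -- |x_j|); hence replacing `v` by its lower bound `l` only decreases the sum.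
      have : 0 ≤ (s i + s j) * (x i + x j) := by
        have h3 : (s i + s j) * (x i + x j) = (1 + s i * s j) * (|x i| + |x j|) := by
          rw [hxs i, hxs j]
          simp only [abs_mul, hsabs, abs_abs, one_mul]
          linear_combination |x i| * hs1 i + |x j| * hs1 j
        rw [h3]
        refine mul_nonneg ?_ (by positivity)
        have := neg_abs_le (s i * s j)
        rw [abs_mul, hsabs, hsabs] at this
        linarith
      nlinarith [mul_le_mul_of_nonneg_right (hvl i j hij) this]
    have h4 := sum_mul_rowSum s (c := fun i j => l * (x i + x j)) fun i j => by rw [add_comm]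
    have h5 : ∀ i, rowSum (fun i j => l * (x i + x j)) i = l * ((n - 2) * x i + X) := fun i => by
      have : rowSum (fun i j => l * (x i + x j)) i
          = rowSum (fun _ _ => l * x i) i + l * rowSum (fun _ j => x j) i := by
        simp only [rowSum, Finset.mul_sum, ← Finset.sum_add_distrib, mul_add]
      rw [this, rowSum_const, rowSum_col]
      ring
    have h6 : ∑ i, s i * rowSum (fun i j => l * (x i + x j)) i
        = l * ((n - 2) * ∑ i, |x i| + σ * X) := by
      have h7 : ∀ i, s i * rowSum (fun i j => l * (x i + x j)) i
          = l * (n - 2) * |x i| + l * X * s i := fun i => by rw [h5, ← hsx]; ring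
      rw [Finset.sum_congr rfl fun i _ => h7 i, Finset.sum_add_distrib, ← Finset.mul_sum,
        ← Finset.mul_sum]
      ring
    linarith
  have hXabs : |X| ≤ ∑ i, |x i| := Finset.abs_sum_le_sum_abs _ _
  rw [le_div_iff₀ (by positivity)]
  rcases le_or_gt (-((n - 2) * m / 2)) X with hX | hX
  · have : l * ((n - 2) * m / 2) ≤ Y :=
      (mul_le_mul_of_nonneg_left (by linarith) hl.le).trans hmaxrow
    nlinarith [mul_nonneg hl.le hm0]
  · have hmpos : 0 < m := by
      rcases hm0.eq_or_lt with h | h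
      · rw [← h] at hX hXσ; simp at hX hXσ; linarith
      · exact h
    have hσ : σ ≤ 2 := by nlinarith
    have hXneg : X < 0 := hX.trans_le (by
      have : 0 ≤ ((n : ℝ) - 2) * m := mul_nonneg (by linarith) hm0
      linarith)
    rw [abs_of_neg hXneg] at hXabs
    have h1 : 2 * X ≤ σ * X := mul_le_mul_of_nonpos_right hσ hXneg.le
    have h2 : ((n : ℝ) - 4) * ((n - 2) * m / 2) ≤ (n - 2) * ∑ i, |x i| + σ * X := by
      have h3 : ((n : ℝ) - 4) * ((n - 2) * m / 2) ≤ (n - 4) * ∑ i, |x i| :=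
        mul_le_mul_of_nonneg_left (by linarith) (by linarith)
      linarith
    -- The constant 8 comes from (n − 4)(n − 2)/2 ≥ n²/8 for n ≥ 8.
    have h3 : (n : ℝ) * (n * m / 8) ≤ (n - 4) * ((n - 2) * m / 2) := by
      nlinarith [mul_nonneg (sub_nonneg.2 hn') hm0, mul_nonneg (mul_nonneg (sub_nonneg.2 hn') hm0)
        (sub_nonneg.2 hn')]
    have h4 : l * ((n : ℝ) * (n * m / 8)) ≤ n * Y :=
      (mul_le_mul_of_nonneg_left (h3.trans h2) hl.le).trans htest
    have h5 : (n : ℝ) * (m * (n * l)) ≤ n * (8 * Y) := by nlinarith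
    exact le_of_mul_le_mul_left h5 (by linarith)

/-- The inverse of the signless Laplacian of weights at least `l` has row-sum norm at most
`8 / (n l)`. -/
theorem abs_le_of_rowSum_le {n : ℕ} (hn : 8 ≤ n) {v : Fin n → Fin n → ℝ} {l Y : ℝ} (hl : 0 < l)
    (hv : ∀ i j, v i j = v j i) (hvl : ∀ i j, i ≠ j → l ≤ v i j) (x : Fin n → ℝ)
    (hY : ∀ i, |rowSum (fun i j => v i j * (x i + x j)) i| ≤ Y) (i : Fin n) :
    |x i| ≤ 8 * Y / (n * l) := by
  obtain ⟨k, -, hk⟩ := Finset.exists_max_image Finset.univ (fun i => |x i|) ⟨i, Finset.mem_univ i⟩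
  refine (hk i (Finset.mem_univ i)).trans ?_
  rcases le_total 0 (x k) with h | h
  · rw [abs_of_nonneg h]
    exact le_of_rowSum_le_aux hn hl hv hvl x hY k fun j => by
      rw [← abs_of_nonneg h]; exact hk j (Finset.mem_univ j)
  · rw [abs_of_nonpos h]
    refine le_of_rowSum_le_aux hn hl hv hvl (fun i => -x i) (fun i => ?_) k fun j => ?_
    · have : rowSum (fun i j => v i j * (-x i + -x j)) i
          = -rowSum (fun i j => v i j * (x i + x j)) i := by
        simp only [rowSum, ← Finset.sum_neg_distrib]
        exact Finset.sum_congr rfl fun j _ => by ring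
      rw [this, abs_neg]
      exact hY i
    · rw [abs_neg, ← abs_of_nonpos h]; exact hk j (Finset.mem_univ j)

/-- For constant weights the form is exactly l((n − 2)Σx_i² + (Σx_i)²), and the last square is
dropped. This is the ℓ² counterpart of the row-sum bound; it supplies the spectral gap for the
energy estimate. -/
theorem mul_sum_sq_le_pairSum {n : ℕ} {v : Fin n → Fin n → ℝ} {l : ℝ} (hl : 0 ≤ l)
    (hvl : ∀ i j, i ≠ j → l ≤ v i j) (x : Fin n → ℝ) :
    l * (n - 2) * ∑ i, x i ^ 2 ≤ pairSum fun i j => v i j * (x i + x j) ^ 2 := by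
  have h1 : pairSum (fun i j => l * (x i + x j) ^ 2)
      ≤ pairSum fun i j => v i j * (x i + x j) ^ 2 :=
    pairSum_le_pairSum fun i j hij => mul_le_mul_of_nonneg_right (hvl i j hij) (sq_nonneg _)
  have h2 := sum_mul_rowSum x (c := fun i j => x i + x j) fun i j => add_comm _ _
  have h3 : ∀ i, rowSum (fun i j => x i + x j) i = (n - 2) * x i + ∑ j, x j := fun i => by
    have : rowSum (fun i j => x i + x j) i
        = rowSum (fun _ _ => x i) i + rowSum (fun _ j => x j) i := by
      simp only [rowSum, ← Finset.sum_add_distrib]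
    rw [this, rowSum_const, rowSum_col]
    ring
  simp only [h3] at h2
  have h4 : ∑ i, x i * ((n - 2) * x i + ∑ j, x j) = (n - 2) * ∑ i, x i ^ 2 + (∑ i, x i) ^ 2 := by
    have h5 : ∀ i, x i * ((n - 2) * x i + ∑ j, x j) = (n - 2) * x i ^ 2 + (∑ j, x j) * x i :=
      fun i => by ring
    rw [Finset.sum_congr rfl fun i _ => h5 i, Finset.sum_add_distrib, ← Finset.mul_sum,
      ← Finset.mul_sum, pow_two]
  rw [h4] at h2
  have h5 : pairSum (fun i j => l * (x i + x j) ^ 2)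
      = l * pairSum fun i j => (x i + x j) * (x i + x j) := by
    rw [← pairSum_const_mul]; exact pairSum_congr fun i j _ => by ring
  rw [h5, ← h2] at h1
  nlinarith [mul_nonneg hl (sq_nonneg (∑ i, x i))]

/-! ### The logistic function -/

/-- The derivative of the logistic function. -/
noncomputable def muDeriv (x : ℝ) : ℝ := Real.exp x / (1 + Real.exp x) ^ 2

theorem hasDerivAt_mu (x : ℝ) : HasDerivAt mu (muDeriv x) x := by
  have h := (Real.hasDerivAt_exp x).div ((Real.hasDerivAt_exp x).const_add 1)
    (by positivity)
  refine h.congr_deriv ?_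
  rw [muDeriv]
  congr 1
  ring

theorem muDeriv_pos (x : ℝ) : 0 < muDeriv x := by unfold muDeriv; positivity

theorem muDeriv_le_one (x : ℝ) : muDeriv x ≤ 1 := by
  rw [muDeriv, div_le_one (by positivity)]
  nlinarith [Real.exp_pos x]

theorem mu_mem_Icc (x : ℝ) : 0 ≤ mu x ∧ mu x ≤ 1 := by
  have := Real.exp_pos x
  constructor
  · unfold mu; positivity
  · rw [mu, div_le_one (by positivity)]; linarith

theorem mu_mul_one_sub (x : ℝ) : mu x * (1 - mu x) = muDeriv x := by
  have := Real.exp_pos x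
  unfold mu muDeriv
  field_simp
  ring

/-- Second-order expansion of the logistic function, with the error controlled by its
derivative. -/
theorem abs_mu_add_sub_le (x h : ℝ) (hh : |h| ≤ 1) :
    |mu (x + h) - mu x - muDeriv x * h| ≤ muDeriv x * h ^ 2 := by
  set a := Real.exp x with ha
  set c := Real.exp h with hc
  have ha0 : 0 < a := Real.exp_pos x
  have hc0 : 0 < c := Real.exp_pos h
  -- With a = e^x and c = e^h the derivative factors out exactly, and what is left lies within h² of
  -- zero uniformly in x.
  have h1 : mu (x + h) - mu x - muDeriv x * h
      = muDeriv x * ((c - 1) * (1 + a) / (1 + a * c) - h) := by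
    simp only [mu, muDeriv, Real.exp_add, ← ha, ← hc]
    field_simp
    ring
  rw [h1, abs_mul, abs_of_pos (muDeriv_pos x)]
  refine mul_le_mul_of_nonneg_left ?_ (muDeriv_pos x).le
  have e1 := abs_le.1 (Real.abs_exp_sub_one_sub_id_le hh)
  have e2 := abs_le.1 (Real.abs_exp_sub_one_sub_id_le (x := -h) (by rwa [abs_neg]))
  rw [Real.exp_neg, ← hc] at e2
  rw [← hc] at e1
  -- The quotient lies between 1 − e^(−h) and e^h − 1, both of which differ from h by at most h².
  have h2 : (c - 1) * (1 + a) / (1 + a * c) ≤ c - 1 := by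
    rw [div_le_iff₀ (by positivity)]
    nlinarith [mul_nonneg ha0.le (sq_nonneg (c - 1))]
  have h3 : 1 - c⁻¹ ≤ (c - 1) * (1 + a) / (1 + a * c) := by
    rw [le_div_iff₀ (by positivity)]
    have : (1 - c⁻¹) * (1 + a * c) = (c - 1) * (a + c⁻¹) := by field_simp; ring
    rw [this]
    have : (c - 1) * (1 + a) - (c - 1) * (a + c⁻¹) = c⁻¹ * (c - 1) ^ 2 := by field_simp; ring
    have : 0 ≤ c⁻¹ * (c - 1) ^ 2 := by positivity
    linarith
  rw [abs_le]
  constructor <;> linarith [e1.1, e1.2, e2.1, e2.2]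

theorem mu_strictMono : StrictMono mu :=
  strictMono_of_deriv_pos fun x => by rw [(hasDerivAt_mu x).deriv]; exact muDeriv_pos x


/-! ### The Jacobian matrices -/

theorem hasDerivAt_linPred_node {n p : ℕ} (z : Fin n → Fin n → Fin p → ℝ) (β : Fin n → ℝ)
    (γ : Fin p → ℝ) (k i j : Fin n) :
    HasDerivAt (fun u => linPred z (Function.update β k u) γ i j)
      ((if i = k then 1 else 0) + (if j = k then 1 else 0)) (β k) := by
  have h : ∀ i : Fin n, HasDerivAt (fun u => Function.update β k u i)
      (if i = k then (1 : ℝ) else 0) (β k) := by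
    intro i
    rcases eq_or_ne i k with rfl | hik
    · simpa using hasDerivAt_id' (β i)
    · simpa [Function.update_of_ne hik, hik] using hasDerivAt_const (β k) (β i)
  exact ((h i).add (h j)).add_const _

theorem hasDerivAt_linPred_cov {n p : ℕ} (z : Fin n → Fin n → Fin p → ℝ) (β : Fin n → ℝ)
    (γ : Fin p → ℝ) (t : Fin p) (i j : Fin n) :
    HasDerivAt (fun u => linPred z β (Function.update γ t u) i j) (z i j t) (γ t) := by
  have h : ∀ s ∈ Finset.univ, HasDerivAt (fun u => z i j s * Function.update γ t u s)
      (if s = t then z i j t else 0) (γ t) := by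
    intro s _
    rcases eq_or_ne s t with rfl | hst
    · simpa using (hasDerivAt_id' (γ s)).const_mul (z i j s)
    · simpa [Function.update_of_ne hst, hst] using hasDerivAt_const (γ t) (z i j s * γ s)
  exact ((HasDerivAt.fun_sum h).const_add (β i + β j)).congr_deriv (by simp)

/-- The conditional variance of the edge `(i, j)`. -/
noncomputable def edgeVar {n p : ℕ} (z : Fin n → Fin n → Fin p → ℝ)
    (β : Fin n → ℝ) (γ : Fin p → ℝ) (i j : Fin n) : ℝ := muDeriv (linPred z β γ i j)

/-- The signless Laplacian matrix of the weights `v`. -/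
noncomputable def signlessLap {n : ℕ} (v : Fin n → Fin n → ℝ) : Matrix (Fin n) (Fin n) ℝ :=
  Matrix.of fun i k =>
    rowSum (fun i j => v i j * ((if i = k then 1 else 0) + (if j = k then 1 else 0))) i

theorem hasDerivAt_mu_linPred_node {n p : ℕ} (z : Fin n → Fin n → Fin p → ℝ) (β : Fin n → ℝ)
    (γ : Fin p → ℝ) (k i j : Fin n) :
    HasDerivAt (fun u => mu (linPred z (Function.update β k u) γ i j))
      (edgeVar z β γ i j * ((if i = k then 1 else 0) + (if j = k then 1 else 0))) (β k) := by
  have h := hasDerivAt_mu (linPred z (Function.update β k (β k)) γ i j)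
  have h2 := h.comp (β k) (hasDerivAt_linPred_node z β γ k i j)
  rw [Function.update_eq_self] at h2
  exact h2

theorem hasDerivAt_mu_linPred_cov {n p : ℕ} (z : Fin n → Fin n → Fin p → ℝ) (β : Fin n → ℝ)
    (γ : Fin p → ℝ) (t : Fin p) (i j : Fin n) :
    HasDerivAt (fun u => mu (linPred z β (Function.update γ t u) i j))
      (edgeVar z β γ i j * z i j t) (γ t) := by
  have h := hasDerivAt_mu (linPred z β (Function.update γ t (γ t)) i j)
  have h2 := h.comp (γ t) (hasDerivAt_linPred_cov z β γ t i j)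
  rw [Function.update_eq_self] at h2
  exact h2

theorem jacobian_meanDeg_node {n p : ℕ} (z : Fin n → Fin n → Fin p → ℝ) (β : Fin n → ℝ)
    (γ : Fin p → ℝ) :
    jacobian (fun β' => meanDeg z β' γ) β = signlessLap (edgeVar z β γ) := by
  ext i k
  exact (HasDerivAt.fun_sum fun j _ => hasDerivAt_mu_linPred_node z β γ k i j).deriv

theorem jacobian_meanDeg_cov {n p : ℕ} (z : Fin n → Fin n → Fin p → ℝ) (β : Fin n → ℝ)
    (γ : Fin p → ℝ) (i : Fin n) (t : Fin p) :
    jacobian (fun γ' => meanDeg z β γ') γ i t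
      = rowSum (fun i j => edgeVar z β γ i j * z i j t) i :=
  (HasDerivAt.fun_sum fun j _ => hasDerivAt_mu_linPred_cov z β γ t i j).deriv

theorem jacobian_meanCov_node {n p : ℕ} (z : Fin n → Fin n → Fin p → ℝ) (β : Fin n → ℝ)
    (γ : Fin p → ℝ) (s : Fin p) (k : Fin n) :
    jacobian (fun β' => meanCov z β' γ) β s k = pairSum fun i j => z i j s *
      (edgeVar z β γ i j * ((if i = k then 1 else 0) + (if j = k then 1 else 0))) :=
  (HasDerivAt.fun_sum fun i _ => HasDerivAt.fun_sum fun j _ =>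
    (hasDerivAt_mu_linPred_node z β γ k i j).const_mul (z i j s)).deriv

theorem jacobian_meanCov_cov {n p : ℕ} (z : Fin n → Fin n → Fin p → ℝ) (β : Fin n → ℝ)
    (γ : Fin p → ℝ) (s t : Fin p) :
    jacobian (fun γ' => meanCov z β γ') γ s t
      = pairSum fun i j => z i j s * (edgeVar z β γ i j * z i j t) :=
  (HasDerivAt.fun_sum fun i _ => HasDerivAt.fun_sum fun j _ =>
    (hasDerivAt_mu_linPred_cov z β γ t i j).const_mul (z i j s)).deriv

theorem sum_indicator_add {n : ℕ} (x : Fin n → ℝ) (i j : Fin n) :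
    ∑ k, ((if i = k then (1 : ℝ) else 0) + (if j = k then 1 else 0)) * x k = x i + x j := by
  simp [add_mul, Finset.sum_add_distrib]

theorem signlessLap_mulVec {n : ℕ} (v : Fin n → Fin n → ℝ) (x : Fin n → ℝ) (i : Fin n) :
    (signlessLap v).mulVec x i = rowSum (fun i j => v i j * (x i + x j)) i := by
  simp only [Matrix.mulVec, dotProduct, signlessLap, Matrix.of_apply, rowSum, Finset.sum_mul]
  rw [Finset.sum_comm]
  refine Finset.sum_congr rfl fun j _ => ?_
  rw [← sum_indicator_add x i j, Finset.mul_sum]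
  exact Finset.sum_congr rfl fun k _ => by ring

theorem isUnit_signlessLap {n : ℕ} (hn : 8 ≤ n) {v : Fin n → Fin n → ℝ} {l : ℝ} (hl : 0 < l)
    (hv : ∀ i j, v i j = v j i) (hvl : ∀ i j, i ≠ j → l ≤ v i j) : IsUnit (signlessLap v) := by
  rw [← Matrix.mulVec_injective_iff_isUnit]
  intro x y hxy
  have h0 : ∀ i, rowSum (fun i j => v i j * ((x - y) i + (x - y) j)) i = 0 := fun i => by
    rw [← signlessLap_mulVec, Matrix.mulVec_sub, hxy, sub_self, Pi.zero_apply]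
  funext i
  have := abs_le_of_rowSum_le hn hl hv hvl (x - y) (Y := 0) (fun i => by rw [h0, abs_zero]) i
  simp only [mul_zero, zero_div, abs_nonpos_iff, Pi.sub_apply] at this
  linarith

/-- The matrix `H` as a weighted Gram matrix of the covariates against their residuals after
projecting out the node effects. -/
theorem exists_profile {n p : ℕ} (hn : 8 ≤ n) (z : Fin n → Fin n → Fin p → ℝ) (β : Fin n → ℝ)
    (γ : Fin p → ℝ) {l : ℝ} (hl : 0 < l)
    (hv : ∀ i j, edgeVar z β γ i j = edgeVar z β γ j i)
    (hvl : ∀ i j, i ≠ j → l ≤ edgeVar z β γ i j) :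
    ∃ w : Fin p → Fin n → ℝ,
      (∀ t i, rowSum (fun i j => edgeVar z β γ i j * (w t i + w t j)) i
        = rowSum (fun i j => edgeVar z β γ i j * z i j t) i) ∧
      ∀ s t, fisherH z β γ s t
        = pairSum fun i j => z i j s * (edgeVar z β γ i j * (z i j t - w t i - w t j)) := by
  set V := signlessLap (edgeVar z β γ) with hV
  set A := jacobian (fun γ' => meanDeg z β γ') γ with hA
  have hunit : IsUnit V.det := (Matrix.isUnit_iff_isUnit_det _).1 (isUnit_signlessLap hn hl hv hvl)
  have hVW : V * (V⁻¹ * A) = A := by rw [← Matrix.mul_assoc, Matrix.mul_nonsing_inv _ hunit,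
    Matrix.one_mul]
  -- Column t of `V⁻¹ * A` solves the normal equations of the weighted least-squares fit of z_ij t
  -- by w_i + w_j.
  refine ⟨fun t i => (V⁻¹ * A) i t, fun t i => ?_, fun s t => ?_⟩
  · rw [← jacobian_meanDeg_cov, ← hA]
    conv_rhs => rw [← hVW]
    exact (signlessLap_mulVec (edgeVar z β γ) (fun k => (V⁻¹ * A) k t) i).symm
  · rw [fisherH, jacobian_meanDeg_node, ← hV, ← hA, Matrix.mul_assoc, Matrix.sub_apply,
      jacobian_meanCov_cov, Matrix.mul_apply]
    simp only [jacobian_meanCov_node]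
    set W := V⁻¹ * A
    have h1 : ∑ k, pairSum (fun i j => z i j s * (edgeVar z β γ i j *
        ((if i = k then 1 else 0) + (if j = k then 1 else 0)))) * W k t
        = pairSum fun i j => z i j s * (edgeVar z β γ i j * (W i t + W j t)) := by
      have : ∀ k, pairSum (fun i j => z i j s * (edgeVar z β γ i j *
        ((if i = k then 1 else 0) + (if j = k then 1 else 0)))) * W k t
        = pairSum (fun i j => z i j s * (edgeVar z β γ i j *
        (((if i = k then 1 else 0) + (if j = k then 1 else 0)) * W k t))) := fun k => by
        rw [mul_comm, ← pairSum_const_mul]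
        exact pairSum_congr fun i j _ => by ring
      rw [Finset.sum_congr rfl fun k _ => this k, ← pairSum_sum]
      refine pairSum_congr fun i j _ => ?_
      rw [← sum_indicator_add (fun k => W k t) i j, ← Finset.mul_sum, ← Finset.mul_sum]
    rw [h1, ← pairSum_sub]
    exact pairSum_congr fun i j _ => by ring

/-! ### The linearized moment equations -/

/-- Summation by parts turns the two halves into `y` tested against row sums, and these agree by the
normal equations for `w`. This is the orthogonality of residuals to node effects on which the
elimination rests. -/
theorem pairSum_residual_eq_zero {n p : ℕ} {z : Fin n → Fin n → Fin p → ℝ}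
    (hz : ∀ i j, z i j = z j i) {v : Fin n → Fin n → ℝ} (hv : ∀ i j, v i j = v j i)
    {w : Fin p → Fin n → ℝ}
    (hw : ∀ t i, rowSum (fun i j => v i j * (w t i + w t j)) i
      = rowSum (fun i j => v i j * z i j t) i) (t : Fin p) (y : Fin n → ℝ) :
    pairSum (fun i j => (y i + y j) * (v i j * (z i j t - w t i - w t j))) = 0 := by
  have h1 := sum_mul_rowSum y (c := fun i j => v i j * (w t i + w t j))
    fun i j => by rw [hv, add_comm]
  have h2 := sum_mul_rowSum y (c := fun i j => v i j * z i j t) fun i j => by rw [hv, hz]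
  simp only [hw] at h1
  have h3 : pairSum (fun i j => (y i + y j) * (v i j * (z i j t - w t i - w t j)))
      = pairSum (fun i j => (y i + y j) * (v i j * z i j t))
        - pairSum (fun i j => (y i + y j) * (v i j * (w t i + w t j))) := by
    rw [← pairSum_sub]; exact pairSum_congr fun i j _ => by ring
  rw [h3, ← h1, ← h2, sub_self]

/-- Eliminating the node parameters from the linearized equations. -/
theorem profile_mulVec_eq {n p : ℕ} {z : Fin n → Fin n → Fin p → ℝ}
    (hz : ∀ i j, z i j = z j i) {v : Fin n → Fin n → ℝ} (hv : ∀ i j, v i j = v j i)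
    {w : Fin p → Fin n → ℝ}
    (hw : ∀ t i, rowSum (fun i j => v i j * (w t i + w t j)) i
      = rowSum (fun i j => v i j * z i j t) i)
    {H : Matrix (Fin p) (Fin p) ℝ}
    (hH : ∀ s t, H s t = pairSum fun i j => z i j s * (v i j * (z i j t - w t i - w t j)))
    (δ : Fin n → ℝ) (g : Fin p → ℝ) {R : Fin n → Fin n → ℝ} (hR : ∀ i j, R i j = R j i)
    {f : Fin n → ℝ} {q : Fin p → ℝ}
    (hf : ∀ i, rowSum (fun i j => v i j * (δ i + δ j + ∑ t, z i j t * g t) + R i j) i = f i)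
    (hq : ∀ s, pairSum (fun i j =>
      z i j s * (v i j * (δ i + δ j + ∑ t, z i j t * g t) + R i j)) = q s) (s : Fin p) :
    H.mulVec g s = q s - ∑ i, w s i * f i
      - pairSum fun i j => (z i j s - w s i - w s j) * R i j := by
  set ω : Fin n → ℝ := fun i => ∑ t, w t i * g t with hω
  have hζ : ∀ i j, ∑ t, (z i j t - w t i - w t j) * g t = ∑ t, z i j t * g t - ω i - ω j :=
    fun i j => by simp only [hω, sub_mul, Finset.sum_sub_distrib]
  have h1 : H.mulVec g s
      = pairSum fun i j => z i j s * (v i j * (∑ t, z i j t * g t - ω i - ω j)) := by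
    have : ∀ t, H s t * g t = pairSum fun i j =>
        z i j s * (v i j * ((z i j t - w t i - w t j) * g t)) := fun t => by
      rw [hH, mul_comm, ← pairSum_const_mul]
      exact pairSum_congr fun i j _ => by ring
    rw [Matrix.mulVec, dotProduct, Finset.sum_congr rfl fun t _ => this t, ← pairSum_sum]
    refine pairSum_congr fun i j _ => ?_
    rw [← hζ, Finset.mul_sum, Finset.mul_sum]
  have h2 : pairSum (fun i j => (w s i + w s j) *
      (v i j * (∑ t, z i j t * g t - ω i - ω j))) = 0 := by
    have : pairSum (fun i j => (w s i + w s j) * (v i j * (∑ t, z i j t * g t - ω i - ω j)))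
        = ∑ t, g t * pairSum fun i j => (w s i + w s j) * (v i j * (z i j t - w t i - w t j)) := by
      simp only [← pairSum_const_mul]
      rw [← pairSum_sum]
      refine pairSum_congr fun i j _ => ?_
      rw [← hζ, Finset.mul_sum, Finset.mul_sum]
      exact Finset.sum_congr rfl fun t _ => by ring
    rw [this]
    exact Finset.sum_eq_zero fun t _ => by rw [pairSum_residual_eq_zero hz hv hw, mul_zero]
  have h3 := pairSum_residual_eq_zero hz hv hw s (fun i => δ i + ω i)
  have h4 := sum_mul_rowSum (w s)
    (c := fun i j => v i j * (δ i + δ j + ∑ t, z i j t * g t) + R i j) fun i j => by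
      rw [hv, hR, hz, add_comm (δ i)]
  simp only [hf] at h4
  rw [h1, ← hq, h4, ← sub_eq_zero, ← pairSum_sub, ← pairSum_sub, ← pairSum_sub]
  -- Splitting D into the node effect δ + ω and the residual part, the two sides of the claim differ
  -- exactly by these two vanishing sums.
  have h5 : pairSum (fun i j => (w s i + w s j) * (v i j * (∑ t, z i j t * g t - ω i - ω j)))
      - pairSum (fun i j => ((δ i + ω i) + (δ j + ω j)) * (v i j * (z i j s - w s i - w s j)))
      = 0 := by rw [h2, h3, sub_self]
  rw [← h5, ← pairSum_sub]
  exact pairSum_congr fun i j _ => by ring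

/-- The energy of a small solution of the linearized equations. -/
theorem energy_le {n p : ℕ} (hn : 8 ≤ n) {z : Fin n → Fin n → Fin p → ℝ}
    (hz : ∀ i j, z i j = z j i) {v : Fin n → Fin n → ℝ} (hv : ∀ i j, v i j = v j i)
    {b : ℝ} (hb : 0 < b) (hvl : ∀ i j, i ≠ j → 1 / b ≤ v i j)
    {w : Fin p → Fin n → ℝ}
    (hw : ∀ t i, rowSum (fun i j => v i j * (w t i + w t j)) i
      = rowSum (fun i j => v i j * z i j t) i)
    (δ : Fin n → ℝ) (g : Fin p → ℝ) {R : Fin n → Fin n → ℝ} (hR : ∀ i j, R i j = R j i)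
    (hR2 : ∀ i j, i ≠ j → |R i j| ≤ v i j * (δ i + δ j + ∑ t, z i j t * g t) ^ 2)
    (hsmall : ∀ i j, i ≠ j → |δ i + δ j + ∑ t, z i j t * g t| ≤ 1 / 2)
    {f : Fin n → ℝ} {q : Fin p → ℝ}
    (hf : ∀ i, rowSum (fun i j => v i j * (δ i + δ j + ∑ t, z i j t * g t) + R i j) i = f i)
    (hq : ∀ s, pairSum (fun i j =>
      z i j s * (v i j * (δ i + δ j + ∑ t, z i j t * g t) + R i j)) = q s) :
    pairSum (fun i j => v i j * (δ i + δ j + ∑ t, z i j t * g t) ^ 2)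
      ≤ 8 * b / n * ∑ i, f i ^ 2 + 4 * ∑ t, |q t - ∑ i, w t i * f i| * |g t| := by
  have hn' : (8 : ℝ) ≤ n := by exact_mod_cast hn
  set D : Fin n → Fin n → ℝ := fun i j => δ i + δ j + ∑ t, z i j t * g t with hD
  set ω : Fin n → ℝ := fun i => ∑ t, w t i * g t with hω
  set E := pairSum fun i j => v i j * D i j ^ 2 with hE
  have hv0 : ∀ i j, i ≠ j → 0 ≤ v i j := fun i j hij => (by positivity : 0 ≤ 1 / b).trans (hvl i j hij)
  have hζ : ∀ i j, ∑ t, (z i j t - w t i - w t j) * g t = ∑ t, z i j t * g t - ω i - ω j :=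
    fun i j => by simp only [hω, sub_mul, Finset.sum_sub_distrib]
  -- Pythagoras: D is the node effect δ + ω plus a combination of residuals, and the two are
  -- `v`-orthogonal, so the node effect alone has energy at most E.
  have hproj : pairSum (fun i j => v i j * ((δ i + ω i) + (δ j + ω j)) ^ 2) ≤ E := by
    have h0 : pairSum (fun i j => ((δ i + ω i) + (δ j + ω j)) *
        (v i j * (∑ t, z i j t * g t - ω i - ω j))) = 0 := by
      have : pairSum (fun i j => ((δ i + ω i) + (δ j + ω j)) *
          (v i j * (∑ t, z i j t * g t - ω i - ω j)))
          = ∑ t, g t * pairSum fun i j => ((δ i + ω i) + (δ j + ω j)) *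
            (v i j * (z i j t - w t i - w t j)) := by
        simp only [← pairSum_const_mul]
        rw [← pairSum_sum]
        refine pairSum_congr fun i j _ => ?_
        rw [← hζ, Finset.mul_sum, Finset.mul_sum]
        exact Finset.sum_congr rfl fun t _ => by ring
      rw [this]
      exact Finset.sum_eq_zero fun t _ => by
        rw [pairSum_residual_eq_zero hz hv hw t fun i => δ i + ω i, mul_zero]
    have h1 : E = pairSum (fun i j => v i j * ((δ i + ω i) + (δ j + ω j)) ^ 2)
        + 2 * pairSum (fun i j => ((δ i + ω i) + (δ j + ω j)) *
          (v i j * (∑ t, z i j t * g t - ω i - ω j)))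
        + pairSum (fun i j => v i j * (∑ t, z i j t * g t - ω i - ω j) ^ 2) := by
      rw [← pairSum_const_mul, ← pairSum_add, ← pairSum_add, hE]
      exact pairSum_congr fun i j _ => by simp only [hD]; ring
    rw [h1, h0]
    have := pairSum_nonneg (f := fun i j => v i j * (∑ t, z i j t * g t - ω i - ω j) ^ 2)
      fun i j hij => mul_nonneg (hv0 i j hij) (sq_nonneg _)
    linarith
  have hspec := mul_sum_sq_le_pairSum (by positivity : 0 ≤ 1 / b) hvl fun i => δ i + ω i
  -- Testing against (δ, g) and moving ω into the node part leaves the covariate direction paired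
  -- with the projected noise only.
  have htest : pairSum (fun i j => D i j * (v i j * D i j + R i j))
      = ∑ i, (δ i + ω i) * f i + ∑ t, (q t - ∑ i, w t i * f i) * g t := by
    have h4 := sum_mul_rowSum δ (c := fun i j => v i j * D i j + R i j) fun i j => by
      simp only [hD]; rw [hv, hR, hz, add_comm (δ i)]
    simp only [hD, hf] at h4
    have h5 : ∑ t, g t * q t = pairSum fun i j => (∑ t, z i j t * g t) *
        (v i j * D i j + R i j) := by
      simp only [← hq, ← pairSum_const_mul]
      rw [← pairSum_sum]
      refine pairSum_congr fun i j _ => ?_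
      rw [Finset.sum_mul]
      exact Finset.sum_congr rfl fun t _ => by ring
    have h6 : ∑ i, ω i * f i = ∑ t, (∑ i, w t i * f i) * g t := by
      simp only [hω, Finset.sum_mul]
      rw [Finset.sum_comm]
      exact Finset.sum_congr rfl fun t _ => Finset.sum_congr rfl fun i _ => by ring
    simp only [add_mul, sub_mul, Finset.sum_add_distrib, Finset.sum_sub_distrib]
    rw [← h6, h4]
    have h7 : ∑ t, q t * g t = ∑ t, g t * q t := Finset.sum_congr rfl fun t _ => mul_comm _ _
    rw [h7, h5]
    have h8 : pairSum (fun i j => D i j * (v i j * D i j + R i j))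
        = pairSum (fun i j => (δ i + δ j) * (v i j * (δ i + δ j + ∑ t, z i j t * g t) + R i j))
        + pairSum (fun i j => (∑ t, z i j t * g t) * (v i j * D i j + R i j)) := by
      rw [← pairSum_add]; exact pairSum_congr fun i j _ => by simp only [hD]; ring
    rw [h8]; ring
  -- Since |D| ≤ 1/2 and |R| ≤ v D², the remainder consumes at most half of the energy.
  have hlow : E / 2 ≤ pairSum fun i j => D i j * (v i j * D i j + R i j) := by
    have : E / 2 = pairSum fun i j => (1 / 2) * (v i j * D i j ^ 2) := by
      rw [pairSum_const_mul]; ring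
    rw [this]
    refine pairSum_le_pairSum fun i j hij => ?_
    have h1 := hsmall i j hij
    have h2 := hR2 i j hij
    have h3 : |D i j * R i j| ≤ (1 / 2) * (v i j * D i j ^ 2) := by
      rw [abs_mul]
      exact mul_le_mul h1 h2 (abs_nonneg _) (by norm_num)
    have h4 := neg_abs_le (D i j * R i j)
    nlinarith
  -- Young's inequality, with weight chosen so that the quadratic term is at most E/4 by `hspec` and
  -- `hproj`; a quarter of E then survives on the left.
  have hyoung : ∑ i, (δ i + ω i) * f i
      ≤ (1 / b * (n - 2) * ∑ i, (δ i + ω i) ^ 2) / 4 + b / (n - 2) * ∑ i, f i ^ 2 := by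
    rw [Finset.mul_sum, Finset.mul_sum, Finset.sum_div, ← Finset.sum_add_distrib]
    refine Finset.sum_le_sum fun i _ => ?_
    have hc : 0 < (n - 2 : ℝ) / b := div_pos (by linarith) hb
    have h1 : b / ((n : ℝ) - 2) = ((n - 2 : ℝ) / b)⁻¹ := by rw [inv_div]
    have h2 : 1 / b * ((n : ℝ) - 2) = (n - 2 : ℝ) / b := by ring
    rw [h1, h2]
    set c := (n - 2 : ℝ) / b
    have : 0 ≤ c⁻¹ * (c * (δ i + ω i) / 2 - f i) ^ 2 := by positivity
    have h3 : c⁻¹ * (c * (δ i + ω i) / 2 - f i) ^ 2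
        = c * (δ i + ω i) ^ 2 / 4 + c⁻¹ * f i ^ 2 - (δ i + ω i) * f i := by
      field_simp; ring
    linarith
  have hq' : ∑ t, (q t - ∑ i, w t i * f i) * g t ≤ ∑ t, |q t - ∑ i, w t i * f i| * |g t| :=
    Finset.sum_le_sum fun t _ => (le_abs_self _).trans (abs_mul _ _).le
  have hbn : 4 * (b / (n - 2) * ∑ i, f i ^ 2) ≤ 8 * b / n * ∑ i, f i ^ 2 := by
    rw [← mul_assoc]
    refine mul_le_mul_of_nonneg_right ?_ (Finset.sum_nonneg fun i _ => sq_nonneg _)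
    rw [← mul_div_assoc, div_le_div_iff₀ (by linarith) (by linarith)]
    nlinarith
  rw [htest] at hlow
  linarith


/-! ### Identifiability and uniqueness of the moment solution. -/

theorem linPred_symm {n p : ℕ} {z : Fin n → Fin n → Fin p → ℝ} (hz : ∀ i j, z i j = z j i)
    (β : Fin n → ℝ) (γ : Fin p → ℝ) (i j : Fin n) : linPred z β γ i j = linPred z β γ j i := by
  rw [linPred, linPred, hz i j, add_comm (β i)]

theorem edgeVar_symm {n p : ℕ} {z : Fin n → Fin n → Fin p → ℝ} (hz : ∀ i j, z i j = z j i)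
    (β : Fin n → ℝ) (γ : Fin p → ℝ) (i j : Fin n) : edgeVar z β γ i j = edgeVar z β γ j i := by
  rw [edgeVar, edgeVar, linPred_symm hz]

theorem linPred_sub {n p : ℕ} (z : Fin n → Fin n → Fin p → ℝ)
    (β β' : Fin n → ℝ) (γ γ' : Fin p → ℝ) (i j : Fin n) :
    linPred z β' γ' i j - linPred z β γ i j
      = (β' - β) i + (β' - β) j + ∑ t, z i j t * (γ' - γ) t := by
  simp only [linPred, Pi.sub_apply, mul_sub, Finset.sum_sub_distrib]
  ring

/-- Testing the two blocks of moment equations against a parameter direction. -/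
theorem sum_add_sum_eq_pairSum {n p : ℕ} (z : Fin n → Fin n → Fin p → ℝ)
    {c : Fin n → Fin n → ℝ} (hc : ∀ i j, c i j = c j i)
    (x : Fin n → ℝ) (y : Fin p → ℝ) :
    ∑ i, x i * rowSum c i + ∑ t, y t * pairSum (fun i j => z i j t * c i j)
      = pairSum fun i j => (x i + x j + ∑ t, z i j t * y t) * c i j := by
  rw [sum_mul_rowSum x hc]
  simp only [← pairSum_const_mul]
  rw [← pairSum_sum, ← pairSum_add]
  refine pairSum_congr fun i j _ => ?_
  rw [add_mul _ (∑ t, z i j t * y t), Finset.sum_mul]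
  congr 1
  exact Finset.sum_congr rfl fun t _ => by ring

theorem edgeVar_pos {n p : ℕ} (z : Fin n → Fin n → Fin p → ℝ) (β : Fin n → ℝ) (γ : Fin p → ℝ)
    (i j : Fin n) : 0 < edgeVar z β γ i j := muDeriv_pos _

theorem rowSum_zero {n : ℕ} (i : Fin n) : rowSum (fun _ _ => 0) i = 0 := by simp [rowSum]

theorem pairSum_zero {n : ℕ} : pairSum (fun _ _ : Fin n => 0) = 0 := by simp [pairSum]

/-- Identifiability: invertibility of `H` makes the linear predictor injective in the
parameters. -/
theorem eq_zero_of_linPred_eq_zero {n p : ℕ} (hn : 8 ≤ n) {z : Fin n → Fin n → Fin p → ℝ}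
    (hz : ∀ i j, z i j = z j i) {β : Fin n → ℝ} {γ : Fin p → ℝ} {l : ℝ} (hl : 0 < l)
    (hvl : ∀ i j, i ≠ j → l ≤ edgeVar z β γ i j) (hH : IsUnit (fisherH z β γ).det)
    {x : Fin n → ℝ} {y : Fin p → ℝ} (h : ∀ i j, i ≠ j → x i + x j + ∑ t, z i j t * y t = 0) :
    x = 0 ∧ y = 0 := by
  obtain ⟨w, hw, hHw⟩ := exists_profile hn z β γ hl (edgeVar_symm hz β γ) hvl
  -- A direction that leaves the predictor unchanged solves the linearized equations with zero
  -- remainder and zero right-hand side.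
  have hy : (fisherH z β γ).mulVec y = 0 := by
    funext s
    rw [profile_mulVec_eq hz (edgeVar_symm hz β γ) hw hHw x y (R := fun _ _ => 0)
      (f := fun _ => 0) (q := fun _ => 0) (fun _ _ => rfl)]
    · simp [pairSum_zero]
    · intro i
      exact (rowSum_congr i fun j hij => by rw [h i j hij]; ring).trans (rowSum_zero i)
    · intro s
      exact (pairSum_congr fun i j hij => by rw [h i j hij]; ring).trans pairSum_zero
  have hy0 : y = 0 := by
    have h2 := (Matrix.mulVec_injective_iff_isUnit.2 ((Matrix.isUnit_iff_isUnit_det _).2 hH))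
    exact h2 (by rw [hy, Matrix.mulVec_zero])
  refine ⟨?_, hy0⟩
  funext i
  have h3 : ∀ i, |rowSum (fun i j => edgeVar z β γ i j * (x i + x j)) i| ≤ 0 := fun i => by
    have : rowSum (fun i j => edgeVar z β γ i j * (x i + x j)) i = 0 := by
      rw [← rowSum_zero i]
      refine rowSum_congr i fun j hij => ?_
      have := h i j hij
      simp only [hy0, Pi.zero_apply, mul_zero, Finset.sum_const_zero, add_zero] at this
      rw [this, mul_zero]
    rw [this, abs_zero]
  have := abs_le_of_rowSum_le hn hl (edgeVar_symm hz β γ) hvl x h3 i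
  simpa using this

/-- The moment equations have at most one solution. -/
theorem solution_unique {n p : ℕ} (hn : 8 ≤ n) {z : Fin n → Fin n → Fin p → ℝ}
    (hz : ∀ i j, z i j = z j i) {β : Fin n → ℝ} {γ : Fin p → ℝ} {l : ℝ} (hl : 0 < l)
    (hvl : ∀ i j, i ≠ j → l ≤ edgeVar z β γ i j) (hH : IsUnit (fisherH z β γ).det)
    {β₁ β₂ : Fin n → ℝ} {γ₁ γ₂ : Fin p → ℝ} (hF : ∀ i, meanDeg z β₁ γ₁ i = meanDeg z β₂ γ₂ i)
    (hQ : ∀ t, meanCov z β₁ γ₁ t = meanCov z β₂ γ₂ t) : β₁ = β₂ ∧ γ₁ = γ₂ := by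
  set c : Fin n → Fin n → ℝ := fun i j => mu (linPred z β₁ γ₁ i j) - mu (linPred z β₂ γ₂ i j)
    with hc
  have hcs : ∀ i j, c i j = c j i := fun i j => by
    simp only [hc]; rw [linPred_symm hz β₁, linPred_symm hz β₂]
  have hr : ∀ i, rowSum c i = 0 := fun i => by
    rw [hc, rowSum_sub]; exact sub_eq_zero.2 (hF i)
  have hp : ∀ t, pairSum (fun i j => z i j t * c i j) = 0 := fun t => by
    simp only [hc, mul_sub]
    rw [pairSum_sub]; exact sub_eq_zero.2 (hQ t)
  have h := sum_add_sum_eq_pairSum z hcs (β₁ - β₂) (γ₁ - γ₂)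
  simp only [hr, hp, mul_zero, Finset.sum_const_zero, add_zero] at h
  -- By monotonicity of `mu` the increments of predictor and mean have the same sign. Their products
  -- sum to zero, so each of them vanishes.
  have hnn : ∀ i j : Fin n, 0 ≤
      ((β₁ - β₂) i + (β₁ - β₂) j + ∑ t, z i j t * (γ₁ - γ₂) t) * c i j := fun i j => by
    rw [← linPred_sub]
    simp only [hc]
    rcases le_total (linPred z β₁ γ₁ i j) (linPred z β₂ γ₂ i j) with h' | h'
    · exact mul_nonneg_of_nonpos_of_nonpos (sub_nonpos.2 h')
        (sub_nonpos.2 (mu_strictMono.monotone h'))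
    · exact mul_nonneg (sub_nonneg.2 h') (sub_nonneg.2 (mu_strictMono.monotone h'))
  have hlt : ∀ i j : Fin n, j < i → linPred z β₁ γ₁ i j = linPred z β₂ γ₂ i j := fun i j hij => by
    have h1 := pairSum_eq_zero_imp (fun i j _ => hnn i j) h.symm i j hij
    rw [← linPred_sub] at h1
    rcases mul_eq_zero.1 h1 with h2 | h2
    · exact sub_eq_zero.1 h2
    · exact mu_strictMono.injective (sub_eq_zero.1 h2)
  have hall : ∀ i j : Fin n, i ≠ j →
      (β₁ - β₂) i + (β₁ - β₂) j + ∑ t, z i j t * (γ₁ - γ₂) t = 0 := fun i j hij => by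
    rw [← linPred_sub, sub_eq_zero]
    rcases lt_or_gt_of_ne hij with h' | h'
    · rw [linPred_symm hz, linPred_symm hz β₂]; exact hlt j i h'
    · exact hlt i j h'
  obtain ⟨h1, h2⟩ := eq_zero_of_linPred_eq_zero hn hz hl hvl hH hall
  exact ⟨sub_eq_zero.1 h1, sub_eq_zero.1 h2⟩

/-! ### A priori bounds for solutions in a box. -/

theorem row_le_rowSumNorm {m q : ℕ} (M : Matrix (Fin m) (Fin q) ℝ) (s : Fin m) :
    ∑ t, |M s t| ≤ rowSumNorm M :=
  le_ciSup (f := fun s => ∑ t, |M s t|) (Set.finite_range _).bddAbove s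

theorem abs_mulVec_le {m q : ℕ} (M : Matrix (Fin m) (Fin q) ℝ) {x : Fin q → ℝ} {c : ℝ}
    (hx : ∀ t, |x t| ≤ c) (hc : 0 ≤ c) (s : Fin m) : |M.mulVec x s| ≤ rowSumNorm M * c := by
  rw [Matrix.mulVec, dotProduct]
  refine (Finset.abs_sum_le_sum_abs _ _).trans ?_
  refine le_trans ?_ (mul_le_mul_of_nonneg_right (row_le_rowSumNorm M s) hc)
  rw [Finset.sum_mul]
  refine Finset.sum_le_sum fun t _ => ?_
  rw [abs_mul]
  exact mul_le_mul_of_nonneg_left (hx t) (abs_nonneg _)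

theorem abs_sum_cov_le {p : ℕ} {x g : Fin p → ℝ} {Z r : ℝ} (hx : ∀ t, |x t| ≤ Z)
    (hg : ∀ t, |g t| ≤ r) (hZ : 0 ≤ Z) : |∑ t, x t * g t| ≤ p * Z * r := by
  refine (Finset.abs_sum_le_sum_abs _ _).trans ?_
  have : ∀ t ∈ Finset.univ, |x t * g t| ≤ Z * r := fun t _ => by
    rw [abs_mul]; exact mul_le_mul (hx t) (hg t) (abs_nonneg _) hZ
  refine (Finset.sum_le_sum this).trans (le_of_eq ?_)
  simp [mul_assoc]

/-- The right-hand sides of the equations for `w` are at most nZ because v ≤ 1, and inverting the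
signless Laplacian costs a factor 8b/n. -/
theorem abs_profile_le {n p : ℕ} (hn : 8 ≤ n) {z : Fin n → Fin n → Fin p → ℝ}
    (hz : ∀ i j, z i j = z j i) {β : Fin n → ℝ} {γ : Fin p → ℝ} {b Z : ℝ} (hb : 0 < b)
    (hvl : ∀ i j, i ≠ j → 1 / b ≤ edgeVar z β γ i j) (hZ0 : 0 ≤ Z)
    (hZ : ∀ i j t, i ≠ j → |z i j t| ≤ Z) {w : Fin p → Fin n → ℝ}
    (hw : ∀ t i, rowSum (fun i j => edgeVar z β γ i j * (w t i + w t j)) i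
      = rowSum (fun i j => edgeVar z β γ i j * z i j t) i) (t : Fin p) (i : Fin n) :
    |w t i| ≤ 8 * b * Z := by
  have h := abs_le_of_rowSum_le hn (by positivity) (edgeVar_symm hz β γ) hvl (w t) (Y := n * Z)
    (fun i => by
      rw [hw]
      refine abs_rowSum_le hZ0 i fun j hij => ?_
      rw [abs_mul, abs_of_pos (edgeVar_pos z β γ i j)]
      exact (mul_le_mul (muDeriv_le_one _) (hZ i j t hij) (abs_nonneg _) zero_le_one).trans
        (one_mul _).le) i
  have hn' : (0 : ℝ) < n := by exact_mod_cast (by omega : 0 < n)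
  refine h.trans (le_of_eq ?_)
  field_simp

/-- A solution of the moment equations in a suitable box around the true parameter lies strictly
inside the box. -/
theorem norm_lt_of_moment_eq {n p : ℕ} (hn : 8 ≤ n) {z : Fin n → Fin n → Fin p → ℝ}
    (hz : ∀ i j, z i j = z j i) {β : Fin n → ℝ} {γ : Fin p → ℝ} {b Z ρ : ℝ} (hb : 1 ≤ b)
    (hvl : ∀ i j, i ≠ j → 1 / b ≤ edgeVar z β γ i j) (hZ0 : 0 ≤ Z)
    (hZ : ∀ i j t, i ≠ j → |z i j t| ≤ Z) {w : Fin p → Fin n → ℝ}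
    (hw : ∀ t i, rowSum (fun i j => edgeVar z β γ i j * (w t i + w t j)) i
      = rowSum (fun i j => edgeVar z β γ i j * z i j t) i)
    (hHw : ∀ s t, fisherH z β γ s t
        = pairSum fun i j => z i j s * (edgeVar z β γ i j * (z i j t - w t i - w t j)))
    (hH : IsUnit (fisherH z β γ).det) (hHinv : rowSumNorm (fisherH z β γ)⁻¹ ≤ ρ / n ^ 2)
    {a N s rb rg : ℝ} (hrb : 0 < rb) (hrg : 0 < rg)
    (hd1 : 2 * rb + p * Z * rg ≤ 1 / 2)
    (hd2 : ρ / n ^ 2 * (s + 17 * b * Z * (8 * b / n * N + 4 * (p * (s * rg)))) < rg)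
    (hd3 : 8 * b / n * (a + n * (p * Z * rg) + n * (2 * rb + p * Z * rg) ^ 2) < rb)
    {f : Fin n → ℝ} {q : Fin p → ℝ} (hfa : ∀ i, |f i| ≤ a) (hfN : ∑ i, f i ^ 2 ≤ N)
    (hqs : ∀ t, |q t - ∑ i, w t i * f i| ≤ s) {β' : Fin n → ℝ} {γ' : Fin p → ℝ}
    (hβ' : ‖β' - β‖ ≤ rb) (hγ' : ‖γ' - γ‖ ≤ rg)
    (hF : ∀ i, meanDeg z β' γ' i - meanDeg z β γ i = f i)
    (hQ : ∀ t, meanCov z β' γ' t - meanCov z β γ t = q t) :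
    ‖β' - β‖ < rb ∧ ‖γ' - γ‖ < rg := by
  have hn' : (8 : ℝ) ≤ n := by exact_mod_cast hn
  set δ := β' - β with hδ
  set g := γ' - γ with hg
  set v := edgeVar z β γ with hv
  have hvs : ∀ i j, v i j = v j i := edgeVar_symm hz β γ
  have hv0 : ∀ i j, 0 < v i j := edgeVar_pos z β γ
  have hv1 : ∀ i j, v i j ≤ 1 := fun i j => muDeriv_le_one _
  have hδi : ∀ i, |δ i| ≤ rb := fun i => (norm_le_pi_norm δ i).trans hβ'
  have hgi : ∀ t, |g t| ≤ rg := fun t => (norm_le_pi_norm g t).trans hγ'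
  set D : Fin n → Fin n → ℝ := fun i j => δ i + δ j + ∑ t, z i j t * g t with hD
  have hzg : ∀ i j, i ≠ j → |∑ t, z i j t * g t| ≤ p * Z * rg := fun i j hij =>
    abs_sum_cov_le (hZ i j · hij) hgi hZ0
  have hDs : ∀ i j, D i j = D j i := fun i j => by simp only [hD]; rw [hz, add_comm (δ i)]
  have hDle : ∀ i j, i ≠ j → |D i j| ≤ 2 * rb + p * Z * rg := fun i j hij => by
    refine (abs_add_le _ _).trans (add_le_add ((abs_add_le _ _).trans ?_) (hzg i j hij))
    linarith [hδi i, hδi j]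
  set R : Fin n → Fin n → ℝ := fun i j =>
    mu (linPred z β' γ' i j) - mu (linPred z β γ i j) - v i j * D i j with hR
  have hRs : ∀ i j, R i j = R j i := fun i j => by
    simp only [hR]; rw [linPred_symm hz β', linPred_symm hz β, hvs, hDs]
  have hRle : ∀ i j, i ≠ j → |R i j| ≤ v i j * D i j ^ 2 := fun i j hij => by
    have h := abs_mu_add_sub_le (linPred z β γ i j) (D i j)
      ((hDle i j hij).trans (hd1.trans (by norm_num)))
    have : linPred z β γ i j + D i j = linPred z β' γ' i j := by
      simp only [hD, hδ, hg]; rw [← linPred_sub]; ring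
    rwa [this] at h
  have hvDR : ∀ i j, v i j * D i j + R i j = mu (linPred z β' γ' i j) - mu (linPred z β γ i j) :=
    fun i j => by simp only [hR]; ring
  have hf : ∀ i, rowSum (fun i j => v i j * D i j + R i j) i = f i := fun i => by
    simp only [hvDR]; rw [rowSum_sub]; exact hF i
  have hq : ∀ t, pairSum (fun i j => z i j t * (v i j * D i j + R i j)) = q t := fun t => by
    simp only [hvDR, mul_sub]; rw [pairSum_sub]; exact hQ t
  have hwb := abs_profile_le hn hz (by linarith) hvl hZ0 hZ hw
  set E := pairSum fun i j => v i j * D i j ^ 2 with hE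
  have hE0 : 0 ≤ E := pairSum_nonneg fun i j _ => mul_nonneg (hv0 i j).le (sq_nonneg _)
  -- `hd1` keeps |D| ≤ 1/2, which is what the energy estimate requires; `hd2` and `hd3` are the
  -- strict gains in the two radii.
  have hEle : E ≤ 8 * b / n * N + 4 * (p * (s * rg)) := by
    refine (energy_le hn hz hvs (by linarith) hvl hw δ g hRs hRle
      (fun i j hij => (hDle i j hij).trans hd1) hf hq).trans (add_le_add ?_ ?_)
    · exact mul_le_mul_of_nonneg_left hfN (by positivity)
    · refine mul_le_mul_of_nonneg_left ?_ (by norm_num)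
      have : ∀ t ∈ Finset.univ, |q t - ∑ i, w t i * f i| * |g t| ≤ s * rg := fun t _ =>
        mul_le_mul (hqs t) (hgi t) (abs_nonneg _) ((abs_nonneg _).trans (hqs t))
      simpa using Finset.sum_le_sum this
  constructor
  · rw [pi_norm_lt_iff hrb]
    intro i
    refine lt_of_le_of_lt ?_ hd3
    have hrow : ∀ i, |rowSum (fun i j => v i j * (δ i + δ j)) i|
        ≤ a + n * (p * Z * rg) + n * (2 * rb + p * Z * rg) ^ 2 := fun i => by
      -- Covariate term and remainder are moved to the right, so that only the signless Laplacian
      -- applied to δ is left to invert.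
      have h1 : rowSum (fun i j => v i j * (δ i + δ j)) i
          = f i - rowSum (fun i j => v i j * ∑ t, z i j t * g t) i - rowSum R i := by
        rw [← hf, ← rowSum_sub, ← rowSum_sub]
        exact rowSum_congr i fun j _ => by simp only [hD]; ring
      rw [h1]
      refine (abs_sub _ _).trans (add_le_add ((abs_sub _ _).trans (add_le_add (hfa i) ?_)) ?_)
      · refine abs_rowSum_le (by positivity) i fun j hij => ?_
        rw [abs_mul, abs_of_pos (hv0 i j)]
        exact (mul_le_mul (hv1 i j) (hzg i j hij) (abs_nonneg _) zero_le_one).trans (one_mul _).le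
      · refine abs_rowSum_le (by positivity) i fun j hij => (hRle i j hij).trans ?_
        refine (mul_le_mul (hv1 i j) ?_ (sq_nonneg _) zero_le_one).trans (one_mul _).le
        rw [← sq_abs]
        exact pow_le_pow_left₀ (abs_nonneg _) (hDle i j hij) 2
    refine (abs_le_of_rowSum_le hn (by positivity) hvs hvl δ hrow i).trans (le_of_eq ?_)
    field_simp
  · rw [pi_norm_lt_iff hrg]
    intro t
    refine lt_of_le_of_lt ?_ hd2
    have hs0 : 0 ≤ s := (abs_nonneg _).trans (hqs t)
    have hHg : ∀ t, |(fisherH z β γ).mulVec g t| ≤ s + 17 * b * Z * E := fun t => by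
      rw [profile_mulVec_eq hz hvs hw hHw δ g hRs hf hq t]
      refine (abs_sub _ _).trans (add_le_add (hqs t) ?_)
      rw [← pairSum_const_mul]
      refine abs_pairSum_le fun i j hij => ?_
      rw [abs_mul]
      refine mul_le_mul ?_ (hRle i j hij) (abs_nonneg _) (by positivity)
      refine (abs_sub _ _).trans ?_
      have := abs_sub (z i j t) (w t i)
      -- The residual is at most Z + 2 · 8bZ ≤ 17bZ, using b ≥ 1.
      nlinarith [hwb t i, hwb t j, hZ i j t hij]
    have hgt : g = (fisherH z β γ)⁻¹.mulVec ((fisherH z β γ).mulVec g) := by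
      rw [Matrix.mulVec_mulVec, Matrix.nonsing_inv_mul _ hH, Matrix.one_mulVec]
    have h0 : 0 ≤ rowSumNorm (fisherH z β γ)⁻¹ :=
      (Finset.sum_nonneg fun u _ => abs_nonneg _).trans (row_le_rowSumNorm _ t)
    have hbZ : 0 ≤ 17 * b * Z := by positivity
    have h1 : |g t| ≤ rowSumNorm (fisherH z β γ)⁻¹ * (s + 17 * b * Z * E) := by
      conv_lhs => rw [hgt]
      exact abs_mulVec_le _ hHg (by positivity) t
    refine h1.trans (mul_le_mul hHinv ?_ (by positivity) (h0.trans hHinv))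
    have := mul_le_mul_of_nonneg_left hEle hbZ
    linarith

/-! ### Existence of a solution by continuation -/

/-- The pair of expected statistics as a function of the pair of parameters. -/
noncomputable def momentMap {n p : ℕ} (z : Fin n → Fin n → Fin p → ℝ)
    (θ : (Fin n → ℝ) × (Fin p → ℝ)) : (Fin n → ℝ) × (Fin p → ℝ) :=
  (meanDeg z θ.1 θ.2, meanCov z θ.1 θ.2)

theorem contDiff_mu : ContDiff ℝ 1 mu :=
  Real.contDiff_exp.div (contDiff_const.add Real.contDiff_exp) fun x => by positivity

theorem contDiff_momentMap {n p : ℕ} (z : Fin n → Fin n → Fin p → ℝ) :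
    ContDiff ℝ 1 (momentMap z) := by
  have h1 : ∀ i j, ContDiff ℝ 1 fun θ : (Fin n → ℝ) × (Fin p → ℝ) =>
      mu (linPred z θ.1 θ.2 i j) := fun i j => by
    refine contDiff_mu.comp ?_
    unfold linPred
    fun_prop
  refine ContDiff.prodMk (contDiff_pi.2 fun i => ?_) (contDiff_pi.2 fun t => ?_)
  · exact ContDiff.sum fun j _ => h1 i j
  · exact ContDiff.sum fun i _ => ContDiff.sum fun j _ => contDiff_const.mul (h1 i j)

theorem hasDerivAt_mu_linPred_line {n p : ℕ} (z : Fin n → Fin n → Fin p → ℝ) (β x : Fin n → ℝ)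
    (γ y : Fin p → ℝ) (i j : Fin n) :
    HasDerivAt (fun u : ℝ => mu (linPred z (β + u • x) (γ + u • y) i j))
      (edgeVar z β γ i j * (x i + x j + ∑ t, z i j t * y t)) 0 := by
  have h1 : ∀ u : ℝ, linPred z (β + u • x) (γ + u • y) i j
      = linPred z β γ i j + u * (x i + x j + ∑ t, z i j t * y t) := fun u => by
    simp only [linPred, Pi.add_apply, Pi.smul_apply, smul_eq_mul, mul_add, Finset.mul_sum,
      Finset.sum_add_distrib]
    rw [Finset.sum_congr rfl fun t _ => mul_left_comm (z i j t) u (y t)]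
    ring
  have h2 : HasDerivAt (fun u : ℝ => linPred z β γ i j + u * (x i + x j + ∑ t, z i j t * y t))
      (x i + x j + ∑ t, z i j t * y t) 0 := by
    simpa using ((hasDerivAt_id' (0 : ℝ)).mul_const (x i + x j + ∑ t, z i j t * y t)).const_add
      (linPred z β γ i j)
  simp only [h1]
  have h3 := (hasDerivAt_mu (linPred z β γ i j + 0 * (x i + x j + ∑ t, z i j t * y t))).comp
    (0 : ℝ) h2
  simpa [edgeVar, Function.comp_def] using h3

/-- A vector in the kernel of the derivative, tested against itself, gives Σ v D² = 0. All edge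
variances are positive at every θ, so D = 0 and `hinj` applies. The derivative is therefore
injective, hence surjective because source and target coincide, and a map with surjective strict
derivative is locally open. -/
theorem map_nhds_momentMap {n p : ℕ} {z : Fin n → Fin n → Fin p → ℝ}
    (hz : ∀ i j, z i j = z j i)
    (hinj : ∀ (x : Fin n → ℝ) (y : Fin p → ℝ),
      (∀ i j, i ≠ j → x i + x j + ∑ t, z i j t * y t = 0) → x = 0 ∧ y = 0)
    (θ : (Fin n → ℝ) × (Fin p → ℝ)) :
    map (momentMap z) (𝓝 θ) = 𝓝 (momentMap z θ) := by
  have hs := (contDiff_momentMap z).contDiffAt.hasStrictFDerivAt (x := θ) one_ne_zero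
  refine hs.map_nhds_eq_of_surj ?_
  rw [LinearMap.range_eq_top]
  refine LinearMap.injective_iff_surjective.1 ?_
  rw [← LinearMap.ker_eq_bot, LinearMap.ker_eq_bot']
  rintro ⟨x, y⟩ hxy
  have hline : HasDerivAt (fun u : ℝ => momentMap z (θ + u • (x, y))) 0 0 := by
    have h1 : HasDerivAt (fun u : ℝ => θ + u • (x, y)) (x, y) 0 := by
      simpa using ((hasDerivAt_id' (0 : ℝ)).smul_const (x, y)).const_add θ
    have h2 : HasFDerivAt (momentMap z) (fderiv ℝ (momentMap z) θ) (θ + (0 : ℝ) • (x, y)) := by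
      simpa using hs.hasFDerivAt
    have h3 := h2.comp_hasDerivAt (0 : ℝ) h1
    have h4 : fderiv ℝ (momentMap z) θ (x, y) = 0 := hxy
    rwa [h4] at h3
  have hF : ∀ i, rowSum (fun i j => edgeVar z θ.1 θ.2 i j *
      (x i + x j + ∑ t, z i j t * y t)) i = 0 := fun i => by
    have h1 : HasDerivAt (fun u : ℝ => meanDeg z (θ.1 + u • x) (θ.2 + u • y) i) 0 0 :=
      hasDerivAt_pi.1 hline.fst i
    exact (HasDerivAt.fun_sum fun j _ =>
      hasDerivAt_mu_linPred_line z θ.1 x θ.2 y i j).unique h1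
  have hQ : ∀ t, pairSum (fun i j => z i j t * (edgeVar z θ.1 θ.2 i j *
      (x i + x j + ∑ t, z i j t * y t))) = 0 := fun t => by
    have h1 : HasDerivAt (fun u : ℝ => meanCov z (θ.1 + u • x) (θ.2 + u • y) t) 0 0 :=
      hasDerivAt_pi.1 hline.snd t
    exact (HasDerivAt.fun_sum fun i _ => HasDerivAt.fun_sum fun j _ =>
      (hasDerivAt_mu_linPred_line z θ.1 x θ.2 y i j).const_mul (z i j t)).unique h1
  have hDs : ∀ i j, x i + x j + ∑ t, z i j t * y t = x j + x i + ∑ t, z j i t * y t :=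
    fun i j => by rw [hz, add_comm (x i)]
  have h := sum_add_sum_eq_pairSum z (c := fun i j => edgeVar z θ.1 θ.2 i j *
    (x i + x j + ∑ t, z i j t * y t)) (fun i j => by rw [edgeVar_symm hz, hDs]) x y
  simp only [hF, hQ, mul_zero, Finset.sum_const_zero, add_zero] at h
  have hzero := pairSum_eq_zero_imp (fun i j _ => by
    have := mul_nonneg (edgeVar_pos z θ.1 θ.2 i j).le
      (mul_self_nonneg (x i + x j + ∑ t, z i j t * y t))
    linarith) h.symm
  have hlt : ∀ i j, j < i → x i + x j + ∑ t, z i j t * y t = 0 := fun i j hij => by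
    rcases mul_eq_zero.1 (hzero i j hij) with h1 | h1
    · exact h1
    · exact (mul_eq_zero.1 h1).resolve_left (edgeVar_pos z θ.1 θ.2 i j).ne'
  obtain ⟨hx, hy⟩ := hinj x y fun i j hij => by
    rcases lt_or_gt_of_ne hij with h' | h'
    · rw [hDs]; exact hlt j i h'
    · exact hlt i j h'
  rw [hx, hy]; rfl

/-- Continuation: if solutions along the segment of right-hand sides cannot reach the boundary
of a box, the moment equations have a solution in the box. -/
theorem exists_solution_of_interior {n p : ℕ} {z : Fin n → Fin n → Fin p → ℝ}
    {β : Fin n → ℝ} {γ : Fin p → ℝ}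
    (hopen : ∀ θ, map (momentMap z) (𝓝 θ) = 𝓝 (momentMap z θ))
    {rb rg : ℝ} (hrb : 0 < rb) (hrg : 0 < rg) (f : Fin n → ℝ) (q : Fin p → ℝ)
    (hint : ∀ u ∈ Set.Icc (0 : ℝ) 1, ∀ β' γ', ‖β' - β‖ ≤ rb → ‖γ' - γ‖ ≤ rg →
      (∀ i, meanDeg z β' γ' i - meanDeg z β γ i = u * f i) →
      (∀ t, meanCov z β' γ' t - meanCov z β γ t = u * q t) → ‖β' - β‖ < rb ∧ ‖γ' - γ‖ < rg) :
    ∃ β' γ', ‖β' - β‖ ≤ rb ∧ ‖γ' - γ‖ ≤ rg ∧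
      (∀ i, meanDeg z β' γ' i - meanDeg z β γ i = f i) ∧
      (∀ t, meanCov z β' γ' t - meanCov z β γ t = q t) := by
  set K : Set ((Fin n → ℝ) × (Fin p → ℝ)) := Metric.closedBall β rb ×ˢ Metric.closedBall γ rg
    with hK
  set path : ℝ → (Fin n → ℝ) × (Fin p → ℝ) := fun u => momentMap z (β, γ) + u • (f, q) with hpath
  have hpathc : Continuous path := by fun_prop
  have hKc : IsCompact K := (isCompact_closedBall β rb).prod (isCompact_closedBall γ rg)
  set S : Set ℝ := path ⁻¹' (momentMap z '' K) with hS
  have hSc : IsClosed S :=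
    ((hKc.image (contDiff_momentMap z).continuous).isClosed).preimage hpathc
  have hmem : ∀ u, u ∈ S → ∃ β' γ', ‖β' - β‖ ≤ rb ∧ ‖γ' - γ‖ ≤ rg ∧
      (∀ i, meanDeg z β' γ' i - meanDeg z β γ i = u * f i) ∧
      (∀ t, meanCov z β' γ' t - meanCov z β γ t = u * q t) ∧ momentMap z (β', γ') = path u := by
    rintro u ⟨⟨β', γ'⟩, ⟨h1, h2⟩, h3⟩
    refine ⟨β', γ', by simpa [dist_eq_norm] using h1, by simpa [dist_eq_norm] using h2,
      fun i => ?_, fun t => ?_, h3⟩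
    · have h4 : meanDeg z β' γ' i = meanDeg z β γ i + u * f i :=
        congrFun (congrArg Prod.fst h3) i
      rw [h4]; ring
    · have h4 : meanCov z β' γ' t = meanCov z β γ t + u * q t :=
        congrFun (congrArg Prod.snd h3) t
      rw [h4]; ring
  have h0 : (0 : ℝ) ∈ S := ⟨(β, γ), ⟨Metric.mem_closedBall_self hrb.le,
    Metric.mem_closedBall_self hrg.le⟩, by simp [hpath]⟩
  have hsub : Set.Icc (0 : ℝ) 1 ⊆ S := by
    -- The set of reachable u is closed because the box is compact. It is open at each of its points
    -- in [0, 1), because a solution there is interior to the box and the moment map is open at it.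
    refine IsClosed.Icc_subset_of_forall_mem_nhdsWithin (hSc.inter isClosed_Icc) h0 ?_
    rintro u ⟨huS, hu⟩
    obtain ⟨β', γ', h1, h2, h3, h4, h5⟩ := hmem u huS
    obtain ⟨h6, h7⟩ := hint u ⟨hu.1, hu.2.le⟩ β' γ' h1 h2 h3 h4
    have hKn : K ∈ 𝓝 (β', γ') := by
      refine prod_mem_nhds ?_ ?_
      · exact mem_of_superset (Metric.isOpen_ball.mem_nhds
          (by simpa [dist_eq_norm] using h6)) Metric.ball_subset_closedBall
      · exact mem_of_superset (Metric.isOpen_ball.mem_nhds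
          (by simpa [dist_eq_norm] using h7)) Metric.ball_subset_closedBall
    have h8 : momentMap z '' K ∈ 𝓝 (path u) := by
      rw [← h5, ← hopen]; exact image_mem_map hKn
    exact mem_nhdsWithin_of_mem_nhds (hpathc.continuousAt.preimage_mem_nhds h8)
  obtain ⟨β', γ', h1, h2, h3, h4, -⟩ := hmem 1 (hsub ⟨zero_le_one, le_rfl⟩)
  exact ⟨β', γ', h1, h2, fun i => by rw [h3, one_mul], fun t => by rw [h4, one_mul]⟩

/-- Existence of a solution of the moment equations near the true parameter, for noise vectors
`f` and `q` that are small in the relevant norms. -/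
theorem exists_solution {n p : ℕ} (hn : 8 ≤ n) {z : Fin n → Fin n → Fin p → ℝ}
    (hz : ∀ i j, z i j = z j i) {β : Fin n → ℝ} {γ : Fin p → ℝ} {b Z ρ : ℝ} (hb : 1 ≤ b)
    (hvl : ∀ i j, i ≠ j → 1 / b ≤ edgeVar z β γ i j) (hZ0 : 0 ≤ Z)
    (hZ : ∀ i j t, i ≠ j → |z i j t| ≤ Z) {w : Fin p → Fin n → ℝ}
    (hw : ∀ t i, rowSum (fun i j => edgeVar z β γ i j * (w t i + w t j)) i
      = rowSum (fun i j => edgeVar z β γ i j * z i j t) i)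
    (hHw : ∀ s t, fisherH z β γ s t
        = pairSum fun i j => z i j s * (edgeVar z β γ i j * (z i j t - w t i - w t j)))
    (hH : IsUnit (fisherH z β γ).det) (hHinv : rowSumNorm (fisherH z β γ)⁻¹ ≤ ρ / n ^ 2)
    {a N s rb rg : ℝ} (hrb : 0 < rb) (hrg : 0 < rg)
    (hd1 : 2 * rb + p * Z * rg ≤ 1 / 2)
    (hd2 : ρ / n ^ 2 * (s + 17 * b * Z * (8 * b / n * N + 4 * (p * (s * rg)))) < rg)
    (hd3 : 8 * b / n * (a + n * (p * Z * rg) + n * (2 * rb + p * Z * rg) ^ 2) < rb)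
    {f : Fin n → ℝ} {q : Fin p → ℝ} (hfa : ∀ i, |f i| ≤ a) (hfN : ∑ i, f i ^ 2 ≤ N)
    (hqs : ∀ t, |q t - ∑ i, w t i * f i| ≤ s) :
    ∃ β' γ', ‖β' - β‖ ≤ rb ∧ ‖γ' - γ‖ ≤ rg ∧
      (∀ i, meanDeg z β' γ' i - meanDeg z β γ i = f i) ∧
      (∀ t, meanCov z β' γ' t - meanCov z β γ t = q t) := by
  refine exists_solution_of_interior (map_nhds_momentMap hz fun x y h =>
    eq_zero_of_linPred_eq_zero hn hz (by positivity) hvl hH h) hrb hrg f q ?_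
  intro u hu β' γ' h1 h2 h3 h4
  -- All three noise bounds survive multiplication by u, so the a priori bound holds along the whole
  -- segment.
  have hu1 : |u| ≤ 1 := abs_le.2 ⟨by linarith [hu.1], hu.2⟩
  refine norm_lt_of_moment_eq hn hz hb hvl hZ0 hZ hw hHw hH hHinv hrb hrg hd1 hd2 hd3
    (f := fun i => u * f i) (q := fun t => u * q t) (fun i => ?_) ?_ (fun t => ?_) h1 h2 h3 h4
  · rw [abs_mul]
    exact (mul_le_of_le_one_left (abs_nonneg _) hu1).trans (hfa i)
  · refine (Finset.sum_le_sum fun i _ => ?_).trans hfN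
    rw [mul_pow]
    exact mul_le_of_le_one_left (sq_nonneg _) ((sq_le_one_iff_abs_le_one u).2 hu1)
  · have : u * q t - ∑ i, w t i * (u * f i) = u * (q t - ∑ i, w t i * f i) := by
      rw [mul_sub, Finset.mul_sum]
      congr 1
      exact Finset.sum_congr rfl fun i _ => by ring
    rw [this, abs_mul]
    exact (mul_le_of_le_one_left (abs_nonneg _) hu1).trans (hqs t)

end DPBeta

namespace DPBeta

open ProbabilityTheory

/-! ### The edge law -/

instance isProbabilityMeasure_edgeLaw (x : ℝ) : IsProbabilityMeasure (edgeLaw x) := by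
  constructor
  obtain ⟨h0, h1⟩ := mu_mem_Icc x
  simp only [edgeLaw, Measure.add_apply, Measure.smul_apply, measure_univ, smul_eq_mul, mul_one]
  rw [← ENNReal.ofReal_add h0 (by linarith)]
  simp

theorem integral_edgeLaw (x : ℝ) (f : Bool → ℝ) :
    ∫ g, f g ∂edgeLaw x = mu x * f true + (1 - mu x) * f false := by
  obtain ⟨h0, h1⟩ := mu_mem_Icc x
  rw [edgeLaw, integral_add_measure (Integrable.of_finite.smul_measure ENNReal.ofReal_ne_top)
    (Integrable.of_finite.smul_measure ENNReal.ofReal_ne_top), integral_smul_measure,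
    integral_smul_measure, integral_dirac, integral_dirac, ENNReal.toReal_ofReal h0,
    ENNReal.toReal_ofReal (by linarith), smul_eq_mul, smul_eq_mul]

/-- The centered edge indicator. -/
noncomputable def edgeNoise (x : ℝ) (g : Bool) : ℝ := (if g then 1 else 0) - mu x

theorem integral_edgeNoise (x : ℝ) : ∫ g, edgeNoise x g ∂edgeLaw x = 0 := by
  rw [integral_edgeLaw]
  simp [edgeNoise]
  ring

theorem memLp_edgeLaw (x : ℝ) (f : Bool → ℝ) : MemLp f 2 (edgeLaw x) :=
  (memLp_two_iff_integrable_sq (measurable_of_countable f).aestronglyMeasurable).2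
    Integrable.of_finite

theorem variance_edgeNoise (x : ℝ) : Var[edgeNoise x; edgeLaw x] = muDeriv x := by
  rw [variance_of_integral_eq_zero (measurable_of_countable _).aemeasurable (integral_edgeNoise x)]
  change ∫ g, (edgeNoise x g) ^ 2 ∂edgeLaw x = _
  rw [integral_edgeLaw, ← mu_mul_one_sub]
  simp [edgeNoise]
  ring

/-! ### Even densities and exponential moments -/

/-- Reflection preserves the measure, so the integral equals its own negative. Integrability is not
needed, since the change of variables also holds for the default value 0. -/
theorem integral_withDensity_eq_zero_of_odd {S : Type*} [MeasurableSpace S] [AddGroup S]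
    [MeasurableNeg S] {μ : Measure S} (hμ : MeasurePreserving (Neg.neg : S → S) μ μ)
    {h : S → ENNReal} (hm : Measurable h) (he : ∀ x, h (-x) = h x) {X : S → ℝ}
    (hX : ∀ x, X (-x) = -X x) : ∫ x, X x ∂(μ.withDensity h) = 0 := by
  have hν : MeasurePreserving (MeasurableEquiv.neg S) (μ.withDensity h) (μ.withDensity h) := by
    refine ⟨(MeasurableEquiv.neg S).measurable, ?_⟩
    ext s hs
    rw [Measure.map_apply (MeasurableEquiv.neg S).measurable hs, withDensity_apply _ hs,
      withDensity_apply _ ((MeasurableEquiv.neg S).measurable hs)]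
    have := hμ.setLIntegral_comp_preimage hs hm
    simp only [he] at this
    exact this
  have h1 := hν.integral_comp' X
  have h2 : ∀ x, X ((MeasurableEquiv.neg S) x) = -X x := hX
  simp only [h2, integral_neg] at h1
  linarith

/-- From u²/2 ≤ e^u with u = a|X|/2. The exponential moment at half the decay rate thus gives the
second moments of both noise laws, as well as the tail of the discrete one. -/
theorem lintegral_sq_le_of_exp_moment {S : Type*} [MeasurableSpace S] {ν : Measure S} {X : S → ℝ}
    {a C : ℝ} (ha : 0 < a)
    (h : ∫⁻ x, ENNReal.ofReal (Real.exp (a * |X x| / 2)) ∂ν ≤ ENNReal.ofReal C) :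
    ∫⁻ x, ENNReal.ofReal (X x ^ 2) ∂ν ≤ ENNReal.ofReal (8 * C / a ^ 2) := by
  have h1 : ∀ x, ENNReal.ofReal (X x ^ 2)
      ≤ ENNReal.ofReal (8 / a ^ 2) * ENNReal.ofReal (Real.exp (a * |X x| / 2)) := fun x => by
    rw [← ENNReal.ofReal_mul (by positivity)]
    refine ENNReal.ofReal_le_ofReal ?_
    have hu : 0 ≤ a * |X x| / 2 := by positivity
    have h2 := Real.quadratic_le_exp_of_nonneg hu
    rw [div_mul_eq_mul_div, le_div_iff₀ (by positivity)]
    have h3 : X x ^ 2 * a ^ 2 = 8 * ((a * |X x| / 2) ^ 2 / 2) := by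
      rw [← sq_abs (X x)]; ring
    linarith
  refine (lintegral_mono h1).trans ?_
  rw [lintegral_const_mul' _ _ ENNReal.ofReal_ne_top]
  refine (mul_le_mul_right h _).trans ?_
  rw [← ENNReal.ofReal_mul (by positivity)]
  exact ENNReal.ofReal_le_ofReal (le_of_eq (by ring))

theorem memLp_two_of_lintegral_sq_le {S : Type*} [MeasurableSpace S] {ν : Measure S} {X : S → ℝ}
    (hX : Measurable X) {C : ℝ}
    (h : ∫⁻ x, ENNReal.ofReal (X x ^ 2) ∂ν ≤ ENNReal.ofReal C) : MemLp X 2 ν := by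
  rw [memLp_two_iff_integrable_sq hX.aestronglyMeasurable]
  refine ⟨(hX.pow_const 2).aestronglyMeasurable, ?_⟩
  rw [hasFiniteIntegral_iff_ofReal (ae_of_all _ fun x => sq_nonneg (X x))]
  exact h.trans_lt ENNReal.ofReal_lt_top

theorem lintegral_sq_eq_variance {S : Type*} [MeasurableSpace S] {ν : Measure S} {X : S → ℝ}
    (hX : MemLp X 2 ν) (h0 : ∫ x, X x ∂ν = 0) :
    ∫⁻ x, ENNReal.ofReal (X x ^ 2) ∂ν = ENNReal.ofReal (Var[X; ν]) := by
  rw [variance_of_integral_eq_zero hX.aestronglyMeasurable.aemeasurable h0]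
  exact (ofReal_integral_eq_lintegral_ofReal hX.integrable_sq
    (ae_of_all _ fun x => sq_nonneg (X x))).symm

theorem variance_le_of_lintegral_sq_le {S : Type*} [MeasurableSpace S] {ν : Measure S}
    {X : S → ℝ} (hX : Measurable X) {C : ℝ} (hC : 0 ≤ C) (h0 : ∫ x, X x ∂ν = 0)
    (h : ∫⁻ x, ENNReal.ofReal (X x ^ 2) ∂ν ≤ ENNReal.ofReal C) : Var[X; ν] ≤ C := by
  rw [lintegral_sq_eq_variance (memLp_two_of_lintegral_sq_le hX h) h0] at h
  exact (ENNReal.ofReal_le_ofReal_iff hC).1 h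

/-! ### The discrete Laplace law -/

theorem hasSum_pow_natAbs {r : ℝ} (h0 : 0 ≤ r) (h1 : r < 1) :
    HasSum (fun x : ℤ => r ^ x.natAbs) ((1 + r) / (1 - r)) := by
  have hg : HasSum (fun m : ℕ => r ^ m) (1 - r)⁻¹ := hasSum_geometric_of_lt_one h0 h1
  have hpos : HasSum (fun m : ℕ => (fun x : ℤ => r ^ x.natAbs) (m : ℤ)) (1 - r)⁻¹ := by
    simpa using hg
  have hneg : HasSum (fun m : ℕ => (fun x : ℤ => r ^ x.natAbs) (-((m : ℤ) + 1)))
      (r * (1 - r)⁻¹) := by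
    have h : ∀ m : ℕ, (fun x : ℤ => r ^ x.natAbs) (-((m : ℤ) + 1)) = r * r ^ m := fun m => by
      simp only
      rw [← pow_succ', show (-((m : ℤ) + 1)).natAbs = m + 1 by omega]
    rw [funext h]
    exact hg.mul_left r
  have h : HasSum (fun x : ℤ => r ^ x.natAbs) ((1 - r)⁻¹ + r * (1 - r)⁻¹) :=
    HasSum.of_nat_of_neg_add_one hpos hneg
  have h2 : (1 - r)⁻¹ + r * (1 - r)⁻¹ = (1 + r) / (1 - r) := by
    rw [div_eq_mul_inv]; ring
  rw [h2] at h
  exact h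

theorem lintegral_discreteLaplace (l : ℝ) (f : ℤ → ENNReal) :
    ∫⁻ x, f x ∂discreteLaplace l
      = ∑' x : ℤ, ENNReal.ofReal ((1 - l) / (1 + l) * l ^ x.natAbs) * f x := by
  rw [discreteLaplace, lintegral_withDensity_eq_lintegral_mul _ (measurable_of_countable _)
    (measurable_of_countable _), lintegral_count]
  rfl

theorem isProbabilityMeasure_discreteLaplace {l : ℝ} (h0 : 0 ≤ l) (h1 : l < 1) :
    IsProbabilityMeasure (discreteLaplace l) := by
  constructor
  rw [← lintegral_one, lintegral_discreteLaplace]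
  simp only [mul_one]
  have hs := (hasSum_pow_natAbs h0 h1).mul_left ((1 - l) / (1 + l))
  have hc : 0 ≤ (1 - l) / (1 + l) := div_nonneg (by linarith) (by linarith)
  rw [← ENNReal.ofReal_tsum_of_nonneg (fun x => mul_nonneg hc (pow_nonneg h0 _)) hs.summable,
    hs.tsum_eq]
  have : (1 - l) / (1 + l) * ((1 + l) / (1 - l)) = 1 := by
    have : 1 - l ≠ 0 := by linarith
    field_simp
  rw [this, ENNReal.ofReal_one]

/-- With r = e^(−a/2) the weights r^(2|x|) are tilted into r^|x|, and the total becomes (1 + r)²/(1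
+ r²) ≤ 2. -/
theorem discreteLaplace_exp_moment {a : ℝ} (ha : 0 < a) :
    ∫⁻ x, ENNReal.ofReal (Real.exp (a * |(x : ℝ)| / 2)) ∂discreteLaplace (Real.exp (-a))
      ≤ ENNReal.ofReal 2 := by
  rw [lintegral_discreteLaplace]
  set r := Real.exp (-(a / 2)) with hr
  have hr0 : 0 < r := Real.exp_pos _
  have hr1 : r < 1 := by rw [hr, Real.exp_lt_one_iff]; linarith
  have hl : Real.exp (-a) = r ^ 2 := by rw [hr, ← Real.exp_nat_mul]; congr 1; push_cast; ring
  have hc : 0 ≤ (1 - r ^ 2) / (1 + r ^ 2) := div_nonneg (by nlinarith) (by positivity)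
  have hterm : ∀ x : ℤ, ENNReal.ofReal ((1 - Real.exp (-a)) / (1 + Real.exp (-a)) *
      Real.exp (-a) ^ x.natAbs) * ENNReal.ofReal (Real.exp (a * |(x : ℝ)| / 2))
      = ENNReal.ofReal ((1 - r ^ 2) / (1 + r ^ 2) * r ^ x.natAbs) := fun x => by
    rw [hl, ← ENNReal.ofReal_mul (mul_nonneg hc (by positivity))]
    congr 1
    have h1 : |(x : ℝ)| = x.natAbs := by rw [Nat.cast_natAbs, Int.cast_abs]
    have h2 : Real.exp (a * |(x : ℝ)| / 2) * r ^ x.natAbs = 1 := by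
      rw [h1, hr, ← Real.exp_nat_mul, ← Real.exp_add, ← Real.exp_zero]
      congr 1; ring
    rw [← pow_mul, mul_comm 2, pow_mul]
    linear_combination (1 - r ^ 2) / (1 + r ^ 2) * r ^ x.natAbs * h2
  have hs := (hasSum_pow_natAbs hr0.le hr1).mul_left ((1 - r ^ 2) / (1 + r ^ 2))
  rw [tsum_congr hterm, ← ENNReal.ofReal_tsum_of_nonneg
    (fun x => mul_nonneg hc (pow_nonneg hr0.le _)) hs.summable, hs.tsum_eq]
  refine ENNReal.ofReal_le_ofReal ?_
  have h3 : (1 - r ^ 2) / (1 + r ^ 2) * ((1 + r) / (1 - r)) = (1 + r) ^ 2 / (1 + r ^ 2) := by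
    have : 1 - r ≠ 0 := by linarith
    field_simp; ring
  rw [h3, div_le_iff₀ (by positivity)]
  nlinarith [sq_nonneg (1 - r)]

theorem discreteLaplace_sq_le {a : ℝ} (ha : 0 < a) :
    ∫⁻ x, ENNReal.ofReal ((x : ℝ) ^ 2) ∂discreteLaplace (Real.exp (-a))
      ≤ ENNReal.ofReal (16 / a ^ 2) := by
  have h := lintegral_sq_le_of_exp_moment (X := fun x : ℤ => (x : ℝ)) ha
    (discreteLaplace_exp_moment ha)
  norm_num at h
  exact h

theorem integral_discreteLaplace (l : ℝ) : ∫ x, (x : ℝ) ∂discreteLaplace l = 0 := by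
  refine integral_withDensity_eq_zero_of_odd ⟨measurable_of_countable _, ?_⟩
    (measurable_of_countable _) (fun x => by rw [Int.natAbs_neg]) fun x => by push_cast; ring
  ext s hs
  rw [Measure.map_apply (measurable_of_countable _) hs]
  rw [Measure.count_apply hs, Measure.count_apply (measurable_of_countable _ hs)]
  congr 1
  have h := (neg_injective (G := ℤ)).encard_image ((Neg.neg : ℤ → ℤ) ⁻¹' s)
  rw [← h, Set.image_preimage_eq _ neg_surjective]

theorem discreteLaplace_tail {a : ℝ} (ha : 0 < a) (y : ℝ) :
    discreteLaplace (Real.exp (-a)) {x | y < |(x : ℝ)|}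
      ≤ ENNReal.ofReal (2 * Real.exp (-(a * y / 2))) := by
  have h1 : discreteLaplace (Real.exp (-a)) {x | y < |(x : ℝ)|}
      ≤ discreteLaplace (Real.exp (-a)) {x | ENNReal.ofReal (Real.exp (a * y / 2))
        ≤ ENNReal.ofReal (Real.exp (a * |(x : ℝ)| / 2))} := by
    refine measure_mono fun x hx => ENNReal.ofReal_le_ofReal (Real.exp_le_exp.2 ?_)
    have := mul_lt_mul_of_pos_left (show y < |(x : ℝ)| from hx) ha
    linarith
  have h2 := mul_meas_ge_le_lintegral (μ := discreteLaplace (Real.exp (-a)))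
    (f := fun x : ℤ => ENNReal.ofReal (Real.exp (a * |(x : ℝ)| / 2))) (measurable_of_countable _)
    (ENNReal.ofReal (Real.exp (a * y / 2)))
  have h3 := h2.trans (discreteLaplace_exp_moment ha)
  have h4 : ENNReal.ofReal (2 * Real.exp (-(a * y / 2)))
      = ENNReal.ofReal 2 / ENNReal.ofReal (Real.exp (a * y / 2)) := by
    rw [← ENNReal.ofReal_div_of_pos (Real.exp_pos _), Real.exp_neg,
      div_eq_mul_inv 2 (Real.exp _)]
  refine h1.trans ?_
  rw [h4, ENNReal.le_div_iff_mul_le (Or.inl (by simpa using Real.exp_pos _))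
    (Or.inl ENNReal.ofReal_ne_top), mul_comm]
  exact h3

/-! ### The Laplace law -/

theorem integral_exp_neg_abs_div {c : ℝ} (hc : 0 < c) :
    ∫ x : ℝ, Real.exp (-|x| / c) = 2 * c := by
  have h1 : ∀ x : ℝ, Real.exp (-|x| / c) = (fun y => Real.exp (-c⁻¹ * y)) |x| := fun x => by
    simp only; congr 1; field_simp
  simp only [h1]
  rw [integral_comp_abs (f := fun y => Real.exp (-c⁻¹ * y)), integral_exp_mul_Ioi (by simpa)]
  simp

theorem lintegral_exp_neg_abs_div {c d : ℝ} (hc : 0 < c) (hd : 0 ≤ d) :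
    ∫⁻ x : ℝ, ENNReal.ofReal (Real.exp (-|x| / c) * d) = ENNReal.ofReal (2 * c * d) := by
  have hi : Integrable fun x : ℝ => Real.exp (-|x| / c) := by
    -- A non-integrable function has integral 0 by convention, which contradicts the positive value
    -- just computed.
    by_contra h
    have := integral_undef h
    rw [integral_exp_neg_abs_div hc] at this
    linarith
  rw [← ofReal_integral_eq_lintegral_ofReal (hi.mul_const d)
    (ae_of_all _ fun x => by positivity), integral_mul_const, integral_exp_neg_abs_div hc]

theorem isProbabilityMeasure_laplace {l : ℝ} (hl : 0 < l) : IsProbabilityMeasure (laplace l) := by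
  constructor
  rw [laplace, withDensity_apply _ MeasurableSet.univ, Measure.restrict_univ]
  simp only [div_eq_mul_inv _ (2 * l)]
  rw [lintegral_exp_neg_abs_div hl (by positivity), mul_inv_cancel₀ (by positivity),
    ENNReal.ofReal_one]

/-- The tilt doubles the scale of the exponential and leaves the prefactor unchanged, so the moment
is exactly 2. -/
theorem laplace_exp_moment {l : ℝ} (hl : 0 < l) :
    ∫⁻ x, ENNReal.ofReal (Real.exp (l⁻¹ * |x| / 2)) ∂laplace l ≤ ENNReal.ofReal 2 := by
  rw [laplace, lintegral_withDensity_eq_lintegral_mul _ (by fun_prop) (by fun_prop)]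
  have h1 : ∀ x : ℝ, ENNReal.ofReal (Real.exp (-|x| / l) / (2 * l)) *
      ENNReal.ofReal (Real.exp (l⁻¹ * |x| / 2))
      = ENNReal.ofReal (Real.exp (-|x| / (2 * l)) * (2 * l)⁻¹) := fun x => by
    rw [← ENNReal.ofReal_mul (by positivity)]
    congr 1
    have : Real.exp (-|x| / (2 * l)) = Real.exp (-|x| / l) * Real.exp (l⁻¹ * |x| / 2) := by
      rw [← Real.exp_add]
      congr 1; field_simp; ring
    rw [this]; ring
  simp only [Pi.mul_apply, h1]
  rw [lintegral_exp_neg_abs_div (by positivity) (by positivity)]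
  refine ENNReal.ofReal_le_ofReal (le_of_eq ?_)
  field_simp

theorem laplace_sq_le {l : ℝ} (hl : 0 < l) :
    ∫⁻ x, ENNReal.ofReal (x ^ 2) ∂laplace l ≤ ENNReal.ofReal (16 * l ^ 2) := by
  refine (lintegral_sq_le_of_exp_moment (X := fun x : ℝ => x) (inv_pos.2 hl)
    (laplace_exp_moment hl)).trans (ENNReal.ofReal_le_ofReal (le_of_eq ?_))
  field_simp
  norm_num

/-! ### Second moments and tail bounds -/

theorem lintegral_sq_add_le {S : Type*} [MeasurableSpace S] {ν : Measure S} {X Y : S → ℝ}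
    (hX : Measurable X) {A B : ℝ} (hA : 0 ≤ A) (hB : 0 ≤ B)
    (hXA : ∫⁻ x, ENNReal.ofReal (X x ^ 2) ∂ν ≤ ENNReal.ofReal A)
    (hYB : ∫⁻ x, ENNReal.ofReal (Y x ^ 2) ∂ν ≤ ENNReal.ofReal B) :
    ∫⁻ x, ENNReal.ofReal ((X x + Y x) ^ 2) ∂ν ≤ ENNReal.ofReal (2 * A + 2 * B) := by
  have h1 : ∀ x, ENNReal.ofReal ((X x + Y x) ^ 2)
      ≤ ENNReal.ofReal 2 * ENNReal.ofReal (X x ^ 2) + ENNReal.ofReal 2 * ENNReal.ofReal (Y x ^ 2) :=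
    fun x => by
      rw [← ENNReal.ofReal_mul zero_le_two, ← ENNReal.ofReal_mul zero_le_two,
        ← ENNReal.ofReal_add (by positivity) (by positivity)]
      exact ENNReal.ofReal_le_ofReal (by nlinarith [sq_nonneg (X x - Y x)])
  refine (lintegral_mono h1).trans ?_
  rw [lintegral_add_left (by fun_prop), lintegral_const_mul' _ _ ENNReal.ofReal_ne_top,
    lintegral_const_mul' _ _ ENNReal.ofReal_ne_top,
    ENNReal.ofReal_add (by positivity) (by positivity), ENNReal.ofReal_mul zero_le_two,
    ENNReal.ofReal_mul zero_le_two]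
  gcongr

theorem measure_lt_le_of_lintegral_le {S : Type*} [MeasurableSpace S] {ν : Measure S} {f : S → ℝ}
    (hf : Measurable f) {A c : ℝ} (hc : 0 < c)
    (h : ∫⁻ x, ENNReal.ofReal (f x) ∂ν ≤ ENNReal.ofReal A) :
    ν {x | c < f x} ≤ ENNReal.ofReal (A / c) := by
  have h1 : ν {x | c < f x} ≤ ν {x | ENNReal.ofReal c ≤ ENNReal.ofReal (f x)} :=
    measure_mono fun x hx => ENNReal.ofReal_le_ofReal (le_of_lt hx)
  refine h1.trans ?_
  rw [ENNReal.ofReal_div_of_pos hc, ENNReal.le_div_iff_mul_le (Or.inl (by simpa using hc))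
    (Or.inl ENNReal.ofReal_ne_top), mul_comm]
  exact (mul_meas_ge_le_lintegral hf.ennreal_ofReal _).trans h

/-- The second moment of a linear combination of independent centered variables. -/
theorem lintegral_sq_linear {ι : Type*} [Fintype ι] {Ω : ι → Type*}
    [∀ i, MeasurableSpace (Ω i)] {μ : ∀ i, Measure (Ω i)} [∀ i, IsProbabilityMeasure (μ i)]
    {X : ∀ i, Ω i → ℝ} (h : ∀ i, MemLp (X i) 2 (μ i)) (h0 : ∀ i, ∫ x, X i x ∂μ i = 0)
    (c : ι → ℝ) :
    ∫⁻ ω, ENNReal.ofReal ((∑ i, c i * X i (ω i)) ^ 2) ∂Measure.pi μ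
      = ENNReal.ofReal (∑ i, c i ^ 2 * Var[X i; μ i]) := by
  have hc : ∀ i, MemLp (fun x => c i * X i x) 2 (μ i) := fun i => (h i).const_mul (c i)
  have hce : ∀ i, MemLp (fun ω : ∀ i, Ω i => c i * X i (ω i)) 2 (Measure.pi μ) := fun i =>
    (hc i).comp_measurePreserving (measurePreserving_eval μ i)
  have hsum : MemLp (fun ω : ∀ i, Ω i => ∑ i, c i * X i (ω i)) 2 (Measure.pi μ) :=
    memLp_finsetSum _ fun i _ => hce i
  have hmean : ∫ ω, ∑ i, c i * X i (ω i) ∂Measure.pi μ = 0 := by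
    rw [integral_finsetSum _ fun i _ => (hce i).integrable one_le_two]
    refine Finset.sum_eq_zero fun i _ => ?_
    rw [integral_const_mul]
    have : ∫ ω, X i (ω i) ∂Measure.pi μ = ∫ x, X i x ∂μ i := by
      have hmp := measurePreserving_eval μ i
      conv_rhs => rw [← hmp.map_eq]
      rw [integral_map hmp.measurable.aemeasurable
        (by rw [hmp.map_eq]; exact (h i).aestronglyMeasurable)]
    rw [this, h0, mul_zero]
  rw [lintegral_sq_eq_variance hsum hmean]
  have hv := variance_sum_pi hc
  have hfun : (∑ i, fun ω : ∀ i, Ω i => c i * X i (ω i)) = fun ω => ∑ i, c i * X i (ω i) := by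
    ext ω; simp
  rw [hfun] at hv
  rw [hv]
  simp only [variance_const_mul]

/-! ### The graph noise as a linear functional of independent edges -/

/-- `pairSum` runs over j < i while `Pair` lists i < j; symmetry reconciles the two orders. -/
theorem pairSum_eq_sum_pair {n : ℕ} {f : Fin n → Fin n → ℝ} (hf : ∀ i j, f i j = f j i) :
    pairSum f = ∑ e : Pair n, f e.1.1 e.1.2 := by
  rw [← Finset.sum_subtype (Finset.univ.filter fun e : Fin n × Fin n => e.1 < e.2)
    (by simp) (fun e : Fin n × Fin n => f e.1 e.2), Finset.sum_filter,
    Fintype.sum_prod_type_right]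
  simp only [pairSum, Finset.sum_filter]
  exact Finset.sum_congr rfl fun i _ => Finset.sum_congr rfl fun j _ => by rw [hf]

theorem adj_symm {n : ℕ} (g : Pair n → Bool) (i j : Fin n) : adj g i j = adj g j i := by
  unfold adj
  rcases lt_trichotomy i j with h | h | h
  · simp [h, not_lt_of_gt h]
  · simp [h]
  · simp [h, not_lt_of_gt h]

theorem adj_pair {n : ℕ} (g : Pair n → Bool) (e : Pair n) :
    adj g e.1.1 e.1.2 = if g e then 1 else 0 := by
  unfold adj
  rw [dif_pos e.2]

/-- The centered adjacency matrix. -/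
noncomputable def adjNoise {n p : ℕ} (z : Fin n → Fin n → Fin p → ℝ) (β : Fin n → ℝ)
    (γ : Fin p → ℝ) (g : Pair n → Bool) (i j : Fin n) : ℝ := adj g i j - mu (linPred z β γ i j)

theorem adjNoise_symm {n p : ℕ} {z : Fin n → Fin n → Fin p → ℝ} (hz : ∀ i j, z i j = z j i)
    (β : Fin n → ℝ) (γ : Fin p → ℝ) (g : Pair n → Bool) (i j : Fin n) :
    adjNoise z β γ g i j = adjNoise z β γ g j i := by
  rw [adjNoise, adjNoise, adj_symm, linPred_symm hz]

theorem pairSum_adjNoise {n p : ℕ} {z : Fin n → Fin n → Fin p → ℝ} (hz : ∀ i j, z i j = z j i)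
    (β : Fin n → ℝ) (γ : Fin p → ℝ) (g : Pair n → Bool) {c : Fin n → Fin n → ℝ}
    (hc : ∀ i j, c i j = c j i) :
    pairSum (fun i j => c i j * adjNoise z β γ g i j)
      = ∑ e : Pair n, c e.1.1 e.1.2 * edgeNoise (linPred z β γ e.1.1 e.1.2) (g e) := by
  rw [pairSum_eq_sum_pair fun i j => by rw [hc, adjNoise_symm hz]]
  exact Finset.sum_congr rfl fun e _ => by rw [adjNoise, adj_pair, edgeNoise]

theorem rowSum_eq_pairSum {n : ℕ} {c : Fin n → Fin n → ℝ} (hc : ∀ i j, c i j = c j i)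
    (k : Fin n) :
    rowSum c k
      = pairSum fun i j => ((if i = k then 1 else 0) + (if j = k then 1 else 0)) * c i j := by
  rw [← sum_mul_rowSum (fun i => if i = k then (1 : ℝ) else 0) hc]
  simp

/-- An edge has at most one end at `k`, so its coefficient is 0 or 1 and equals its square; n − 1
edges meet `k`. -/
theorem sum_incidence_sq {n : ℕ} (k : Fin n) :
    ∑ e : Pair n, ((if e.1.1 = k then (1 : ℝ) else 0) + (if e.1.2 = k then 1 else 0)) ^ 2
      = (n : ℝ) - 1 := by
  have h := rowSum_eq_pairSum (c := fun _ _ => 1) (fun _ _ => rfl) k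
  rw [rowSum_const, pairSum_eq_sum_pair fun i j => by rw [add_comm]] at h
  rw [mul_one] at h
  rw [h]
  refine Finset.sum_congr rfl fun e _ => ?_
  have he := e.2.ne
  rcases eq_or_ne e.1.1 k with h1 | h1
  · have h2 : e.1.2 ≠ k := fun h2 => he (h1.trans h2.symm)
    simp [h1, h2]
  · by_cases h2 : e.1.2 = k <;> simp [h1, h2]

/-- The law of the edges. -/
noncomputable abbrev graphLaw {n p : ℕ} (z : Fin n → Fin n → Fin p → ℝ) (β : Fin n → ℝ)
    (γ : Fin p → ℝ) : Measure (Pair n → Bool) :=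
  Measure.pi fun e : Pair n => edgeLaw (linPred z β γ e.1.1 e.1.2)

theorem graphLaw_sq {n p : ℕ} (z : Fin n → Fin n → Fin p → ℝ) (β : Fin n → ℝ)
    (γ : Fin p → ℝ) (c : Pair n → ℝ) :
    ∫⁻ g, ENNReal.ofReal ((∑ e, c e * edgeNoise (linPred z β γ e.1.1 e.1.2) (g e)) ^ 2)
        ∂graphLaw z β γ
      = ENNReal.ofReal (∑ e, c e ^ 2 * edgeVar z β γ e.1.1 e.1.2) := by
  rw [lintegral_sq_linear (fun e => memLp_edgeLaw _ _) fun e => integral_edgeNoise _]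
  simp only [variance_edgeNoise]
  rfl

/-- Hoeffding's inequality for a linear functional of the edges. -/
theorem graphLaw_tail {n p : ℕ} (hn : 2 ≤ n) (z : Fin n → Fin n → Fin p → ℝ) (β : Fin n → ℝ)
    (γ : Fin p → ℝ) {c : Pair n → ℝ} (hc : ∑ e, c e ^ 2 = (n : ℝ) - 1) :
    graphLaw z β γ {g | √(n * Real.log n)
        ≤ ∑ e, c e * edgeNoise (linPred z β γ e.1.1 e.1.2) (g e)}
      ≤ ENNReal.ofReal (1 / (n : ℝ) ^ 2) := by
  have hn' : (2 : ℝ) ≤ n := by exact_mod_cast hn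
  have hlog : 0 ≤ Real.log n := Real.log_nonneg (by linarith)
  have hind : iIndepFun (fun (e : Pair n) (g : Pair n → Bool) =>
      c e * edgeNoise (linPred z β γ e.1.1 e.1.2) (g e)) (graphLaw z β γ) :=
    iIndepFun_pi (X := fun e x => c e * edgeNoise (linPred z β γ e.1.1 e.1.2) x)
      fun e => (measurable_of_countable _).aemeasurable
  have hsub : ∀ e ∈ Finset.univ, HasSubgaussianMGF (fun g : Pair n → Bool =>
      c e * edgeNoise (linPred z β γ e.1.1 e.1.2) (g e))
      (Real.toNNReal (c e ^ 2) * (‖(1 : ℝ) - 0‖₊ / 2) ^ 2) (graphLaw z β γ) := fun e _ => by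
    rw [Real.toNNReal_of_nonneg (sq_nonneg (c e))]
    refine HasSubgaussianMGF.const_mul ?_ (c e)
    refine HasSubgaussianMGF.of_map (Y := fun g : Pair n → Bool => g e)
      (X := edgeNoise (linPred z β γ e.1.1 e.1.2)) (measurable_pi_apply e).aemeasurable ?_
    rw [(measurePreserving_eval (fun e : Pair n => edgeLaw (linPred z β γ e.1.1 e.1.2)) e).map_eq]
    have h := hasSubgaussianMGF_of_mem_Icc (μ := edgeLaw (linPred z β γ e.1.1 e.1.2))
      (X := fun g : Bool => if g then (1 : ℝ) else 0) (a := 0) (b := 1)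
      (measurable_of_countable _).aemeasurable (ae_of_all _ fun g => by cases g <;> simp)
    have h2 : ∫ g, (if g then (1 : ℝ) else 0) ∂edgeLaw (linPred z β γ e.1.1 e.1.2)
        = mu (linPred z β γ e.1.1 e.1.2) := by rw [integral_edgeLaw]; simp
    rw [h2] at h
    exact h
  have h := HasSubgaussianMGF.measure_sum_ge_le_of_iIndepFun hind hsub (Real.sqrt_nonneg (n * Real.log n))
  have hsum : ((∑ e : Pair n, Real.toNNReal (c e ^ 2) * (‖(1 : ℝ) - 0‖₊ / 2) ^ 2 : NNReal) : ℝ) = (n - 1) / 4 := by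
    push_cast
    simp only [Real.coe_toNNReal _ (sq_nonneg _), sub_zero, norm_one]
    rw [← Finset.sum_mul, hc]
    ring
  rw [hsum, Real.sq_sqrt (by positivity)] at h
  rw [← ofReal_measureReal]
  refine ENNReal.ofReal_le_ofReal (h.trans ?_)
  have hexp : 1 / (n : ℝ) ^ 2 = Real.exp (-(2 * Real.log n)) := by
    rw [Real.exp_neg, two_mul, Real.exp_add, Real.exp_log (by linarith), one_div, pow_two]
  rw [hexp]
  -- The variance proxy is (n − 1)/4, so the exponent is 2n log n/(n − 1) ≥ 2 log n; this leaves
  -- room for a union over the n degrees.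
  refine Real.exp_le_exp.2 ?_
  rw [neg_div, neg_le_neg_iff, le_div_iff₀ (by linarith)]
  nlinarith

/-! ### The size of the noise -/

/-- The deviation of the released degrees from their expectations. -/
noncomputable def degNoise {n p : ℕ} (z : Fin n → Fin n → Fin p → ℝ) (β : Fin n → ℝ)
    (γ : Fin p → ℝ) (ω : Sample n p) (i : Fin n) : ℝ := noisyDeg ω i - meanDeg z β γ i

/-- The deviation of the released covariate statistic from its expectation. -/
noncomputable def covNoise {n p : ℕ} (z : Fin n → Fin n → Fin p → ℝ) (β : Fin n → ℝ)
    (γ : Fin p → ℝ) (ω : Sample n p) (t : Fin p) : ℝ := noisyCov z ω t - meanCov z β γ t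

theorem degNoise_eq {n p : ℕ} (z : Fin n → Fin n → Fin p → ℝ) (β : Fin n → ℝ)
    (γ : Fin p → ℝ) (ω : Sample n p) (i : Fin n) :
    degNoise z β γ ω i = rowSum (adjNoise z β γ ω.1) i + (ω.2.1 i : ℝ) := by
  have h : rowSum (adjNoise z β γ ω.1) i
      = rowSum (fun i j => adj ω.1 i j) i - rowSum (fun i j => mu (linPred z β γ i j)) i :=
    rowSum_sub _ _ i
  rw [h]
  simp only [degNoise, noisyDeg, meanDeg, rowSum]
  ring

theorem covNoise_eq {n p : ℕ} (z : Fin n → Fin n → Fin p → ℝ) (β : Fin n → ℝ)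
    (γ : Fin p → ℝ) (ω : Sample n p) (t : Fin p) :
    covNoise z β γ ω t = pairSum (fun i j => z i j t * adjNoise z β γ ω.1 i j) + ω.2.2 t := by
  have h : pairSum (fun i j => z i j t * adjNoise z β γ ω.1 i j)
      = pairSum (fun i j => z i j t * adj ω.1 i j)
        - pairSum (fun i j => z i j t * mu (linPred z β γ i j)) := by
    rw [← pairSum_sub]; exact pairSum_congr fun i j _ => by rw [adjNoise]; ring
  rw [h]
  simp only [covNoise, noisyCov, meanCov, pairSum]
  ring

/-- The edge coefficients of the `i`-th degree. -/
def incidence {n : ℕ} (i : Fin n) (e : Pair n) : ℝ :=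
  (if e.1.1 = i then 1 else 0) + (if e.1.2 = i then 1 else 0)

theorem rowSum_adjNoise {n p : ℕ} {z : Fin n → Fin n → Fin p → ℝ} (hz : ∀ i j, z i j = z j i)
    (β : Fin n → ℝ) (γ : Fin p → ℝ) (g : Pair n → Bool) (i : Fin n) :
    rowSum (adjNoise z β γ g) i
      = ∑ e : Pair n, incidence i e * edgeNoise (linPred z β γ e.1.1 e.1.2) (g e) := by
  rw [rowSum_eq_pairSum (adjNoise_symm hz β γ g), pairSum_adjNoise hz β γ g fun i j => add_comm _ _]
  rfl

/-- The covariate noise after projecting out the node effects. -/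
theorem profileNoise_eq {n p : ℕ} {z : Fin n → Fin n → Fin p → ℝ} (hz : ∀ i j, z i j = z j i)
    (β : Fin n → ℝ) (γ : Fin p → ℝ) (w : Fin p → Fin n → ℝ) (ω : Sample n p) (t : Fin p) :
    covNoise z β γ ω t - ∑ i, w t i * degNoise z β γ ω i
      = ∑ e : Pair n, (z e.1.1 e.1.2 t - w t e.1.1 - w t e.1.2)
          * edgeNoise (linPred z β γ e.1.1 e.1.2) (ω.1 e)
        + (∑ i, -w t i * (ω.2.1 i : ℝ) + ω.2.2 t) := by
  rw [← pairSum_adjNoise hz β γ ω.1 (c := fun i j => z i j t - w t i - w t j)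
    fun i j => by rw [hz]; ring]
  simp only [covNoise_eq, degNoise_eq, mul_add, Finset.sum_add_distrib]
  rw [sum_mul_rowSum (w t) (adjNoise_symm hz β γ ω.1)]
  have h : pairSum (fun i j => (z i j t - w t i - w t j) * adjNoise z β γ ω.1 i j)
      = pairSum (fun i j => z i j t * adjNoise z β γ ω.1 i j)
        - pairSum (fun i j => (w t i + w t j) * adjNoise z β γ ω.1 i j) := by
    rw [← pairSum_sub]; exact pairSum_congr fun i j _ => by ring
  rw [h]
  simp only [neg_mul, Finset.sum_neg_distrib]
  ring

theorem lintegral_comp_fst {α β : Type*} [MeasurableSpace α] [MeasurableSpace β]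
    (μ : Measure α) (ν : Measure β) [SFinite μ] [IsProbabilityMeasure ν] {f : α → ENNReal}
    (hf : Measurable f) : ∫⁻ x, f x.1 ∂μ.prod ν = ∫⁻ x, f x ∂μ :=
  measurePreserving_fst.lintegral_comp hf

theorem lintegral_comp_snd {α β : Type*} [MeasurableSpace α] [MeasurableSpace β]
    (μ : Measure α) (ν : Measure β) [IsProbabilityMeasure μ] [SFinite ν] {f : β → ENNReal}
    (hf : Measurable f) : ∫⁻ x, f x.2 ∂μ.prod ν = ∫⁻ x, f x ∂ν :=
  measurePreserving_snd.lintegral_comp hf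

/-- The law of the degree noises. -/
noncomputable abbrev degNoiseLaw (n : ℕ) (a : ℝ) : Measure (Fin n → ℤ) :=
  Measure.pi fun _ => discreteLaplace (Real.exp (-a))

/-- The law of the covariate noises. -/
noncomputable abbrev covNoiseLaw (p : ℕ) (l : ℝ) : Measure (Fin p → ℝ) :=
  Measure.pi fun _ => laplace l

theorem isProbabilityMeasure_discreteLaplace_exp {a : ℝ} (ha : 0 < a) :
    IsProbabilityMeasure (discreteLaplace (Real.exp (-a))) :=
  isProbabilityMeasure_discreteLaplace (Real.exp_pos _).le (by rw [Real.exp_lt_one_iff]; linarith)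

theorem degNoiseLaw_sq {n : ℕ} {a : ℝ} (ha : 0 < a) (c : Fin n → ℝ) :
    ∫⁻ x, ENNReal.ofReal ((∑ i, c i * (x i : ℝ)) ^ 2) ∂degNoiseLaw n a
      ≤ ENNReal.ofReal (16 / a ^ 2 * ∑ i, c i ^ 2) := by
  have := isProbabilityMeasure_discreteLaplace_exp ha
  have hm : Measurable fun x : ℤ => (x : ℝ) := measurable_of_countable _
  rw [lintegral_sq_linear (X := fun (_ : Fin n) (x : ℤ) => (x : ℝ))
    (fun _ => memLp_two_of_lintegral_sq_le hm (discreteLaplace_sq_le ha))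
    fun _ => integral_discreteLaplace _]
  refine ENNReal.ofReal_le_ofReal ?_
  rw [Finset.mul_sum]
  refine Finset.sum_le_sum fun i _ => ?_
  rw [mul_comm]
  exact mul_le_mul_of_nonneg_right (variance_le_of_lintegral_sq_le hm (by positivity)
    (integral_discreteLaplace _) (discreteLaplace_sq_le ha)) (sq_nonneg _)

theorem degNoiseLaw_tail {n : ℕ} {a : ℝ} (ha : 0 < a) (y : ℝ) :
    degNoiseLaw n a {x | ∃ i, y < |(x i : ℝ)|}
      ≤ ENNReal.ofReal (n * (2 * Real.exp (-(a * y / 2)))) := by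
  have := isProbabilityMeasure_discreteLaplace_exp ha
  rw [Set.ofPred_exists]
  refine (measure_iUnion_fintype_le _ _).trans ?_
  have h : ∀ i ∈ Finset.univ, degNoiseLaw n a {x | y < |(x i : ℝ)|}
      ≤ ENNReal.ofReal (2 * Real.exp (-(a * y / 2))) := fun i _ => by
    have h1 := (measurePreserving_eval
      (fun _ : Fin n => discreteLaplace (Real.exp (-a))) i).measure_preimage
      (s := {x : ℤ | y < |(x : ℝ)|}) (Set.to_countable _).measurableSet.nullMeasurableSet
    exact h1.le.trans (discreteLaplace_tail ha y)
  refine (Finset.sum_le_sum h).trans (le_of_eq ?_)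
  rw [Finset.sum_const, Finset.card_univ, Fintype.card_fin, nsmul_eq_mul,
    ENNReal.ofReal_mul n.cast_nonneg, ENNReal.ofReal_natCast]

theorem graphLaw_degree_tail {n p : ℕ} (hn : 2 ≤ n) {z : Fin n → Fin n → Fin p → ℝ}
    (hz : ∀ i j, z i j = z j i) (β : Fin n → ℝ) (γ : Fin p → ℝ) :
    graphLaw z β γ {g | ∃ i, √(n * Real.log n) < |rowSum (adjNoise z β γ g) i|}
      ≤ ENNReal.ofReal (2 / n) := by
  have hn' : (2 : ℝ) ≤ n := by exact_mod_cast hn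
  rw [Set.ofPred_exists]
  refine (measure_iUnion_fintype_le _ _).trans ?_
  have h : ∀ i ∈ Finset.univ,
      graphLaw z β γ {g | √(n * Real.log n) < |rowSum (adjNoise z β γ g) i|}
      ≤ ENNReal.ofReal (2 / (n : ℝ) ^ 2) := fun i _ => by
    have h1 := graphLaw_tail hn z β γ (sum_incidence_sq i)
    have h2 := graphLaw_tail hn z β γ (c := fun e => -incidence i e)
      (by simp only [neg_sq]; exact sum_incidence_sq i)
    have h3 : {g | √(n * Real.log n) < |rowSum (adjNoise z β γ g) i|}
        ⊆ {g | √(n * Real.log n) ≤ ∑ e : Pair n, incidence i e *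
            edgeNoise (linPred z β γ e.1.1 e.1.2) (g e)}
          ∪ {g | √(n * Real.log n) ≤ ∑ e : Pair n, -incidence i e *
            edgeNoise (linPred z β γ e.1.1 e.1.2) (g e)} := by
      intro g hg
      rw [Set.mem_ofPred_eq, rowSum_adjNoise hz] at hg
      rcases lt_abs.1 hg with h | h
      · exact Or.inl h.le
      · refine Or.inr ?_
        simp only [Set.mem_ofPred_eq, neg_mul, Finset.sum_neg_distrib]
        exact h.le
    refine (measure_mono h3).trans ((measure_union_le _ _).trans ((add_le_add h1 h2).trans ?_))
    rw [← ENNReal.ofReal_add (by positivity) (by positivity)]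
    exact ENNReal.ofReal_le_ofReal (le_of_eq (by ring))
  refine (Finset.sum_le_sum h).trans (le_of_eq ?_)
  rw [Finset.sum_const, Finset.card_univ, Fintype.card_fin, nsmul_eq_mul,
    ← ENNReal.ofReal_natCast, ← ENNReal.ofReal_mul n.cast_nonneg]
  congr 1
  field_simp

theorem covNoiseLaw_sq {p : ℕ} {l : ℝ} (hl : 0 < l) (t : Fin p) :
    ∫⁻ x, ENNReal.ofReal (x t ^ 2) ∂covNoiseLaw p l ≤ ENNReal.ofReal (16 * l ^ 2) := by
  have := isProbabilityMeasure_laplace hl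
  have h := (measurePreserving_eval (fun _ : Fin p => laplace l) t).lintegral_comp
    (f := fun x : ℝ => ENNReal.ofReal (x ^ 2)) (by fun_prop)
  exact h.le.trans (laplace_sq_le hl)

theorem norm_le_zMax {n p : ℕ} {z : Fin n → Fin n → Fin p → ℝ} (hz : ∀ i j, z i j = z j i)
    (i j : Fin n) (hij : i ≠ j) : ‖z i j‖ ≤ zMax z := by
  have h : ∀ e : Pair n, ‖z e.1.1 e.1.2‖ ≤ zMax z := fun e =>
    le_ciSup (f := fun e : Pair n => ‖z e.1.1 e.1.2‖) (Set.finite_range _).bddAbove e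
  rcases lt_or_gt_of_ne hij with h' | h'
  · exact h ⟨(i, j), h'⟩
  · rw [hz]; exact h ⟨(j, i), h'⟩

theorem abs_le_zMax {n p : ℕ} {z : Fin n → Fin n → Fin p → ℝ} (hz : ∀ i j, z i j = z j i)
    (i j : Fin n) (t : Fin p) (hij : i ≠ j) : |z i j t| ≤ zMax z :=
  (norm_le_pi_norm (z i j) t).trans (norm_le_zMax hz i j hij)

/-- Projecting out the node effects does not increase the variance. -/
theorem pairSum_residual_sq_le {n p : ℕ} {z : Fin n → Fin n → Fin p → ℝ}
    (hz : ∀ i j, z i j = z j i) {β : Fin n → ℝ} {γ : Fin p → ℝ} {w : Fin p → Fin n → ℝ}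
    (hw : ∀ t i, rowSum (fun i j => edgeVar z β γ i j * (w t i + w t j)) i
      = rowSum (fun i j => edgeVar z β γ i j * z i j t) i) (t : Fin p) :
    pairSum (fun i j => (z i j t - w t i - w t j) ^ 2 * edgeVar z β γ i j)
      ≤ (n : ℝ) ^ 2 * zMax z ^ 2 := by
  have horth := pairSum_residual_eq_zero hz (edgeVar_symm hz β γ) hw t (w t)
  have h1 : pairSum (fun i j => edgeVar z β γ i j * z i j t ^ 2)
      = pairSum (fun i j => (z i j t - w t i - w t j) ^ 2 * edgeVar z β γ i j)
        + 2 * pairSum (fun i j => (w t i + w t j) *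
          (edgeVar z β γ i j * (z i j t - w t i - w t j)))
        + pairSum (fun i j => edgeVar z β γ i j * (w t i + w t j) ^ 2) := by
    rw [← pairSum_const_mul, ← pairSum_add, ← pairSum_add]
    exact pairSum_congr fun i j _ => by ring
  have h2 : 0 ≤ pairSum (fun i j => edgeVar z β γ i j * (w t i + w t j) ^ 2) :=
    pairSum_nonneg fun i j _ => mul_nonneg (edgeVar_pos z β γ i j).le (sq_nonneg _)
  have h3 : pairSum (fun i j => edgeVar z β γ i j * z i j t ^ 2)
      ≤ pairSum fun _ _ : Fin n => zMax z ^ 2 := pairSum_le_pairSum fun i j hij => by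
    rw [← sq_abs (z i j t)]
    have := pow_le_pow_left₀ (abs_nonneg _) (abs_le_zMax hz i j t hij) 2
    exact (mul_le_mul (muDeriv_le_one _) this (sq_nonneg _) zero_le_one).trans (one_mul _).le
  have h4 := pairSum_const_le (n := n) (sq_nonneg (zMax z))
  rw [horth] at h1
  linarith

theorem measurable_adj {n : ℕ} (i j : Fin n) : Measurable fun g : Pair n → Bool => adj g i j :=
  measurable_of_finite _

theorem measurable_degNoise {n p : ℕ} (z : Fin n → Fin n → Fin p → ℝ) (β : Fin n → ℝ)
    (γ : Fin p → ℝ) (i : Fin n) : Measurable fun ω : Sample n p => degNoise z β γ ω i := by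
  have h : ∀ i j, Measurable fun ω : Sample n p => adj ω.1 i j := fun i j =>
    (measurable_adj i j).comp measurable_fst
  have h2 : Measurable fun ω : Sample n p => (ω.2.1 i : ℝ) :=
    (measurable_of_countable (fun x : Fin n → ℤ => (x i : ℝ))).comp
      (measurable_fst.comp measurable_snd)
  unfold degNoise noisyDeg
  fun_prop

theorem measurable_covNoise {n p : ℕ} (z : Fin n → Fin n → Fin p → ℝ) (β : Fin n → ℝ)
    (γ : Fin p → ℝ) (t : Fin p) : Measurable fun ω : Sample n p => covNoise z β γ ω t := by
  have h : ∀ i j, Measurable fun ω : Sample n p => adj ω.1 i j := fun i j =>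
    (measurable_adj i j).comp measurable_fst
  unfold covNoise noisyCov
  fun_prop

theorem isProbabilityMeasure_sampleLaw {n p : ℕ} (hp : 0 < p) (z : Fin n → Fin n → Fin p → ℝ)
    (β : Fin n → ℝ) (γ : Fin p → ℝ) {k : ℕ} {ε : ℝ} (hk : 0 < k) (hε : 0 < ε)
    (hZ : 0 < zMax z) : IsProbabilityMeasure (sampleLaw z β γ k ε) := by
  have hk' : (0 : ℝ) < k := by exact_mod_cast hk
  have hp' : (0 : ℝ) < p := by exact_mod_cast hp
  have h1 : IsProbabilityMeasure (discreteLaplace (Real.exp (-ε / (4 * k)))) := by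
    rw [neg_div]
    exact isProbabilityMeasure_discreteLaplace_exp (by positivity)
  have h2 : IsProbabilityMeasure (laplace (2 * p * k * zMax z / ε)) :=
    isProbabilityMeasure_laplace (by positivity)
  unfold sampleLaw
  infer_instance

/-- The three summands are the variances of the projected graph noise, of the degree noise weighted
by |w| ≤ 8bZ, and of the covariate noise. Each of m², mκ², κ² is at most (m + κ²)², and 65538 = 2 +
2 · 2 · 256 · 64. -/
theorem noise_second_moment_le {m κ b Z q : ℝ} (hm : 1 ≤ m) (hb : 1 ≤ b) :
    2 * (m ^ 2 * Z ^ 2) + 2 * (2 * (256 * κ ^ 2 * (m * (8 * b * Z) ^ 2))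
        + 2 * (64 * q ^ 2 * κ ^ 2 * Z ^ 2))
      ≤ (65538 + 256 * q ^ 2) * (b ^ 2 * Z * (m + κ ^ 2)) ^ 2 := by
  set S := (m + κ ^ 2) ^ 2 with hS
  have hS0 : 0 ≤ S := sq_nonneg _
  have hb2 : (1 : ℝ) ≤ b ^ 2 := one_le_pow₀ hb
  have hb4 : b ^ 2 ≤ b ^ 4 := pow_le_pow_right₀ hb (by norm_num)
  have e1 : m ^ 2 ≤ S := by nlinarith [sq_nonneg κ, sq_nonneg (κ ^ 2)]
  have e2 : m * κ ^ 2 ≤ S := by nlinarith [sq_nonneg κ, sq_nonneg (κ ^ 2)]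
  have e3 : κ ^ 2 ≤ S := le_trans (by nlinarith [sq_nonneg κ]) e2
  have hbS : S ≤ b ^ 4 * S := le_mul_of_one_le_left hS0 (hb2.trans hb4)
  have f1 : m ^ 2 * Z ^ 2 ≤ b ^ 4 * S * Z ^ 2 :=
    mul_le_mul_of_nonneg_right (e1.trans hbS) (sq_nonneg _)
  have f2 : b ^ 2 * (m * κ ^ 2) * Z ^ 2 ≤ b ^ 4 * S * Z ^ 2 :=
    mul_le_mul_of_nonneg_right
      (mul_le_mul hb4 e2 (mul_nonneg (by linarith) (sq_nonneg _)) (by positivity)) (sq_nonneg _)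
  have f3 : κ ^ 2 * Z ^ 2 ≤ b ^ 4 * S * Z ^ 2 :=
    mul_le_mul_of_nonneg_right (e3.trans hbS) (sq_nonneg _)
  have f4 := mul_le_mul_of_nonneg_left f3 (by positivity : (0 : ℝ) ≤ 256 * q ^ 2)
  have h1 : (65538 + 256 * q ^ 2) * (b ^ 2 * Z * (m + κ ^ 2)) ^ 2
      = 2 * (b ^ 4 * S * Z ^ 2) + 65536 * (b ^ 4 * S * Z ^ 2)
        + 256 * q ^ 2 * (b ^ 4 * S * Z ^ 2) := by
    rw [hS]; ring
  rw [h1]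
  linarith

set_option maxHeartbeats 1000000 in
/-- With high probability the noise is small in all the norms that matter. -/
theorem noise_tail {n p : ℕ} (hn : 2 ≤ n) (hp : 0 < p) {z : Fin n → Fin n → Fin p → ℝ}
    (hz : ∀ i j, z i j = z j i) {β : Fin n → ℝ} {γ : Fin p → ℝ} {k : ℕ} {ε : ℝ} (hk : 0 < k)
    (hε : 0 < ε) (hZ : 0 < zMax z) {b : ℝ} (hb : 1 ≤ b) {w : Fin p → Fin n → ℝ}
    (hw : ∀ t i, rowSum (fun i j => edgeVar z β γ i j * (w t i + w t j)) i
      = rowSum (fun i j => edgeVar z β γ i j * z i j t) i)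
    (hwb : ∀ t i, |w t i| ≤ 8 * b * zMax z) {K : ℝ} (hK : 0 < K) :
    sampleLaw z β γ k ε {ω | ¬((∀ i, |degNoise z β γ ω i|
          ≤ √(n * Real.log n) + 16 * (k / ε) * Real.log n)
        ∧ ∑ i, degNoise z β γ ω i ^ 2 ≤ K * (n * (n + (k / ε) ^ 2))
        ∧ ∀ t, |covNoise z β γ ω t - ∑ i, w t i * degNoise z β γ ω i|
          ≤ K * (b ^ 2 * zMax z * (n + (k / ε) ^ 2)))}
      ≤ ENNReal.ofReal (4 / n + 512 / K + p * ((65538 + 256 * p ^ 2) / K ^ 2)) := by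
  have hn' : (2 : ℝ) ≤ n := by exact_mod_cast hn
  have hk' : (0 : ℝ) < k := by exact_mod_cast hk
  have hp' : (0 : ℝ) < p := by exact_mod_cast hp
  set κ : ℝ := k / ε with hκ
  have hκ0 : 0 < κ := by positivity
  set Z := zMax z with hZdef
  set a : ℝ := ε / (4 * k) with ha
  have ha0 : 0 < a := by positivity
  have hsq : 16 / a ^ 2 = 256 * κ ^ 2 := by rw [ha, hκ]; field_simp; norm_num
  set l : ℝ := 2 * p * k * Z / ε with hl
  have hl0 : 0 < l := by positivity
  have hl2 : 16 * l ^ 2 = 64 * p ^ 2 * κ ^ 2 * Z ^ 2 := by rw [hl, hκ]; field_simp; norm_num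
  have := isProbabilityMeasure_discreteLaplace_exp ha0
  have := isProbabilityMeasure_laplace hl0
  have hP : sampleLaw z β γ k ε
      = (graphLaw z β γ).prod ((degNoiseLaw n a).prod (covNoiseLaw p l)) := by
    rw [sampleLaw, neg_div]
  rw [hP]
  set P := (graphLaw z β γ).prod ((degNoiseLaw n a).prod (covNoiseLaw p l)) with hPdef
  -- the three components of a sample
  have hmX : ∀ c : Fin n → ℝ, Measurable fun x : Fin n → ℤ => ∑ i, c i * (x i : ℝ) :=
    fun c => measurable_of_countable _
  have hgraph : ∀ c : Pair n → ℝ, ∫⁻ ω, ENNReal.ofReal ((∑ e, c e *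
      edgeNoise (linPred z β γ e.1.1 e.1.2) (ω.1 e)) ^ 2) ∂P
      = ENNReal.ofReal (∑ e, c e ^ 2 * edgeVar z β γ e.1.1 e.1.2) := fun c => by
    rw [← graphLaw_sq, hPdef, lintegral_comp_fst (graphLaw z β γ) _ (f := fun g =>
      ENNReal.ofReal ((∑ e, c e * edgeNoise (linPred z β γ e.1.1 e.1.2) (g e)) ^ 2))
      (measurable_of_finite _)]
  have hdeg : ∀ c : Fin n → ℝ, ∫⁻ ω, ENNReal.ofReal ((∑ i, c i * (ω.2.1 i : ℝ)) ^ 2) ∂P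
      ≤ ENNReal.ofReal (256 * κ ^ 2 * ∑ i, c i ^ 2) := fun c => by
    rw [← hsq]
    refine le_trans (le_of_eq ?_) (degNoiseLaw_sq ha0 c)
    rw [hPdef, lintegral_comp_snd (graphLaw z β γ) _
      (f := fun y : (Fin n → ℤ) × (Fin p → ℝ) =>
        ENNReal.ofReal ((∑ i, c i * (y.1 i : ℝ)) ^ 2))
      (((hmX c).comp measurable_fst).pow_const 2).ennreal_ofReal,
      lintegral_comp_fst (degNoiseLaw n a) _
      (f := fun x => ENNReal.ofReal ((∑ i, c i * (x i : ℝ)) ^ 2)) (measurable_of_countable _)]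
  have hcov : ∀ t, ∫⁻ ω, ENNReal.ofReal (ω.2.2 t ^ 2) ∂P
      ≤ ENNReal.ofReal (64 * p ^ 2 * κ ^ 2 * Z ^ 2) := fun t => by
    rw [← hl2]
    refine le_trans (le_of_eq ?_) (covNoiseLaw_sq hl0 t)
    rw [hPdef, lintegral_comp_snd (graphLaw z β γ) _
      (f := fun y : (Fin n → ℤ) × (Fin p → ℝ) => ENNReal.ofReal (y.2 t ^ 2)) (by fun_prop),
      lintegral_comp_snd (degNoiseLaw n a) _
      (f := fun x : Fin p → ℝ => ENNReal.ofReal (x t ^ 2)) (by fun_prop)]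
  have hmG : ∀ c : Pair n → ℝ, Measurable fun ω : Sample n p => ∑ e, c e *
      edgeNoise (linPred z β γ e.1.1 e.1.2) (ω.1 e) := fun c =>
    (measurable_of_finite (fun g : Pair n → Bool => ∑ e, c e *
      edgeNoise (linPred z β γ e.1.1 e.1.2) (g e))).comp measurable_fst
  -- maximal degree noise
  have hB1 : P {ω | ∃ i, √(n * Real.log n) < |rowSum (adjNoise z β γ ω.1) i|}
      ≤ ENNReal.ofReal (2 / n) := by
    have h := (measurePreserving_fst (μ := graphLaw z β γ)
      (ν := (degNoiseLaw n a).prod (covNoiseLaw p l))).measure_preimage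
      (s := {g | ∃ i, √(n * Real.log n) < |rowSum (adjNoise z β γ g) i|})
      (Set.toFinite _).measurableSet.nullMeasurableSet
    exact h.le.trans (graphLaw_degree_tail hn hz β γ)
  have hB2 : P {ω | ∃ i, 16 * κ * Real.log n < |(ω.2.1 i : ℝ)|} ≤ ENNReal.ofReal (2 / n) := by
    have hs : MeasurableSet {x : Fin n → ℤ | ∃ i, 16 * κ * Real.log n < |(x i : ℝ)|} :=
      (Set.to_countable _).measurableSet
    have h1 := (measurePreserving_snd (μ := graphLaw z β γ)
      (ν := (degNoiseLaw n a).prod (covNoiseLaw p l))).measure_preimage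
      (s := Prod.fst ⁻¹' {x : Fin n → ℤ | ∃ i, 16 * κ * Real.log n < |(x i : ℝ)|})
      (measurable_fst hs).nullMeasurableSet
    have h2 := (measurePreserving_fst (μ := degNoiseLaw n a)
      (ν := covNoiseLaw p l)).measure_preimage hs.nullMeasurableSet
    refine (h1.le.trans h2.le).trans ((degNoiseLaw_tail ha0 _).trans
      (ENNReal.ofReal_le_ofReal (le_of_eq ?_)))
    -- The threshold is chosen so that each tail is 2/n², and the union over n nodes costs 2/n.
    have h3 : a * (16 * κ * Real.log n) / 2 = 2 * Real.log n := by
      rw [ha, hκ]; field_simp; ring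
    rw [h3, Real.exp_neg, two_mul (Real.log n), Real.exp_add, Real.exp_log (by linarith)]
    field_simp
  -- total degree noise
  have hB3 : P {ω | K * (n * (n + κ ^ 2)) < ∑ i, degNoise z β γ ω i ^ 2}
      ≤ ENNReal.ofReal (512 / K) := by
    have h1 : ∀ i ∈ Finset.univ, ∫⁻ ω, ENNReal.ofReal (degNoise z β γ ω i ^ 2) ∂P
        ≤ ENNReal.ofReal (512 * (n + κ ^ 2)) := fun i _ => by
      have hA : ∑ e, incidence i e ^ 2 * edgeVar z β γ e.1.1 e.1.2 ≤ n := by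
        refine le_trans (Finset.sum_le_sum fun e _ =>
          mul_le_of_le_one_right (sq_nonneg _) (muDeriv_le_one _)) ?_
        exact (sum_incidence_sq i).le.trans (by linarith)
      have h2 := lintegral_sq_add_le (hmG (incidence i)) n.cast_nonneg
        (B := 256 * κ ^ 2 * ∑ j, (if j = i then (1 : ℝ) else 0) ^ 2) (by positivity)
        ((hgraph (incidence i)).le.trans (ENNReal.ofReal_le_ofReal hA))
        (hdeg fun j => if j = i then 1 else 0)
      have h3 : ∀ ω : Sample n p, degNoise z β γ ω i
          = ∑ e : Pair n, incidence i e * edgeNoise (linPred z β γ e.1.1 e.1.2) (ω.1 e)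
            + ∑ j, (if j = i then (1 : ℝ) else 0) * (ω.2.1 j : ℝ) := fun ω => by
        rw [degNoise_eq, rowSum_adjNoise hz]; simp
      simp only [h3]
      refine h2.trans (ENNReal.ofReal_le_ofReal ?_)
      simp only [ite_pow, one_pow, ne_eq, OfNat.ofNat_ne_zero, not_false_eq_true, zero_pow,
        Finset.sum_ite_eq', Finset.mem_univ, if_true, mul_one]
      linarith
    have h4 : ∫⁻ ω, ENNReal.ofReal (∑ i, degNoise z β γ ω i ^ 2) ∂P
        ≤ ENNReal.ofReal (n * (512 * (n + κ ^ 2))) := by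
      simp only [ENNReal.ofReal_sum_of_nonneg fun i (_ : i ∈ Finset.univ) =>
        sq_nonneg (degNoise z β γ _ i)]
      rw [lintegral_finsetSum _ fun i _ =>
        ((measurable_degNoise z β γ i).pow_const 2).ennreal_ofReal]
      refine (Finset.sum_le_sum h1).trans (le_of_eq ?_)
      rw [Finset.sum_const, Finset.card_univ, Fintype.card_fin, nsmul_eq_mul,
        ENNReal.ofReal_mul n.cast_nonneg, ENNReal.ofReal_natCast]
    refine (measure_lt_le_of_lintegral_le (Finset.measurable_sum _ fun i _ =>
      (measurable_degNoise z β γ i).pow_const 2) (by positivity) h4).trans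
      (ENNReal.ofReal_le_ofReal (le_of_eq ?_))
    field_simp
  -- projected covariate noise
  have hB4 : ∀ t ∈ Finset.univ, P {ω | K * (b ^ 2 * Z * (n + κ ^ 2))
      < |covNoise z β γ ω t - ∑ i, w t i * degNoise z β γ ω i|}
      ≤ ENNReal.ofReal ((65538 + 256 * p ^ 2) / K ^ 2) := fun t _ => by
    set U := b ^ 2 * Z * (n + κ ^ 2) with hU
    have hU0 : 0 < U := by positivity
    -- Projection only lowers the variance, so no factor b enters here.
    have hA : ∑ e : Pair n, (z e.1.1 e.1.2 t - w t e.1.1 - w t e.1.2) ^ 2 *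
        edgeVar z β γ e.1.1 e.1.2 ≤ (n : ℝ) ^ 2 * Z ^ 2 := by
      rw [← pairSum_eq_sum_pair (f := fun i j => (z i j t - w t i - w t j) ^ 2 *
        edgeVar z β γ i j) fun i j => by rw [hz, edgeVar_symm hz]; ring]
      exact pairSum_residual_sq_le hz hw t
    have hWs : ∑ i, (-w t i) ^ 2 ≤ n * (8 * b * Z) ^ 2 := by
      have : ∀ i ∈ Finset.univ, (-w t i) ^ 2 ≤ (8 * b * Z) ^ 2 := fun i _ => by
        rw [neg_sq, ← sq_abs]
        exact pow_le_pow_left₀ (abs_nonneg _) (hwb t i) 2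
      simpa using Finset.sum_le_sum this
    have h2 := lintegral_sq_add_le (ν := P) (X := fun ω : Sample n p =>
      ∑ i, -w t i * (ω.2.1 i : ℝ)) (Y := fun ω => ω.2.2 t)
      ((hmX fun i => -w t i).comp (measurable_fst.comp measurable_snd))
      (A := 256 * κ ^ 2 * (n * (8 * b * Z) ^ 2)) (by positivity) (by positivity)
      ((hdeg fun i => -w t i).trans (ENNReal.ofReal_le_ofReal
        (mul_le_mul_of_nonneg_left hWs (by positivity)))) (hcov t)
    have h3 := lintegral_sq_add_le (hmG fun e => z e.1.1 e.1.2 t - w t e.1.1 - w t e.1.2)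
      (by positivity) (by positivity)
      ((hgraph _).le.trans (ENNReal.ofReal_le_ofReal hA)) h2
    simp only [← profileNoise_eq hz β γ w] at h3
    have hbound : 2 * ((n : ℝ) ^ 2 * Z ^ 2) + 2 * (2 * (256 * κ ^ 2 * (n * (8 * b * Z) ^ 2))
        + 2 * (64 * p ^ 2 * κ ^ 2 * Z ^ 2)) ≤ (65538 + 256 * p ^ 2) * U ^ 2 := by
      exact noise_second_moment_le (by linarith) hb
    have h5 := measure_lt_le_of_lintegral_le (c := (K * U) ^ 2)
      (((measurable_covNoise z β γ t).sub (Finset.measurable_sum _ fun i _ =>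
        (measurable_degNoise z β γ i).const_mul (w t i))).pow_const 2) (by positivity)
      (h3.trans (ENNReal.ofReal_le_ofReal hbound))
    have h6 : {ω | K * U < |covNoise z β γ ω t - ∑ i, w t i * degNoise z β γ ω i|}
        ⊆ {ω | (K * U) ^ 2 < (covNoise z β γ ω t - ∑ i, w t i * degNoise z β γ ω i) ^ 2} :=
      fun ω hω => by
        rw [Set.mem_ofPred_eq, ← sq_abs (covNoise z β γ ω t - _)]
        exact pow_lt_pow_left₀ hω (by positivity) two_ne_zero
    refine (measure_mono h6).trans (h5.trans (ENNReal.ofReal_le_ofReal (le_of_eq ?_)))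
    field_simp
  have hsub : {ω | ¬((∀ i, |degNoise z β γ ω i| ≤ √(n * Real.log n) + 16 * κ * Real.log n)
        ∧ ∑ i, degNoise z β γ ω i ^ 2 ≤ K * (n * (n + κ ^ 2))
        ∧ ∀ t, |covNoise z β γ ω t - ∑ i, w t i * degNoise z β γ ω i|
          ≤ K * (b ^ 2 * Z * (n + κ ^ 2)))}
      ⊆ (({ω | ∃ i, √(n * Real.log n) < |rowSum (adjNoise z β γ ω.1) i|}
        ∪ {ω | ∃ i, 16 * κ * Real.log n < |(ω.2.1 i : ℝ)|})
        ∪ {ω | K * (n * (n + κ ^ 2)) < ∑ i, degNoise z β γ ω i ^ 2})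
        ∪ ⋃ t, {ω | K * (b ^ 2 * Z * (n + κ ^ 2))
          < |covNoise z β γ ω t - ∑ i, w t i * degNoise z β γ ω i|} := by
    intro ω hω
    by_contra hcon
    simp only [Set.mem_union, Set.mem_iUnion, Set.mem_ofPred_eq, not_or, not_exists,
      not_lt] at hcon
    obtain ⟨⟨⟨h1, h2⟩, h3⟩, h4⟩ := hcon
    refine hω ⟨fun i => ?_, h3, h4⟩
    rw [degNoise_eq]
    exact (abs_add_le _ _).trans (add_le_add (h1 i) (h2 i))
  refine (measure_mono hsub).trans ((measure_union_le _ _).trans ?_)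
  have hB5 := (measure_iUnion_fintype_le P fun t => {ω | K * (b ^ 2 * Z * (n + κ ^ 2))
      < |covNoise z β γ ω t - ∑ i, w t i * degNoise z β γ ω i|}).trans (Finset.sum_le_sum hB4)
  rw [Finset.sum_const, Finset.card_univ, Fintype.card_fin, nsmul_eq_mul,
    ← ENNReal.ofReal_natCast, ← ENNReal.ofReal_mul p.cast_nonneg] at hB5
  have hB6 := (measure_union_le _ _).trans (add_le_add ((measure_union_le _ _).trans
    (add_le_add hB1 hB2)) hB3)
  refine (add_le_add hB6 hB5).trans (le_of_eq ?_)
  rw [← ENNReal.ofReal_add (by positivity) (by positivity),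
    ← ENNReal.ofReal_add (by positivity) (by positivity),
    ← ENNReal.ofReal_add (by positivity) (by positivity)]
  congr 1
  ring


/-! ### The constants in the conditions -/

/-- The real `sSup` of an unbounded set is 0, so boundedness must be shown before `bSup` bounds
anything. It follows from compactness of the two balls and continuity of the predictor. -/
theorem bddAbove_bSup_set {n p : ℕ} (z : Fin n → Fin n → Fin p → ℝ) (β : Fin n → ℝ)
    (γ : Fin p → ℝ) (r₁ r₂ : ℝ) :
    BddAbove {x | ∃ β' ∈ Metric.closedBall β r₁, ∃ γ' ∈ Metric.closedBall γ r₂,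
      ∃ i j : Fin n, i ≠ j ∧
        x = (1 + Real.exp (linPred z β' γ' i j)) ^ 2 / Real.exp (linPred z β' γ' i j)} := by
  have hK : IsCompact (Metric.closedBall β r₁ ×ˢ Metric.closedBall γ r₂) :=
    (isCompact_closedBall β r₁).prod (isCompact_closedBall γ r₂)
  have h : ∀ i j : Fin n, ∃ c : ℝ, ∀ θ ∈ Metric.closedBall β r₁ ×ˢ Metric.closedBall γ r₂,
      (1 + Real.exp (linPred z θ.1 θ.2 i j)) ^ 2 / Real.exp (linPred z θ.1 θ.2 i j) ≤ c := by
    intro i j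
    have hc : Continuous fun θ : (Fin n → ℝ) × (Fin p → ℝ) =>
        (1 + Real.exp (linPred z θ.1 θ.2 i j)) ^ 2 / Real.exp (linPred z θ.1 θ.2 i j) := by
      have : Continuous fun θ : (Fin n → ℝ) × (Fin p → ℝ) => linPred z θ.1 θ.2 i j := by
        unfold linPred; fun_prop
      exact Continuous.div (by fun_prop) (by fun_prop) fun θ => (Real.exp_pos _).ne'
    obtain ⟨c, hc'⟩ := hK.bddAbove_image hc.continuousOn
    exact ⟨c, fun θ hθ => hc' ⟨θ, hθ, rfl⟩⟩
  choose c hc using h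
  refine ⟨∑ i, ∑ j, |c i j|, ?_⟩
  rintro x ⟨β', hβ', γ', hγ', i, j, -, rfl⟩
  refine (hc i j (β', γ') ⟨hβ', hγ'⟩).trans ((le_abs_self _).trans ?_)
  refine (Finset.single_le_sum (f := fun j => |c i j|) (fun _ _ => abs_nonneg _)
    (Finset.mem_univ j)).trans ?_
  exact Finset.single_le_sum (f := fun i => ∑ j, |c i j|)
    (fun _ _ => Finset.sum_nonneg fun _ _ => abs_nonneg _) (Finset.mem_univ i)

theorem inv_edgeVar_le_bSup {n p : ℕ} (z : Fin n → Fin n → Fin p → ℝ) (β : Fin n → ℝ)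
    (γ : Fin p → ℝ) {r₁ r₂ : ℝ} (h₁ : 0 < r₁) (h₂ : 0 < r₂) (i j : Fin n) (hij : i ≠ j) :
    (edgeVar z β γ i j)⁻¹ ≤ bSup z β γ r₁ r₂ := by
  refine le_csSup (bddAbove_bSup_set z β γ r₁ r₂) ⟨β, Metric.mem_closedBall_self h₁.le, γ,
    Metric.mem_closedBall_self h₂.le, i, j, hij, ?_⟩
  rw [edgeVar, muDeriv, inv_div]

theorem one_le_bSup {n p : ℕ} (hn : 2 ≤ n) (z : Fin n → Fin n → Fin p → ℝ) (β : Fin n → ℝ)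
    (γ : Fin p → ℝ) {r₁ r₂ : ℝ} (h₁ : 0 < r₁) (h₂ : 0 < r₂) : 1 ≤ bSup z β γ r₁ r₂ := by
  have h := inv_edgeVar_le_bSup z β γ h₁ h₂ ⟨0, by omega⟩ ⟨1, by omega⟩ (by simp)
  exact ((one_le_inv₀ (edgeVar_pos z β γ _ _)).2 (muDeriv_le_one _)).trans h

theorem one_div_bSup_le {n p : ℕ} (hn : 2 ≤ n) (z : Fin n → Fin n → Fin p → ℝ) (β : Fin n → ℝ)
    (γ : Fin p → ℝ) {r₁ r₂ : ℝ} (h₁ : 0 < r₁) (h₂ : 0 < r₂) (i j : Fin n) (hij : i ≠ j) :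
    1 / bSup z β γ r₁ r₂ ≤ edgeVar z β γ i j := by
  have h := inv_edgeVar_le_bSup z β γ h₁ h₂ i j hij
  have h1 := one_le_bSup hn z β γ h₁ h₂
  rw [one_div]
  exact inv_le_of_inv_le₀ (edgeVar_pos z β γ i j) h

theorem zMax_nonneg {n p : ℕ} (z : Fin n → Fin n → Fin p → ℝ) : 0 ≤ zMax z :=
  Real.iSup_nonneg fun _ => norm_nonneg _

/-- The inverse of `H` cannot be smaller than the size of the covariates allows. -/
theorem one_le_rho_mul_zMax_sq {n p : ℕ} (hn : 0 < n) (hp : 0 < p)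
    {z : Fin n → Fin n → Fin p → ℝ} (hz : ∀ i j, z i j = z j i) {β : Fin n → ℝ} {γ : Fin p → ℝ}
    {ρ : ℝ} {w : Fin p → Fin n → ℝ}
    (hw : ∀ t i, rowSum (fun i j => edgeVar z β γ i j * (w t i + w t j)) i
      = rowSum (fun i j => edgeVar z β γ i j * z i j t) i)
    (hHw : ∀ s t, fisherH z β γ s t
        = pairSum fun i j => z i j s * (edgeVar z β γ i j * (z i j t - w t i - w t j)))
    (hH : IsUnit (fisherH z β γ).det) (hHinv : rowSumNorm (fisherH z β γ)⁻¹ ≤ ρ / n ^ 2) :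
    1 ≤ ρ * zMax z ^ 2 := by
  have hn' : (0 : ℝ) < n := by exact_mod_cast hn
  set H := fisherH z β γ
  -- Arithmetic-geometric mean splits each term into a covariate square and a weighted residual
  -- square; each contributes at most n²Z²/2 in total.
  have hentry : ∀ s t, |H s t| ≤ (n : ℝ) ^ 2 * zMax z ^ 2 := fun s t => by
    rw [hHw]
    have h1 := abs_pairSum_le (f := fun i j =>
      z i j s * (edgeVar z β γ i j * (z i j t - w t i - w t j)))
      (g := fun i j => (1 / 2) * zMax z ^ 2
        + (1 / 2) * ((z i j t - w t i - w t j) ^ 2 * edgeVar z β γ i j)) fun i j hij => by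
        set v := edgeVar z β γ i j
        set y := z i j t - w t i - w t j
        have hv0 : 0 < v := edgeVar_pos z β γ i j
        have hv1 : v ≤ 1 := muDeriv_le_one _
        have h2 : z i j s ^ 2 ≤ zMax z ^ 2 := by
          rw [← sq_abs]; exact pow_le_pow_left₀ (abs_nonneg _) (abs_le_zMax hz i j s hij) 2
        have h3 : v * z i j s ^ 2 ≤ zMax z ^ 2 :=
          (mul_le_of_le_one_left (sq_nonneg _) hv1).trans h2
        rw [abs_le]
        constructor
        · nlinarith [mul_nonneg hv0.le (sq_nonneg (z i j s + y))]
        · nlinarith [mul_nonneg hv0.le (sq_nonneg (z i j s - y))]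
    rw [pairSum_add, pairSum_const_mul (1 / 2)
      (fun i j => (z i j t - w t i - w t j) ^ 2 * edgeVar z β γ i j)] at h1
    have h2 := pairSum_residual_sq_le hz hw t
    have h3 := pairSum_const_le (n := n) (c := 1 / 2 * zMax z ^ 2) (by positivity)
    linarith
  -- One diagonal entry of H⁻¹H = 1 is enough: entries of H of size at most n²Z² force the first row
  -- of H⁻¹ to have absolute sum at least 1/(n²Z²).
  have h1 : ∑ t, H⁻¹ ⟨0, hp⟩ t * H t ⟨0, hp⟩ = 1 := by
    rw [← Matrix.mul_apply, Matrix.nonsing_inv_mul _ hH, Matrix.one_apply_eq]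
  have h2 : (1 : ℝ) ≤ ∑ t, |H⁻¹ ⟨0, hp⟩ t| * ((n : ℝ) ^ 2 * zMax z ^ 2) := by
    rw [← h1]
    refine Finset.sum_le_sum fun t _ => (le_abs_self _).trans ?_
    rw [abs_mul]
    exact mul_le_mul_of_nonneg_left (hentry t _) (abs_nonneg _)
  rw [← Finset.sum_mul] at h2
  have h3 := mul_le_mul_of_nonneg_right ((row_le_rowSumNorm H⁻¹ ⟨0, hp⟩).trans hHinv)
    (by positivity : 0 ≤ (n : ℝ) ^ 2 * zMax z ^ 2)
  refine (h2.trans h3).trans (le_of_eq ?_)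
  field_simp

/-! ### Rates -/

/-- The second-order term is negligible, and the induced error of the covariate effects is
negligible against the rate of the node effects. -/
theorem remainder_rates {m s b κ Z ρ C : ℝ} (hm : 0 < m) (hs : 0 < s) (hs1 : s ≤ 1)
    (hms : 1 ≤ m * s ^ 2) (hb : 1 ≤ b) (hκ : 0 ≤ κ) (hZ : 0 ≤ Z) (hρ : 0 ≤ ρ) (hC : 0 ≤ C)
    (hZC : Z ≤ C * (m * s ^ 2)) (hX : b ^ 2 * (κ * s ^ 2) ≤ 1) :
    ρ * b * Z * (b ^ 2 * Z * (m + κ ^ 2)) / m ^ 2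
        ≤ C * (b ^ 3 * ρ * Z * s + b ^ 4 * ρ * Z * (κ * s ^ 2)) ∧
      Z * (ρ * (b ^ 2 * Z * (m + κ ^ 2)) / m ^ 2)
        ≤ C * (b ^ 3 * ρ * Z * s + b ^ 4 * ρ * Z * (κ * s ^ 2)) * ((1 + 4 * κ * s) * s) := by
  -- In the application m = n and s = √(log n / n), so m s² is log n.
  have hZm : Z / m ≤ C * s ^ 2 := by rw [div_le_iff₀ hm]; linarith
  have hm1 : 1 / m ≤ s ^ 2 := by rw [div_le_iff₀ hm]; linarith
  have hκm : κ / m ≤ κ * s ^ 2 := by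
    rw [div_eq_mul_one_div]; exact mul_le_mul_of_nonneg_left hm1 hκ
  have hκs : κ * s ^ 2 ≤ 1 :=
    (le_mul_of_one_le_left (by positivity) (one_le_pow₀ hb)).trans hX
  have hb23 : b ^ 2 ≤ b ^ 3 := pow_le_pow_right₀ hb (by norm_num)
  have hb34 : b ^ 3 ≤ b ^ 4 := pow_le_pow_right₀ hb (by norm_num)
  have hb24 : b ^ 2 ≤ b ^ 4 := hb23.trans hb34
  set Y1 := b ^ 3 * ρ * Z * s with hY1
  set Y2 := b ^ 4 * ρ * Z * (κ * s ^ 2) with hY2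
  have hY10 : 0 ≤ Y1 := by positivity
  have hY20 : 0 ≤ Y2 := by positivity
  have hss : s ^ 2 ≤ s := by nlinarith
  have hratio : Z / m * (κ / m) ≤ C * s ^ 2 * (κ * s ^ 2) :=
    mul_le_mul hZm hκm (by positivity) (by positivity)
  constructor
  · have h1 : ρ * b * Z * (b ^ 2 * Z * (m + κ ^ 2)) / m ^ 2
        = b ^ 3 * ρ * Z * (Z / m) + b ^ 3 * ρ * Z * κ * (Z / m * (κ / m)) := by
      field_simp
    have h2 : b ^ 3 * ρ * Z * (Z / m) ≤ C * Y1 := by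
      have := mul_le_mul_of_nonneg_left (hZm.trans (mul_le_mul_of_nonneg_left hss hC))
        (by positivity : 0 ≤ b ^ 3 * ρ * Z)
      refine this.trans (le_of_eq (by rw [hY1]; ring))
    have h3 : b ^ 3 * ρ * Z * κ * (Z / m * (κ / m)) ≤ C * Y2 := by
      have e1 : Z / m * (κ / m) ≤ C * s ^ 2 :=
        hratio.trans (mul_le_of_le_one_right (by positivity) hκs)
      have e2 : b ^ 3 * ρ * Z * κ ≤ b ^ 4 * ρ * Z * κ := by gcongr
      refine (mul_le_mul e2 e1 (by positivity) (by positivity)).trans (le_of_eq ?_)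
      rw [hY2]; ring
    rw [h1]; linarith
  · have h1 : Z * (ρ * (b ^ 2 * Z * (m + κ ^ 2)) / m ^ 2)
        = b ^ 2 * ρ * Z * (Z / m) + b ^ 2 * ρ * Z * κ * (Z / m * (κ / m)) := by
      field_simp
    have h2 : b ^ 2 * ρ * Z * (Z / m) ≤ C * Y1 * s := by
      have e2 : b ^ 2 * ρ * Z ≤ b ^ 3 * ρ * Z := by gcongr
      refine (mul_le_mul e2 hZm (by positivity) (by positivity)).trans (le_of_eq ?_)
      rw [hY1]; ring
    have h3 : b ^ 2 * ρ * Z * κ * (Z / m * (κ / m)) ≤ C * Y2 * (κ * s ^ 2) := by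
      have e2 : b ^ 2 * ρ * Z * κ ≤ b ^ 4 * ρ * Z * κ := by gcongr
      refine (mul_le_mul e2 hratio (by positivity) (by positivity)).trans (le_of_eq ?_)
      rw [hY2]; ring
    rw [h1]
    have h4 : C * Y1 * s ≤ C * Y1 * ((1 + 4 * κ * s) * s) :=
      mul_le_mul_of_nonneg_left (by nlinarith [mul_nonneg hκ hs.le]) (by positivity)
    have h5 : C * Y2 * (κ * s ^ 2) ≤ C * Y2 * ((1 + 4 * κ * s) * s) :=
      mul_le_mul_of_nonneg_left (by nlinarith [mul_nonneg hκ (sq_nonneg s)]) (by positivity)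
    nlinarith

/-- In the application m = n and l = log n. The hypothesis `hX` forces κ ≤ n, hence n + κ² ≤ n(1 +
κ), and Z ≤ C log n supplies the logarithm; the remaining summand of `tau` is nonnegative. -/
theorem second_order_le_tau {m l b κ Z C : ℝ} (hm : 0 < m) (hl : 1 ≤ l) (hb : 1 ≤ b)
    (hκ : 0 ≤ κ) (hZ : 0 ≤ Z) (hC : 0 ≤ C) (hZC : Z ≤ C * l) (hX : b ^ 2 * (κ * (l / m)) ≤ 1) :
    b ^ 2 * Z * (m + κ ^ 2) ≤ C * (m * l * (b ^ 3 + κ * b ^ 3 + Z / √l)) := by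
  have hb23 : b ^ 2 ≤ b ^ 3 := pow_le_pow_right₀ hb (by norm_num)
  have hκm : κ ≤ m := by
    have h1 : κ * (l / m) ≤ 1 :=
      (le_mul_of_one_le_left (by positivity) (one_le_pow₀ hb)).trans hX
    rw [← mul_div_assoc, div_le_one hm] at h1
    exact (le_mul_of_one_le_right hκ hl).trans h1
  have h1 : b ^ 2 * Z ≤ b ^ 3 * (C * l) := mul_le_mul hb23 hZC hZ (by positivity)
  have h2 : m + κ ^ 2 ≤ m * (1 + κ) := by nlinarith
  have h3 : b ^ 2 * Z * (m + κ ^ 2) ≤ b ^ 3 * (C * l) * (m * (1 + κ)) :=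
    mul_le_mul h1 h2 (by positivity) (by positivity)
  have h4 : 0 ≤ C * (m * l * (Z / √l)) := by positivity
  nlinarith

/-- This is the condition `hd2` of the box argument. Projected noise and degree-noise energy
contribute 1 + 136 multiples of KρU/n² with U = b²Z(m + κ²), less than half of `rg`. The feedback of
the covariate error through the energy is linear in `rg` with coefficient at most 68/272 = 1/4. -/
theorem covariate_box_lt {m q b Z κ K ρ rg : ℝ} (hm : 0 < m) (hq : 0 < q) (hK : 0 < K)
    (hrg0 : 0 < rg) (hrg : rg = 300 * K * (ρ * (b ^ 2 * Z * (m + κ ^ 2)) / m ^ 2))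
    (hS : ρ * b * Z * (b ^ 2 * Z * (m + κ ^ 2)) / m ^ 2 ≤ 1 / (272 * q * K)) :
    ρ / m ^ 2 * (K * (b ^ 2 * Z * (m + κ ^ 2)) + 17 * b * Z *
        (8 * b / m * (K * (m * (m + κ ^ 2)))
          + 4 * (q * (K * (b ^ 2 * Z * (m + κ ^ 2)) * rg)))) < rg := by
  set U := b ^ 2 * Z * (m + κ ^ 2) with hU
  have h0 : 17 * b * Z * (8 * b / m * (K * (m * (m + κ ^ 2)))) = 136 * (K * U) := by
    have : 8 * b / m * (K * (m * (m + κ ^ 2))) = 8 * b * (K * (m + κ ^ 2)) := by field_simp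
    rw [this, hU]; ring
  have h1 : ρ / m ^ 2 * (K * U + 17 * b * Z *
        (8 * b / m * (K * (m * (m + κ ^ 2))) + 4 * (q * (K * U * rg))))
        = 137 * K * (ρ * U / m ^ 2) + 68 * q * K * (ρ * b * Z * U / m ^ 2) * rg := by
    rw [mul_add (17 * b * Z), h0]; ring
  have h2 : 68 * q * K * (ρ * b * Z * U / m ^ 2) ≤ 1 / 4 := by
    rw [le_div_iff₀ (by positivity)] at hS
    linarith
  have h3 := mul_le_mul_of_nonneg_right h2 hrg0.le
  rw [h1]
  linarith

/-- This is the condition `hd3`. Noise and covariate error contribute 8b · 5u = 40bu, that is 5/8 of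
`rb`; the quadratic term is at most 72(b rb)rb, less than a quarter of `rb`. -/
theorem node_box_lt {m b u c d rb : ℝ} (hm : 0 < m) (hb : 1 ≤ b) (hu : 0 < u)
    (hrb : rb = 64 * (b * u)) (hc : c ≤ m * (4 * u)) (hd0 : 0 ≤ d) (hd : d ≤ u)
    (hbrb : b * rb ≤ 64 / 100000) :
    8 * b / m * (c + m * d + m * (2 * rb + d) ^ 2) < rb := by
  have hub : u ≤ rb := by rw [hrb]; nlinarith [mul_nonneg (sub_nonneg.2 hb) hu.le]
  have hrb0 : 0 < rb := hu.trans_le hub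
  have h2 : (2 * rb + d) ^ 2 ≤ (3 * rb) ^ 2 :=
    pow_le_pow_left₀ (by positivity) (by linarith) 2
  have h3 : c + m * d + m * (2 * rb + d) ^ 2 ≤ m * (5 * u + (3 * rb) ^ 2) := by
    have := mul_le_mul_of_nonneg_left hd hm.le
    have := mul_le_mul_of_nonneg_left h2 hm.le
    linarith
  refine (mul_le_mul_of_nonneg_left h3 (by positivity)).trans_lt ?_
  have h4 : 8 * b / m * (m * (5 * u + (3 * rb) ^ 2)) = 40 * (b * u) + 72 * (b * rb) * rb := by
    field_simp; ring
  rw [h4]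
  have h5 : 72 * (b * rb) * rb ≤ 1 / 4 * rb :=
    mul_le_mul_of_nonneg_right (by linarith) hrb0.le
  linarith

/-- Small deviations of the node and covariate effects, for noise that is small in the sense
of `noise_tail`. -/
theorem solution_of_small_noise {n p : ℕ} (hn : 8 ≤ n) (hp : 0 < p)
    {z : Fin n → Fin n → Fin p → ℝ}
    (hz : ∀ i j, z i j = z j i) {β : Fin n → ℝ} {γ : Fin p → ℝ} {b ρ κ K : ℝ} (hb : 1 ≤ b)
    (hvl : ∀ i j, i ≠ j → 1 / b ≤ edgeVar z β γ i j) (hZ0 : 0 < zMax z) (hρ : 0 < ρ)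
    (hκ : 0 < κ) (hK : 0 < K) {w : Fin p → Fin n → ℝ}
    (hw : ∀ t i, rowSum (fun i j => edgeVar z β γ i j * (w t i + w t j)) i
      = rowSum (fun i j => edgeVar z β γ i j * z i j t) i)
    (hHw : ∀ s t, fisherH z β γ s t
        = pairSum fun i j => z i j s * (edgeVar z β γ i j * (z i j t - w t i - w t j)))
    (hH : IsUnit (fisherH z β γ).det) (hHinv : rowSumNorm (fisherH z β γ)⁻¹ ≤ ρ / n ^ 2)
    (hS1 : ρ * b * zMax z * (b ^ 2 * zMax z * (n + κ ^ 2)) / n ^ 2 ≤ 1 / (272 * p * K))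
    (hS2 : p * (300 * K) * (zMax z * (ρ * (b ^ 2 * zMax z * (n + κ ^ 2)) / n ^ 2))
      ≤ (1 + 4 * κ * √(Real.log n / n)) * √(Real.log n / n))
    (hS3 : b ^ 2 * ((1 + 4 * κ * √(Real.log n / n)) * √(Real.log n / n)) ≤ 1 / 100000)
    {f : Fin n → ℝ} {q : Fin p → ℝ}
    (hfa : ∀ i, |f i| ≤ √(n * Real.log n) + 16 * κ * Real.log n)
    (hfN : ∑ i, f i ^ 2 ≤ K * (n * (n + κ ^ 2)))
    (hqs : ∀ t, |q t - ∑ i, w t i * f i| ≤ K * (b ^ 2 * zMax z * (n + κ ^ 2))) :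
    ∃ β' γ', ‖β' - β‖ ≤ 64 * (b * ((1 + 4 * κ * √(Real.log n / n)) * √(Real.log n / n))) ∧
      ‖γ' - γ‖ ≤ 300 * K * (ρ * (b ^ 2 * zMax z * (n + κ ^ 2)) / n ^ 2) ∧
      (∀ i, meanDeg z β' γ' i - meanDeg z β γ i = f i) ∧
      (∀ t, meanCov z β' γ' t - meanCov z β γ t = q t) := by
  have hn' : (8 : ℝ) ≤ n := by exact_mod_cast hn
  have hn0 : (0 : ℝ) < n := by linarith
  have hp' : (0 : ℝ) < p := by exact_mod_cast hp
  have hlog : 0 < Real.log n := Real.log_pos (by linarith)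
  set s := √(Real.log n / n) with hs
  have hs0 : 0 < s := Real.sqrt_pos.2 (by positivity)
  have hs2 : s ^ 2 = Real.log n / n := Real.sq_sqrt (by positivity)
  have hlogs : Real.log n = n * s ^ 2 := by rw [hs2]; field_simp
  have hroot : √(n * Real.log n) = n * s := by
    rw [hlogs, show (n : ℝ) * (n * s ^ 2) = (n * s) ^ 2 by ring, Real.sqrt_sq (by positivity)]
  set Z := zMax z with hZ
  set U := b ^ 2 * Z * (n + κ ^ 2) with hU
  have hU0 : 0 < U := by positivity
  set u := (1 + 4 * κ * s) * s with hu
  have hu0 : 0 < u := by positivity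
  set rb := 64 * (b * u) with hrb
  set rg := 300 * K * (ρ * U / n ^ 2) with hrg
  have hrb0 : 0 < rb := by positivity
  have hrg0 : 0 < rg := by positivity
  have hpZ : p * Z * rg ≤ u := by
    refine le_trans (le_of_eq ?_) hS2
    rw [hrg]; ring
  have hub : u ≤ rb := by rw [hrb]; nlinarith [mul_nonneg (sub_nonneg.2 hb) hu0.le]
  have hbrb : b * rb ≤ 64 / 100000 := by rw [hrb]; nlinarith
  have hrb1 : rb ≤ 64 / 100000 := by nlinarith [mul_nonneg (sub_nonneg.2 hb) hrb0.le]
  -- The noise bound equals n(s + 16κs²), while 4u = 4s + 16κs².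
  have ha : (√(n * Real.log n) + 16 * κ * Real.log n) ≤ n * (4 * u) := by
    rw [hroot, hlogs, hu]
    nlinarith [mul_pos hn0 hs0]
  have hpZ0 : 0 ≤ p * Z * rg := by positivity
  refine exists_solution hn hz hb hvl hZ0.le (fun i j t hij => abs_le_zMax hz i j t hij) hw hHw hH
    hHinv hrb0 hrg0 (by linarith) ?_ ?_ hfa hfN hqs
  · exact covariate_box_lt hn0 hp' hK hrg0 hrg hS1
  · exact node_box_lt hn0 hb hu0 hrb ha hpZ0 hpZ hbrb

/-! ### Stochastic orders -/

theorem isLittleOPOne_of_isBigOP {Ω : ℕ → Type*} [∀ n, MeasurableSpace (Ω n)]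
    {P : ∀ n, Measure (Ω n)} {X : ∀ n, Ω n → ℝ} {r : ℕ → ℝ} (h : IsBigOP P X r)
    (hr : Tendsto r atTop (𝓝 0)) : IsLittleOPOne P X := by
  intro δ hδ
  rw [ENNReal.tendsto_nhds_zero]
  intro η hη
  obtain ⟨η', hη', hle⟩ : ∃ η' : ℝ, 0 < η' ∧ ENNReal.ofReal η' ≤ η := by
    rcases eq_or_ne η ⊤ with rfl | hη2
    · exact ⟨1, one_pos, le_top⟩
    · exact ⟨η.toReal, ENNReal.toReal_pos hη.ne' hη2, (ENNReal.ofReal_toReal hη2).le⟩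
  obtain ⟨M, hM, hev⟩ := h η' hη'
  have hMr : Tendsto (fun n => M * r n) atTop (𝓝 0) := by simpa using hr.const_mul M
  filter_upwards [hev, hMr.eventually_lt_const hδ] with n h1 h2
  refine (measure_mono fun ω hω => ?_).trans (h1.trans hle)
  exact h2.trans hω


/-! ### From noise bounds to all moment solutions. -/

/-- The moment equations have a solution, and every solution is close to the true parameter. -/
def GoodSample {n p : ℕ} (z : Fin n → Fin n → Fin p → ℝ) (β : Fin n → ℝ) (γ : Fin p → ℝ)
    (rb rg : ℝ) (ω : Sample n p) : Prop :=
  (∃ β' γ', SolvesMoment z ω β' γ') ∧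
    ∀ β' γ', SolvesMoment z ω β' γ' → ‖β' - β‖ ≤ rb ∧ ‖γ' - γ‖ ≤ rg

/-- Non-asymptotic bound on the probability that the moment equations have no solution close to
the true parameter. -/
theorem measure_not_goodSample_le {n p : ℕ} (hn : 8 ≤ n) (hp : 0 < p)
    {z : Fin n → Fin n → Fin p → ℝ} (hz : ∀ i j, z i j = z j i) {β : Fin n → ℝ} {γ : Fin p → ℝ}
    {k : ℕ} {ε : ℝ} (hk : 0 < k) (hε : 0 < ε) {b ρ : ℝ} (hb : 1 ≤ b)
    (hvl : ∀ i j, i ≠ j → 1 / b ≤ edgeVar z β γ i j)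
    (hH : IsUnit (fisherH z β γ).det) (hHinv : rowSumNorm (fisherH z β γ)⁻¹ ≤ ρ / n ^ 2)
    {K C η : ℝ} (hK : 0 < K) (hC : 0 < C) (hZC : zMax z ≤ C * Real.log n)
    (hT1 : b ^ 2 * epsTilde n k ε * √(Real.log n / n) ≤ 1 / 100000)
    (hη : b ^ 3 * ρ * zMax z * √(Real.log n / n)
      + b ^ 4 * ρ * zMax z * (k / ε * (√(Real.log n / n)) ^ 2) ≤ η)
    (hη1 : C * η ≤ 1 / (272 * p * K)) (hη2 : p * (300 * K) * (C * η) ≤ 1) :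
    sampleLaw z β γ k ε {ω | ¬GoodSample z β γ (64 * (b * epsTilde n k ε * √(Real.log n / n)))
        (300 * K * C * (ρ * tau n k ε b (zMax z) * Real.log n / n)) ω}
      ≤ ENNReal.ofReal (4 / n + 512 / K + p * ((65538 + 256 * p ^ 2) / K ^ 2)) := by
  have hn' : (8 : ℝ) ≤ n := by exact_mod_cast hn
  have hn0 : (0 : ℝ) < n := by linarith
  have hk' : (0 : ℝ) < k := by exact_mod_cast hk
  have hlog : 1 ≤ Real.log n := by
    rw [Real.le_log_iff_exp_le hn0]
    linarith [Real.exp_one_lt_d9]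
  obtain ⟨w, hw, hHw⟩ := exists_profile hn z β γ (by positivity) (edgeVar_symm hz β γ) hvl
  have hρZ := one_le_rho_mul_zMax_sq (by omega) hp hz hw hHw hH hHinv
  have hZ : 0 < zMax z := by
    refine (zMax_nonneg z).lt_of_ne fun h => ?_
    rw [← h] at hρZ
    norm_num at hρZ
  have hρ : 0 < ρ := by
    by_contra h
    have := mul_nonpos_of_nonpos_of_nonneg (not_lt.1 h) (sq_nonneg (zMax z))
    linarith
  set κ : ℝ := k / ε with hκ
  have hκ0 : 0 < κ := by positivity
  set s := √(Real.log n / n) with hs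
  have hs0 : 0 < s := Real.sqrt_pos.2 (by positivity)
  have hs2 : s ^ 2 = Real.log n / n := Real.sq_sqrt (by positivity)
  have hms : n * s ^ 2 = Real.log n := by rw [hs2]; field_simp
  have hs1 : s ≤ 1 := by
    refine Real.sqrt_le_one.2 ?_
    rw [div_le_one hn0]
    linarith [Real.log_le_sub_one_of_pos hn0]
  have he : epsTilde n k ε = 1 + 4 * κ * s := by rw [epsTilde, mul_div_assoc]
  rw [he] at hT1 ⊢
  have hb2 : 0 < b ^ 2 := by positivity
  have hS3 : b ^ 2 * ((1 + 4 * κ * s) * s) ≤ 1 / 100000 := by rwa [← mul_assoc]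
  have hX : b ^ 2 * (κ * s ^ 2) ≤ 1 := by
    have : b ^ 2 * (κ * s ^ 2) ≤ b ^ 2 * ((1 + 4 * κ * s) * s) :=
      mul_le_mul_of_nonneg_left (by nlinarith [mul_pos hκ0 (mul_pos hs0 hs0)]) hb2.le
    linarith
  obtain ⟨h1, h2⟩ := remainder_rates hn0 hs0 hs1 (hms ▸ hlog) hb hκ0.le hZ.le hρ.le hC.le
    (hms.symm ▸ hZC) hX
  have hCη := mul_le_mul_of_nonneg_left hη hC.le
  set u := (1 + 4 * κ * s) * s with hu
  have hu0 : 0 < u := by positivity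
  have hS1 := (h1.trans hCη).trans hη1
  have hS2 : p * (300 * K) * (zMax z * (ρ * (b ^ 2 * zMax z * (n + κ ^ 2)) / n ^ 2)) ≤ u := by
    have h3 := h2.trans (mul_le_mul_of_nonneg_right hCη hu0.le)
    have h4 := mul_le_mul_of_nonneg_left h3 (by positivity : 0 ≤ p * (300 * K))
    have h5 := mul_le_mul_of_nonneg_right hη2 hu0.le
    linarith
  have hrate : 300 * K * (ρ * (b ^ 2 * zMax z * (n + κ ^ 2)) / n ^ 2)
      ≤ 300 * K * C * (ρ * tau n k ε b (zMax z) * Real.log n / n) := by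
    have h3 := second_order_le_tau hn0 hlog hb hκ0.le hZ.le hC.le hZC (hs2 ▸ hX)
    have h4 : 300 * K * C * (ρ * tau n k ε b (zMax z) * Real.log n / n) = 300 * K * (ρ *
        (C * (n * Real.log n * (b ^ 3 + κ * b ^ 3 + zMax z / √(Real.log n)))) / n ^ 2) := by
      rw [tau, ← hκ]; field_simp
    rw [h4]
    gcongr
  have hmain := noise_tail (by omega) hp hz hk hε hZ hb hw
    (abs_profile_le hn hz (by linarith) hvl hZ.le (fun i j t hij => abs_le_zMax hz i j t hij) hw)
    hK
  refine (measure_mono ?_).trans hmain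
  intro ω (hω : ¬_)
  refine fun hnoise => hω ?_
  obtain ⟨hfa, hfN, hqs⟩ := hnoise
  obtain ⟨β', γ', hβ', hγ', hF, hQ⟩ := solution_of_small_noise hn hp hz hb hvl hZ hρ hκ0 hK hw
    hHw hH hHinv hS1 hS2 hS3 hfa hfN hqs
  have hsol : SolvesMoment z ω β' γ' := by
    constructor
    · intro i
      have := hF i
      rw [degNoise] at this
      linarith
    · intro t
      have := hQ t
      rw [covNoise] at this
      linarith
  refine ⟨⟨β', γ', hsol⟩, fun β'' γ'' h => ?_⟩
  -- Uniqueness is global, so the solution found in the box is the only one and its bounds pass to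
  -- any other.
  obtain ⟨rfl, rfl⟩ := solution_unique hn hz (by positivity : 0 < 1 / b) hvl hH
    (β₁ := β'') (β₂ := β') (γ₁ := γ'') (γ₂ := γ')
    (fun i => (h.1 i).symm.trans (hsol.1 i)) fun t => (h.2 t).symm.trans (hsol.2 t)
  refine ⟨hβ'.trans (le_of_eq (by rw [mul_assoc b])), hγ'.trans hrate⟩

end DPBeta

/-! ### The asymptotic theorem. -/

theorem theorem1 (p : ℕ) (hp : 0 < p)
    (z : ∀ n : ℕ, Fin n → Fin n → Fin p → ℝ) (hz : ∀ n i j, z n i j = z n j i)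
    (βs : ∀ n : ℕ, Fin n → ℝ) (γs : ℕ → Fin p → ℝ)
    (k : ℕ → ℕ) (hk : ∀ n, 0 < k n) (ε : ℕ → ℝ) (hε : ∀ n, 0 < ε n)
    (r₁ r₂ : ℕ → ℝ) (hr₁ : ∀ n, 0 < r₁ n) (hr₂ : ∀ n, 0 < r₂ n)
    (b : ℕ → ℝ) (hb : ∀ n, b n = bSup (z n) (βs n) (γs n) (r₁ n) (r₂ n))
    (ρ : ℕ → ℝ)
    (hρ : ∀ᶠ n : ℕ in atTop, ∀ β ∈ Metric.closedBall (βs n) (r₁ n),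
      IsUnit (fisherH (z n) β (γs n)).det ∧
        rowSumNorm (fisherH (z n) β (γs n))⁻¹ ≤ ρ n / (n : ℝ) ^ 2)
    (τ : ℕ → ℝ) (hτ : ∀ n, τ n = tau n (k n) (ε n) (b n) (zMax (z n)))
    (hzlog : (fun n => zMax (z n)) =O[atTop] fun n : ℕ => Real.log n)
    (h1 : (fun n => b n ^ 2 * epsTilde n (k n) (ε n)) =o[atTop]
      fun n : ℕ => √((n : ℝ) / Real.log n))
    (h2 : (fun n => b n ^ 3 * ρ n ^ 2 * τ n * zMax (z n) ^ 2) =o[atTop]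
      fun n : ℕ => (n : ℝ) / Real.log n)
    (P : ∀ n : ℕ, Measure (Sample n p))
    (hP : ∀ n, P n = sampleLaw (z n) (βs n) (γs n) (k n) (ε n)) :
    Tendsto (fun n => P n {ω | ∃ β γ, SolvesMoment (z n) ω β γ}) atTop (𝓝 1) ∧
    ∀ (βh : ∀ n : ℕ, Sample n p → Fin n → ℝ) (γh : ∀ n : ℕ, Sample n p → Fin p → ℝ),
      (∀ n, IsMomentEstimator (z n) (βh n) (γh n)) →
      IsBigOP P (fun n ω => ‖γh n ω - γs n‖)
        (fun n : ℕ => ρ n * τ n * Real.log n / n) ∧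
      IsLittleOPOne P (fun n ω => ‖γh n ω - γs n‖) ∧
      IsBigOP P (fun n ω => ‖βh n ω - βs n‖)
        (fun n : ℕ => b n * epsTilde n (k n) (ε n) * √(Real.log n / n)) ∧
      IsLittleOPOne P (fun n ω => ‖βh n ω - βs n‖) := by
  have hp' : (0 : ℝ) < p := by exact_mod_cast hp
  -- the two conditions as limits
  set T1 : ℕ → ℝ := fun n => b n ^ 2 * epsTilde n (k n) (ε n) * √(Real.log n / n) with hT1def
  set T2 : ℕ → ℝ := fun n => b n ^ 3 * ρ n ^ 2 * τ n * zMax (z n) ^ 2 * (Real.log n / n)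
    with hT2def
  have hT1 : Tendsto T1 atTop (𝓝 0) := by
    refine h1.tendsto_div_nhds_zero.congr fun n => ?_
    rw [div_eq_mul_inv, ← Real.sqrt_inv, inv_div]
  have hT2 : Tendsto T2 atTop (𝓝 0) := by
    refine h2.tendsto_div_nhds_zero.congr fun n => ?_
    rw [div_eq_mul_inv, inv_div]
  -- The two error terms of `remainder_rates` have squares at most T2 and T1 · T2: the first uses b³
  -- ≤ τ, the second κb³ ≤ τ together with b²κs² ≤ T1.
  set η : ℕ → ℝ := fun n => √(T2 n) + √(T1 n * T2 n) with hηdef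
  have hη : Tendsto η atTop (𝓝 0) := by
    have h3 := (Real.continuous_sqrt.tendsto 0).comp hT2
    have h4 := (Real.continuous_sqrt.tendsto 0).comp (by simpa using hT1.mul hT2 :
      Tendsto (fun n => T1 n * T2 n) atTop (𝓝 0))
    simpa [Function.comp_def] using h3.add h4
  obtain ⟨C, hC, hCbound⟩ := hzlog.exists_pos
  -- facts valid for all large sample sizes
  have hbasic : ∀ᶠ n : ℕ in atTop, 8 ≤ n ∧ 1 ≤ b n ∧
      (∀ i j, i ≠ j → 1 / b n ≤ edgeVar (z n) (βs n) (γs n) i j) ∧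
      IsUnit (fisherH (z n) (βs n) (γs n)).det ∧
      rowSumNorm (fisherH (z n) (βs n) (γs n))⁻¹ ≤ ρ n / (n : ℝ) ^ 2 ∧
      1 ≤ ρ n * zMax (z n) ^ 2 ∧ 0 < zMax (z n) ∧ 0 < ρ n ∧
      zMax (z n) ≤ C * Real.log n := by
    filter_upwards [hρ, eventually_ge_atTop 8, hCbound.bound] with n hρn hn hZC
    have hbn : 1 ≤ b n := by rw [hb]; exact one_le_bSup (by omega) _ _ _ (hr₁ n) (hr₂ n)
    have hvl : ∀ i j, i ≠ j → 1 / b n ≤ edgeVar (z n) (βs n) (γs n) i j := fun i j hij => by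
      rw [hb]; exact one_div_bSup_le (by omega) _ _ _ (hr₁ n) (hr₂ n) i j hij
    obtain ⟨hH, hHinv⟩ := hρn (βs n) (Metric.mem_closedBall_self (hr₁ n).le)
    obtain ⟨w, hw, hHw⟩ := exists_profile hn (z n) (βs n) (γs n) (by positivity)
      (edgeVar_symm (hz n) _ _) hvl
    have hρZ := one_le_rho_mul_zMax_sq (by omega) hp (hz n) hw hHw hH hHinv
    have hZ0 := zMax_nonneg (z n)
    refine ⟨hn, hbn, hvl, hH, hHinv, hρZ, hZ0.lt_of_ne fun h => ?_, ?_, ?_⟩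
    · rw [← h] at hρZ
      norm_num at hρZ
    · by_contra h
      have := mul_nonpos_of_nonpos_of_nonneg (not_lt.1 h) (sq_nonneg (zMax (z n)))
      linarith
    · have hlog : 0 ≤ Real.log n := Real.log_natCast_nonneg n
      rwa [Real.norm_of_nonneg hZ0, Real.norm_of_nonneg hlog] at hZC
  have hrates : ∀ᶠ n : ℕ in atTop, 0 ≤ T1 n ∧ 0 ≤ ρ n * τ n * Real.log n / n ∧
      b n * epsTilde n (k n) (ε n) * √(Real.log n / n) ≤ T1 n ∧
      ρ n * τ n * Real.log n / n ≤ T2 n ∧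
      b n ^ 3 * ρ n * zMax (z n) * √(Real.log n / n)
        + b n ^ 4 * ρ n * zMax (z n) * (k n / ε n * (√(Real.log n / n)) ^ 2) ≤ η n := by
    filter_upwards [hbasic] with n hn
    obtain ⟨hn, hbn, -, -, -, hρZ, hZ, hρn, -⟩ := hn
    have hn0 : (0 : ℝ) < n := by exact_mod_cast (by omega : 0 < n)
    have hk' : (0 : ℝ) < k n := by exact_mod_cast hk n
    have hκ0 : 0 < k n / ε n := div_pos hk' (hε n)
    have hlog : 0 ≤ Real.log n := Real.log_natCast_nonneg n
    set κ := k n / ε n with hκ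
    set s := √(Real.log n / n) with hs
    have hs0 : 0 ≤ s := Real.sqrt_nonneg _
    have hs2 : s ^ 2 = Real.log n / n := Real.sq_sqrt (by positivity)
    have he : epsTilde n (k n) (ε n) = 1 + 4 * κ * s := by rw [epsTilde, mul_div_assoc]
    have hτn : τ n = b n ^ 3 + κ * b n ^ 3 + zMax (z n) / √(Real.log n) := by rw [hτ, tau]
    have hZl : 0 ≤ zMax (z n) / √(Real.log n) := by positivity
    have hτ0 : 0 ≤ τ n := by rw [hτn]; positivity
    have hτ1 : b n ^ 3 ≤ τ n := by
      rw [hτn]; have : 0 ≤ κ * b n ^ 3 := by positivity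
      linarith
    have hτ2 : κ * b n ^ 3 ≤ τ n := by
      rw [hτn]; have : 0 ≤ b n ^ 3 := by positivity
      linarith
    have hbb : b n ≤ b n ^ 2 := le_self_pow₀ hbn two_ne_zero
    have hT1n : T1 n = b n ^ 2 * (1 + 4 * κ * s) * s := by rw [hT1def]; simp only [he]; rfl
    have hT2n : T2 n = b n ^ 3 * ρ n ^ 2 * τ n * zMax (z n) ^ 2 * s ^ 2 := by rw [hs2]
    have hT10 : 0 ≤ T1 n := by rw [hT1n]; positivity
    refine ⟨hT10, by positivity, ?_, ?_, ?_⟩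
    · rw [hT1n, he]
      gcongr
    · have h3 : 1 ≤ b n ^ 3 * (ρ n * zMax (z n) ^ 2) :=
        one_le_mul_of_one_le_of_one_le (one_le_pow₀ hbn) hρZ
      have h4 := le_mul_of_one_le_left (by positivity : 0 ≤ ρ n * τ n * s ^ 2) h3
      rw [hT2n, mul_div_assoc, ← hs2]
      refine h4.trans (le_of_eq (by ring))
    · refine add_le_add (Real.le_sqrt_of_sq_le ?_) (Real.le_sqrt_of_sq_le ?_)
      · have h3 := mul_le_mul_of_nonneg_left hτ1
          (by positivity : 0 ≤ b n ^ 3 * ρ n ^ 2 * zMax (z n) ^ 2 * s ^ 2)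
        rw [hT2n]
        refine le_trans (le_of_eq (by ring)) (h3.trans (le_of_eq (by ring)))
      · have h3 := mul_le_mul_of_nonneg_left hτ2
          (by positivity : 0 ≤ b n ^ 3 * ρ n ^ 2 * zMax (z n) ^ 2 * s ^ 2)
        have h4 : b n ^ 2 * (κ * s ^ 2) ≤ T1 n := by
          rw [hT1n, mul_assoc]
          refine mul_le_mul_of_nonneg_left ?_ (by positivity)
          nlinarith [mul_nonneg hκ0.le (sq_nonneg s)]
        have h5 := mul_le_mul h4 h3 (by positivity) hT10
        rw [hT2n]
        refine le_trans (le_of_eq (by ring)) (h5.trans (le_of_eq (by ring)))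
  have hkey : ∀ δ : ℝ, 0 < δ → ∃ M : ℝ, 0 < M ∧ ∀ᶠ n in atTop,
      P n {ω | ¬GoodSample (z n) (βs n) (γs n)
        (64 * (b n * epsTilde n (k n) (ε n) * √(Real.log n / n)))
        (M * (ρ n * τ n * Real.log n / n)) ω} ≤ ENNReal.ofReal δ := by
    intro δ hδ
    set A : ℝ := 512 + p * (65538 + 256 * p ^ 2) with hA
    have hA0 : 0 < A := by positivity
    -- This K makes the Markov and Chebyshev terms at most A/K ≤ δ/2; the remaining 4/n is below δ/2
    -- for large n.
    set K : ℝ := 1 + 2 * A / δ with hK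
    have hK1 : 1 ≤ K := by
      have : 0 < 2 * A / δ := by positivity
      linarith
    have hK0 : 0 < K := by linarith
    have hKA : 512 / K + p * ((65538 + 256 * p ^ 2) / K ^ 2) ≤ δ / 2 := by
      have h3 : p * ((65538 + 256 * (p : ℝ) ^ 2) / K ^ 2) ≤ p * ((65538 + 256 * p ^ 2) / K) := by
        gcongr
        exact le_self_pow₀ hK1 two_ne_zero
      have h4 : 512 / K + p * ((65538 + 256 * (p : ℝ) ^ 2) / K) = A / K := by
        rw [hA]; ring
      have h5 : A / K ≤ δ / 2 := by
        rw [div_le_div_iff₀ hK0 two_pos, hK]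
        have : δ * (1 + 2 * A / δ) = δ + 2 * A := by field_simp
        rw [this]; linarith
      linarith
    have hCη : Tendsto (fun n => C * η n) atTop (𝓝 0) := by simpa using hη.const_mul C
    have hCη2 : Tendsto (fun n => p * (300 * K) * (C * η n)) atTop (𝓝 0) := by
      simpa using hCη.const_mul (p * (300 * K))
    have hninv : Tendsto (fun n : ℕ => 4 / (n : ℝ)) atTop (𝓝 0) :=
      tendsto_const_div_atTop_nhds_zero_nat 4
    refine ⟨300 * K * C, by positivity, ?_⟩
    filter_upwards [hbasic, hrates, hT1.eventually_le_const (by norm_num : (0 : ℝ) < 1 / 100000),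
      hCη.eventually_le_const (by positivity : 0 < 1 / (272 * p * K)),
      hCη2.eventually_le_const one_pos, hninv.eventually_le_const (half_pos hδ)]
      with n hn hr h3 h4 h5 h6
    obtain ⟨hn, hbn, hvl, hH, hHinv, -, -, -, hZC⟩ := hn
    obtain ⟨-, -, -, -, hηn⟩ := hr
    rw [hP, hτ]
    refine (measure_not_goodSample_le hn hp (hz n) (hk n) (hε n) hbn hvl hH hHinv hK0 hC hZC h3
      hηn h4 h5).trans (ENNReal.ofReal_le_ofReal ?_)
    linarith
  -- The Laplace noise has total mass one only for a positive scale, and `zMax` is known to be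
  -- positive only for large n.
  have hprob : ∀ᶠ n in atTop, IsProbabilityMeasure (P n) := by
    filter_upwards [hbasic] with n hn
    rw [hP]
    exact isProbabilityMeasure_sampleLaw hp _ _ _ (hk n) (hε n) hn.2.2.2.2.2.2.1
  refine ⟨?_, fun βh γh hest => ?_⟩
  · rw [ENNReal.tendsto_nhds ENNReal.one_ne_top]
    intro δ hδ
    obtain ⟨δ', hδ', hle⟩ : ∃ δ' : ℝ, 0 < δ' ∧ ENNReal.ofReal δ' ≤ δ := by
      rcases eq_or_ne δ ⊤ with rfl | hδ2
      · exact ⟨1, one_pos, le_top⟩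
      · exact ⟨δ.toReal, ENNReal.toReal_pos hδ.ne' hδ2, (ENNReal.ofReal_toReal hδ2).le⟩
    obtain ⟨M, -, hev⟩ := hkey δ' hδ'
    filter_upwards [hev, hprob] with n hn hpn
    refine ⟨?_, prob_le_one.trans le_self_add⟩
    -- The whole space is covered by the solvable samples and the bad ones; subadditivity then
    -- avoids any measurability of the solvable set.
    rw [tsub_le_iff_right, ← measure_univ (μ := P n)]
    refine (measure_mono fun ω _ => ?_).trans
      ((measure_union_le _ _).trans (add_le_add le_rfl (hn.trans hle)))
    by_cases hω : ∃ β γ, SolvesMoment (z n) ω β γ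
    · exact Or.inl hω
    · exact Or.inr fun hg => hω hg.1
  · have hγ : IsBigOP P (fun n ω => ‖γh n ω - γs n‖)
        (fun n : ℕ => ρ n * τ n * Real.log n / n) := by
      intro δ hδ
      obtain ⟨M, hM, hev⟩ := hkey δ hδ
      refine ⟨M, hM, ?_⟩
      filter_upwards [hev] with n hn
      refine (measure_mono ?_).trans hn
      intro ω (hω : _ < |‖γh n ω - γs n‖|) hg
      rw [abs_norm] at hω
      exact absurd (hg.2 _ _ (hest n ω hg.1)).2 (not_le.2 hω)
    have hβ : IsBigOP P (fun n ω => ‖βh n ω - βs n‖)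
        (fun n : ℕ => b n * epsTilde n (k n) (ε n) * √(Real.log n / n)) := by
      intro δ hδ
      obtain ⟨M, -, hev⟩ := hkey δ hδ
      -- The node radius does not depend on the confidence level; only the covariate radius grows
      -- with K.
      refine ⟨64, by norm_num, ?_⟩
      filter_upwards [hev] with n hn
      refine (measure_mono ?_).trans hn
      intro ω (hω : _ < |‖βh n ω - βs n‖|) hg
      rw [abs_norm] at hω
      exact absurd (hg.2 _ _ (hest n ω hg.1)).1 (not_le.2 hω)
    refine ⟨hγ, isLittleOPOne_of_isBigOP hγ ?_, hβ, isLittleOPOne_of_isBigOP hβ ?_⟩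
    · exact tendsto_of_tendsto_of_tendsto_of_le_of_le' tendsto_const_nhds hT2
        (hrates.mono fun n hn => hn.2.1) (hrates.mono fun n hn => hn.2.2.2.1)
    · refine tendsto_of_tendsto_of_tendsto_of_le_of_le' tendsto_const_nhds hT1
        (hbasic.mono fun n hn => ?_) (hrates.mono fun n hn => hn.2.2.1)
      have hb0 : 0 ≤ b n := by linarith [hn.2.1]
      have he0 : 0 ≤ epsTilde n (k n) (ε n) := by
        have := hε n
        unfold epsTilde
        positivity
      positivity
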